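/- Let $(M,g)$ be a simply connected Lorentzian manifold of dimension at least $2$ (smooth, Hausdorff, second countable; the signature is $(-,+,\dots,+)$, and a one-dimensional manifold with a negative definite metric also counts as Lorentzian). Let $\varepsilon\in\{1,-1\}$. Then the following two statements are equivalent. (1) There are a smooth connection $\nabla$ on $TM$ with $\nabla g=0$, a smooth complete vector field $\xi$ with $\varepsilon g(\xi,\xi)>0$ everywhere on $M$, and a 3-form $S\in\Omega^3(M)$ such that the torsion $T$ of $\nabla$ is parallel, $\nabla T=0$, and is twistor-free with vectorial component $\xi$ and skew-symmetric component $S$, that is, $$g(T(X,Y),Z)=g(X,\xi)\,g(Y,Z)-g(Y,\xi)\,g(X,Z)+S(X,Y,Z)$$ for all tangent vectors $X,Y,Z$ at a point. (2) $(M,g)$ is homothetic to a warped product $$\bigl(\mathbb R\times N,\ \varepsilon\,dt^2+e^{2\varepsilon t}g_N\bigr),$$ that is, $g=c\,f^*(\varepsilon\,dt^2+e^{2\varepsilon t}g_N)$ for a constant $c>0$ and a diffeomorphism $f:M\to\mathbb R\times N$, where $(N,g_N)$ is a manifold that is Riemannian if $\varepsilon=-1$ and Lorentzian if $\varepsilon=1$,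 and that carries a 3-form $\tau\in\Omega^3(N)$ (possibly zero) which is parallel for the Levi-Civita connection of $g_N$ and satisfies $\sigma_\tau=0$. Here $$\sigma_\tau(X,Y,Z)=\tau(\tau(X,Y),Z)+\tau(\tau(Y,Z),X)+\tau(\tau(Z,X),Y),$$ where $\tau(X,Y)$ is the vector defined by $g_N(\tau(X,Y),Z)=\tau(X,Y,Z)$. -/

import Mathlib

open scoped Manifold ContDiff Bundle

universe u

namespace TwistorFree

noncomputable section

section Tensors

variable {E : Type*} [NormedAddCommGroup E] [NormedSpace ℝ E]
  {H : Type*} [TopologicalSpace H] (I : ModelWithCorners ℝ E H)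
  (M : Type*) [TopologicalSpace M] [ChartedSpace H M]

/-- A vector field on `M`, not necessarily smooth. -/
abbrev VField : Type _ := (x : M) → TangentSpace I x

/-- A field of bilinear forms on the tangent spaces of `M`. -/
abbrev BilinField : Type _ := (x : M) → TangentSpace I x →L[ℝ] TangentSpace I x →L[ℝ] ℝ

/-- A field of trilinear forms on the tangent spaces of `M`. -/
abbrev TrilinField : Type _ :=
  (x : M) → TangentSpace I x →L[ℝ] TangentSpace I x →L[ℝ] TangentSpace I x →L[ℝ] ℝ

variable {I M}

/-- Smoothness of a vector field. -/
def IsSmoothVField [IsManifold I ∞ M] (X : VField I M) : Prop :=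
  ContMDiff I I.tangent ∞ (fun x => (Bundle.TotalSpace.mk' E x (X x) : TangentBundle I M))

/-- A pseudo-Riemannian metric: a smooth field of nondegenerate symmetric bilinear forms. -/
structure IsPseudoRiemannian [IsManifold I ∞ M] (g : BilinField I M) : Prop where
  smooth : ContMDiff I (I.prod 𝓘(ℝ, E →L[ℝ] E →L[ℝ] ℝ)) ∞
    (fun x => Bundle.TotalSpace.mk' (E →L[ℝ] E →L[ℝ] ℝ)
      (E := fun x => TangentSpace I x →L[ℝ] TangentSpace I x →L[ℝ] ℝ) x (g x))
  symm : ∀ (x : M) (v w : TangentSpace I x), g x v w = g x w v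
  nondegenerate : ∀ (x : M) (v : TangentSpace I x), (∀ w, g x v w = 0) → v = 0

/-- A Riemannian metric: positive definite on each tangent space. -/
structure IsRiemannian [IsManifold I ∞ M] (g : BilinField I M) : Prop
    extends IsPseudoRiemannian g where
  pos : ∀ (x : M) (v : TangentSpace I x), v ≠ 0 → 0 < g x v v

/-- A Lorentzian metric, of signature `(-, +, …, +)`: each tangent space contains a vector of
negative square on whose orthogonal complement the metric is positive definite. On a manifold of
dimension one this says that the metric is negative definite. -/
structure IsLorentzian [IsManifold I ∞ M] (g : BilinField I M) : Prop
    extends IsPseudoRiemannian g where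
  index_one : ∀ x : M, ∃ v : TangentSpace I x, g x v v < 0 ∧
    ∀ w : TangentSpace I x, g x v w = 0 → w ≠ 0 → 0 < g x w w

/-- A differential 3-form: a smooth field of alternating trilinear forms. Smoothness is
tested on smooth vector fields. -/
structure IsThreeForm [IsManifold I ∞ M] (τ : TrilinField I M) : Prop where
  smooth : ∀ X Y Z : VField I M, IsSmoothVField X → IsSmoothVField Y → IsSmoothVField Z →
    ContMDiff I 𝓘(ℝ, ℝ) ∞ (fun x => τ x (X x) (Y x) (Z x))
  swap_left : ∀ (x : M) (u v w : TangentSpace I x), τ x u v w = -τ x v u w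
  swap_right : ∀ (x : M) (u v w : TangentSpace I x), τ x u v w = -τ x u w v

open Classical in
/-- The vector metrically dual to a linear form `α`, characterised by `g (sharp α) w = α w`. -/
def sharp (g : BilinField I M) (x : M) (α : TangentSpace I x →L[ℝ] ℝ) : TangentSpace I x :=
  if h : ∃ v : TangentSpace I x, ∀ w, g x v w = α w then h.choose else 0

/-- For a pseudo-Riemannian metric `sharp` really is the metric dual. -/
theorem sharp_spec [FiniteDimensional ℝ E] [IsManifold I ∞ M] {g : BilinField I M}
    (hg : IsPseudoRiemannian g) (x : M) (α : TangentSpace I x →L[ℝ] ℝ) (w : TangentSpace I x) :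
    g x (sharp g x α) w = α w := by
  have h : ∃ v : TangentSpace I x, ∀ w, g x v w = α w := by
    have : FiniteDimensional ℝ (TangentSpace I x) := inferInstanceAs (FiniteDimensional ℝ E)
    let L : TangentSpace I x →ₗ[ℝ] Module.Dual ℝ (TangentSpace I x) :=
      { toFun := fun v => (g x v : TangentSpace I x →ₗ[ℝ] ℝ)
        map_add' := fun a b => by ext; simp
        map_smul' := fun a b => by ext; simp }
    have hinj : Function.Injective L := by
      refine (injective_iff_map_eq_zero L).2 fun v hv => hg.nondegenerate x v fun w => ?_
      exact LinearMap.congr_fun hv w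
    have hsurj : Function.Surjective L :=
      (LinearMap.injective_iff_surjective_of_finrank_eq_finrank
        (Subspace.dual_finrank_eq (K := ℝ) (V := TangentSpace I x)).symm).1 hinj
    obtain ⟨v, hv⟩ := hsurj (α : TangentSpace I x →ₗ[ℝ] ℝ)
    exact ⟨v, fun w => LinearMap.congr_fun hv w⟩
  rw [sharp, dif_pos h]
  exact h.choose_spec w

/-- The vector `τ(u, v)` defined by `g(τ(u, v), w) = τ(u, v, w)`. -/
def raise (g : BilinField I M) (τ : TrilinField I M) (x : M) (u v : TangentSpace I x) :
    TangentSpace I x :=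
  sharp g x (τ x u v)

/-- `σ_τ(u, v, w)`, the cyclic sum of `τ(τ(u, v), w)`. -/
def sigma (g : BilinField I M) (τ : TrilinField I M) (x : M) (u v w : TangentSpace I x) :
    TangentSpace I x :=
  raise g τ x (raise g τ x u v) w + raise g τ x (raise g τ x v w) u
    + raise g τ x (raise g τ x w u) v

/-- A complete vector field: every maximal integral curve is defined on all of `ℝ`. -/
def IsCompleteVField (X : VField I M) : Prop :=
  ∀ x : M, ∃ γ : ℝ → M, γ 0 = x ∧ IsMIntegralCurve γ X

end Tensors

section Connections

variable {E : Type*} [NormedAddCommGroup E] [NormedSpace ℝ E] [FiniteDimensional ℝ E]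
  {H : Type*} [TopologicalSpace H] {I : ModelWithCorners ℝ E H}
  {M : Type*} [TopologicalSpace M] [ChartedSpace H M] [IsManifold I ∞ M]

/-- A smooth affine connection on `M` with `∇ g = 0`. Here `D Y x v` is `(∇_v Y)(x)`. -/
structure IsMetricConnection (g : BilinField I M)
    (D : CovariantDerivative I E (TangentSpace I : M → Type _)) : Prop where
  smooth : D.ContMDiffCovariantDerivative ∞
  metric : ∀ Y Z : VField I M, IsSmoothVField Y → IsSmoothVField Z →
    ∀ (x : M) (v : TangentSpace I x),
      mvfderiv I (fun y => g y (Y y) (Z y)) x v = g x (D Y x v) (Z x) + g x (Y x) (D Z x v)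

/-- The Levi-Civita connection of `g`: the metric connection without torsion. -/
structure IsLeviCivita (g : BilinField I M)
    (D : CovariantDerivative I E (TangentSpace I : M → Type _)) : Prop
    extends IsMetricConnection g D where
  torsion_free : ∀ (x : M) (u v : TangentSpace I x), D.torsion x u v = 0

/-- `∇ T = 0` for the torsion `T` of the connection `∇`. -/
def HasParallelTorsion (D : CovariantDerivative I E (TangentSpace I : M → Type _)) : Prop :=
  ∀ Y Z : VField I M, IsSmoothVField Y → IsSmoothVField Z →
    ∀ (x : M) (v : TangentSpace I x),
      D (fun y => D.torsion y (Y y) (Z y)) x v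
        = D.torsion x (D Y x v) (Z x) + D.torsion x (Y x) (D Z x v)

/-- `∇ τ = 0` for a 3-form `τ`. -/
def IsParallelForm (D : CovariantDerivative I E (TangentSpace I : M → Type _))
    (τ : TrilinField I M) : Prop :=
  ∀ Y Z W : VField I M, IsSmoothVField Y → IsSmoothVField Z → IsSmoothVField W →
    ∀ (x : M) (v : TangentSpace I x),
      mvfderiv I (fun y => τ y (Y y) (Z y) (W y)) x v
        = τ x (D Y x v) (Z x) (W x) + τ x (Y x) (D Z x v) (W x) + τ x (Y x) (Z x) (D W x v)

/-- `τ` is parallel for the Levi-Civita connection of `g`. -/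
def IsLeviCivitaParallel (g : BilinField I M) (τ : TrilinField I M) : Prop :=
  ∃ D : CovariantDerivative I E (TangentSpace I : M → Type _),
    IsLeviCivita g D ∧ IsParallelForm D τ

/-- The torsion has zero twistorial component, vectorial component `ξ` and skew-symmetric
component `S`: it is `T(u, v) = (u ∧ v) ξ + S(u, v)`, with `(u ∧ v) ξ = g(u, ξ) v - g(v, ξ) u`;
both sides are paired with a third vector `w`. -/
def HasTorsionComponents (g : BilinField I M)
    (D : CovariantDerivative I E (TangentSpace I : M → Type _))
    (ξ : VField I M) (S : TrilinField I M) : Prop :=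
  ∀ (x : M) (u v w : TangentSpace I x),
    g x (D.torsion x u v) w = g x (g x u (ξ x) • v - g x v (ξ x) • u) w + S x u v w

/-- The torsion is twistor-free with vectorial component `ξ`. -/
def IsTwistorFreeWith (g : BilinField I M)
    (D : CovariantDerivative I E (TangentSpace I : M → Type _)) (ξ : VField I M) : Prop :=
  ∃ S : TrilinField I M, IsThreeForm S ∧ HasTorsionComponents g D ξ S

end Connections

section Maps

variable {E : Type*} [NormedAddCommGroup E] [NormedSpace ℝ E]
  {H : Type*} [TopologicalSpace H] {I : ModelWithCorners ℝ E H}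
  {M : Type*} [TopologicalSpace M] [ChartedSpace H M]
  {E' : Type*} [NormedAddCommGroup E'] [NormedSpace ℝ E']
  {H' : Type*} [TopologicalSpace H'] {J : ModelWithCorners ℝ E' H'}
  {N : Type*} [TopologicalSpace N] [ChartedSpace H' N]

/-- The pull-back of a field of bilinear forms. -/
def pullback (I : ModelWithCorners ℝ E H) (f : M → N) (h : BilinField J N) : BilinField I M :=
  fun x => (ContinuousLinearMap.precomp ℝ (mfderiv I J f x)).comp ((h (f x)).comp (mfderiv I J f x))

/-- The metric `dt²` of the real line. -/
def lineMetric : BilinField 𝓘(ℝ, ℝ) ℝ := fun _ => ContinuousLinearMap.mul ℝ ℝ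

/-- The warped product metric `ε dt² + e^{2εt} h` on `ℝ × N`. -/
def warpedProduct (ε : ℝ) (h : BilinField J N) : BilinField (𝓘(ℝ, ℝ).prod J) (ℝ × N) :=
  fun p => ε • pullback (𝓘(ℝ, ℝ).prod J) Prod.fst lineMetric p
    + Real.exp (2 * ε * p.1) • pullback (𝓘(ℝ, ℝ).prod J) Prod.snd h p

/-- `(M, g)` and `(N, h)` are homothetic: `g = c f^* h` for a constant `c > 0` and a smooth
diffeomorphism `f : M → N`. -/
def IsHomothetic (g : BilinField I M) (h : BilinField J N) : Prop :=
  ∃ (c : ℝ) (f : Diffeomorph I J M N ∞), 0 < c ∧ ∀ x : M, g x = c • pullback I f h x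

end Maps

end

end TwistorFree

universe v

namespace TwistorFree

open Bundle Set Filter Topology VectorField

set_option linter.unusedSectionVars false

section SmoothFields

variable {E : Type*} [NormedAddCommGroup E] [NormedSpace ℝ E] [FiniteDimensional ℝ E]
  {H : Type*} [TopologicalSpace H] {I : ModelWithCorners ℝ E H}
  {M : Type*} [TopologicalSpace M] [ChartedSpace H M] [IsManifold I ∞ M]

theorem IsSmoothVField.mdifferentiableAt {X : VField I M} (hX : IsSmoothVField X) (x : M) :
    MDifferentiableAt I I.tangent (fun y => (TotalSpace.mk' E y (X y) : TangentBundle I M)) x :=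
  (hX x).mdifferentiableAt (by simp)

theorem exists_isSmoothVField_eventuallyEq [T2Space M] {x : M} {Y : VField I M} {s : Set M}
    (hs : s ∈ 𝓝 x)
    (hY : ContMDiffOn I I.tangent ∞
      (fun y => (TotalSpace.mk' E y (Y y) : TangentBundle I M)) s) :
    ∃ X : VField I M, IsSmoothVField X ∧ ∀ᶠ y in 𝓝 x, X y = Y y := by
  obtain ⟨f, hf⟩ : ∃ f : SmoothBumpFunction I x, tsupport f ⊆ interior s := by
    obtain ⟨f, -, hf⟩ := (SmoothBumpFunction.nhds_basis_tsupport (I := I) x).mem_iff.1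
      (interior_mem_nhds.2 hs)
    exact ⟨f, hf⟩
  refine ⟨fun y => f y • Y y, fun y => ?_, ?_⟩
  · by_cases hy : y ∈ tsupport f
    · have h1 : ContMDiffAt I I.tangent ∞
          (fun y => (TotalSpace.mk' E y (Y y) : TangentBundle I M)) y :=
        (hY y (interior_subset (hf hy))).contMDiffAt (mem_interior_iff_mem_nhds.1 (hf hy))
      exact ContMDiffAt.smul_section f.contMDiff.contMDiffAt h1
    · have h0 : ContMDiffAt I I.tangent ∞
          (fun y => (TotalSpace.mk' E y (0 : TangentSpace I y) : TangentBundle I M)) y :=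
        Bundle.contMDiff_zeroSection ℝ (TangentSpace I : M → Type _) y
      refine h0.congr_of_eventuallyEq ?_
      filter_upwards [(isClosed_tsupport f).isOpen_compl.mem_nhds hy] with z hz
      rw [image_eq_zero_of_notMem_tsupport hz, zero_smul]
  · filter_upwards [f.eventuallyEq_one] with y hy
    simp [hy]

theorem exists_isSmoothVField_extend [T2Space M] {x : M} (v : TangentSpace I x) :
    ∃ X : VField I M, IsSmoothVField X ∧ X x = v ∧
      ∀ᶠ y in 𝓝 x, X y = FiberBundle.extend E v y := by
  obtain ⟨s, hs, h⟩ := FiberBundle.exists_contMDiffOn_extend (k := ∞) I E v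
  obtain ⟨X, hX, hXe⟩ := exists_isSmoothVField_eventuallyEq hs h
  exact ⟨X, hX, by rw [hXe.self_of_nhds, FiberBundle.extend_apply_self], hXe⟩

theorem exists_isSmoothVField_apply_eq [T2Space M] {x : M} (v : TangentSpace I x) :
    ∃ X : VField I M, IsSmoothVField X ∧ X x = v := by
  obtain ⟨X, hX, hx, -⟩ := exists_isSmoothVField_extend v
  exact ⟨X, hX, hx⟩

theorem exists_isSmoothVField_frame [T2Space M] (x : M) (w : E) :
    ∃ X : VField I M, IsSmoothVField X ∧
      ∀ᶠ y in 𝓝 x, X y = (trivializationAt E (TangentSpace I) x).symm y w := by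
  obtain ⟨X, hX, -, h⟩ := exists_isSmoothVField_extend
    ((trivializationAt E (TangentSpace I) x).symm x w)
  refine ⟨X, hX, ?_⟩
  filter_upwards [h] with y hy
  rw [hy]
  simp only [FiberBundle.extend]
  rw [Trivialization.mk_symm _ (FiberBundle.mem_baseSet_trivializationAt' x)]
  rw [Trivialization.apply_symm_apply]
  simp

theorem IsSmoothVField.add {X Y : VField I M} (hX : IsSmoothVField X) (hY : IsSmoothVField Y) :
    IsSmoothVField (fun x => X x + Y x) :=
  ContMDiff.add_section hX hY

theorem IsSmoothVField.smul {X : VField I M} {f : M → ℝ} (hf : ContMDiff I 𝓘(ℝ, ℝ) ∞ f)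
    (hX : IsSmoothVField X) : IsSmoothVField (fun x => f x • X x) :=
  ContMDiff.smul_section hf hX

scoped instance isManifold_minSmoothness_two : IsManifold I (minSmoothness ℝ 2) M := by
  simpa using inferInstanceAs (IsManifold I 2 M)

scoped instance isManifold_minSmoothness_three : IsManifold I (minSmoothness ℝ 3) M := by
  simpa using inferInstanceAs (IsManifold I 3 M)

theorem IsSmoothVField.mlieBracket {X Y : VField I M} (hX : IsSmoothVField X)
    (hY : IsSmoothVField Y) : IsSmoothVField (mlieBracket I X Y) := by
  intro x
  have : IsManifold I (((⊤ : ℕ∞) : WithTop ℕ∞) + 1) M := by simpa using ‹IsManifold I ∞ M›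
  exact ContMDiffAt.mlieBracket_vectorField (n := ⊤) (m := ⊤) (hX x) (hY x) (by simp)

theorem contMDiffAt_clm_of_apply {F : Type*} [NormedAddCommGroup F] [NormedSpace ℝ F]
    {f : M → E →L[ℝ] F} {x : M} {k : WithTop ℕ∞}
    (h : ∀ w, ContMDiffAt I 𝓘(ℝ, F) k (fun y => f y w) x) :
    ContMDiffAt I 𝓘(ℝ, E →L[ℝ] F) k f x := by
  let b := Module.finBasis ℝ E
  let L : Fin (Module.finrank ℝ E) → F →L[ℝ] E →L[ℝ] F := fun i =>
    ContinuousLinearMap.smulRightL ℝ E F (LinearMap.toContinuousLinearMap (b.coord i))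
  have hf : f = fun y => ∑ i, L i (f y (b i)) := by
    funext y
    ext w
    conv_lhs => rw [← b.sum_repr w]
    simp only [map_sum, map_smul, L, FunLike.coe_sum, Finset.sum_apply]
    rfl
  rw [hf]
  refine ContMDiffAt.sum fun i _ => ?_
  exact (L i).contMDiff.contMDiffAt.comp x (h (b i))

theorem contMDiff_bilinField [T2Space M] {b : BilinField I M}
    (h : ∀ X Y : VField I M, IsSmoothVField X → IsSmoothVField Y →
      ContMDiff I 𝓘(ℝ, ℝ) ∞ (fun x => b x (X x) (Y x))) :
    ContMDiff I (I.prod 𝓘(ℝ, E →L[ℝ] E →L[ℝ] ℝ)) ∞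
      (fun x => Bundle.TotalSpace.mk' (E →L[ℝ] E →L[ℝ] ℝ)
        (E := fun x => TangentSpace I x →L[ℝ] TangentSpace I x →L[ℝ] ℝ) x (b x)) := by
  intro x
  rw [contMDiffAt_hom_bundle]
  refine ⟨contMDiffAt_id, ?_⟩
  refine contMDiffAt_clm_of_apply fun v => contMDiffAt_clm_of_apply fun w => ?_
  obtain ⟨X, hX, hXe⟩ := exists_isSmoothVField_frame (I := I) x v
  obtain ⟨Y, hY, hYe⟩ := exists_isSmoothVField_frame (I := I) x w
  refine (h X Y hX hY x).congr_of_eventuallyEq ?_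
  have hb := (trivializationAt E (TangentSpace I) x).open_baseSet.mem_nhds
    (FiberBundle.mem_baseSet_trivializationAt' x)
  filter_upwards [hXe, hYe, hb] with y h1 h2 hy
  have := inCoordinates_apply_eq₂ (𝕜 := ℝ) (F₁ := E) (E₁ := (TangentSpace I : M → Type _))
    (F₂ := E) (E₂ := (TangentSpace I : M → Type _)) (F₃ := ℝ) (E₃ := Bundle.Trivial M ℝ)
    (ϕ := b y) (v := v) (w := w) hy hy (mem_univ y)
  refine this.trans ?_
  rw [h1, h2]
  simp

theorem contMDiff_homField [T2Space M]
    {A : (x : M) → TangentSpace I x →L[ℝ] TangentSpace I x}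
    (h : ∀ X : VField I M, IsSmoothVField X → IsSmoothVField (fun x => A x (X x))) :
    ContMDiff I (I.prod 𝓘(ℝ, E →L[ℝ] E)) ∞
      (fun x => Bundle.TotalSpace.mk' (E →L[ℝ] E)
        (E := fun x => TangentSpace I x →L[ℝ] TangentSpace I x) x (A x)) := by
  intro x
  rw [contMDiffAt_hom_bundle]
  refine ⟨contMDiffAt_id, ?_⟩
  refine contMDiffAt_clm_of_apply fun v => ?_
  obtain ⟨X, hX, hXe⟩ := exists_isSmoothVField_frame (I := I) x v
  have h0 := h X hX x
  rw [contMDiffAt_section] at h0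
  refine h0.congr_of_eventuallyEq ?_
  have hb := (trivializationAt E (TangentSpace I) x).open_baseSet.mem_nhds
    (FiberBundle.mem_baseSet_trivializationAt' x)
  filter_upwards [hXe, hb] with y h1 hy
  rw [ContinuousLinearMap.inCoordinates_eq hy hy, h1]
  rfl

theorem contMDiff_apply_bilinField {b : BilinField I M}
    (hb : ContMDiff I (I.prod 𝓘(ℝ, E →L[ℝ] E →L[ℝ] ℝ)) ∞
      (fun x => Bundle.TotalSpace.mk' (E →L[ℝ] E →L[ℝ] ℝ)
        (E := fun x => TangentSpace I x →L[ℝ] TangentSpace I x →L[ℝ] ℝ) x (b x)))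
    {X Y : VField I M} (hX : IsSmoothVField X) (hY : IsSmoothVField Y) :
    ContMDiff I 𝓘(ℝ, ℝ) ∞ (fun x => b x (X x) (Y x)) := by
  intro x
  have := ContMDiffAt.clm_bundle_apply₂ (F₁ := E) (F₂ := E) (F₃ := ℝ)
    (E₁ := (TangentSpace I : M → Type _)) (E₂ := (TangentSpace I : M → Type _))
    (E₃ := Bundle.Trivial M ℝ) (hb x) (hX x) (hY x)
  simpa [contMDiffAt_section] using this

theorem mdifferentiableAt_apply_bilinField {b : BilinField I M}
    (hb : ContMDiff I (I.prod 𝓘(ℝ, E →L[ℝ] E →L[ℝ] ℝ)) ∞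
      (fun x => Bundle.TotalSpace.mk' (E →L[ℝ] E →L[ℝ] ℝ)
        (E := fun x => TangentSpace I x →L[ℝ] TangentSpace I x →L[ℝ] ℝ) x (b x)))
    {X Y : VField I M} {x : M}
    (hX : MDifferentiableAt I I.tangent (fun y => (TotalSpace.mk' E y (X y) : TangentBundle I M)) x)
    (hY : MDifferentiableAt I I.tangent
      (fun y => (TotalSpace.mk' E y (Y y) : TangentBundle I M)) x) :
    MDifferentiableAt I 𝓘(ℝ, ℝ) (fun x => b x (X x) (Y x)) x := by
  have := MDifferentiableAt.clm_bundle_apply₂ (F₁ := E) (F₂ := E) (F₃ := ℝ)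
    (E₁ := (TangentSpace I : M → Type _)) (E₂ := (TangentSpace I : M → Type _))
    (E₃ := Bundle.Trivial M ℝ) ((hb x).mdifferentiableAt (by simp)) hX hY
  simpa [mdifferentiableAt_section] using this

theorem isSmoothVField_of_metric [T2Space M] {g : BilinField I M} (hg : IsPseudoRiemannian g)
    {X : VField I M} (h : ∀ W : VField I M, IsSmoothVField W →
      ContMDiff I 𝓘(ℝ, ℝ) ∞ (fun x => g x (X x) (W x))) : IsSmoothVField X := by
  intro x
  let e := trivializationAt E (TangentSpace I) x
  have hx : x ∈ e.baseSet := FiberBundle.mem_baseSet_trivializationAt' x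
  have hb := e.open_baseSet.mem_nhds hx
  rw [contMDiffAt_section]
  let G : M → E →L[ℝ] E →L[ℝ] ℝ := fun y =>
    ContinuousLinearMap.inCoordinates E (TangentSpace I) (E →L[ℝ] ℝ)
      (fun x => TangentSpace I x →L[ℝ] Bundle.Trivial M ℝ x) x y x y (g y)
  have hG : ContMDiffAt I 𝓘(ℝ, E →L[ℝ] E →L[ℝ] ℝ) ∞ G x :=
    ((contMDiffAt_hom_bundle _).1 (hg.smooth x)).2
  have hGapp : ∀ y ∈ e.baseSet, ∀ v w, G y v w = g y (e.symm y v) (e.symm y w) := by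
    intro y hy v w
    have := inCoordinates_apply_eq₂ (𝕜 := ℝ) (F₁ := E) (E₁ := (TangentSpace I : M → Type _))
      (F₂ := E) (E₂ := (TangentSpace I : M → Type _)) (F₃ := ℝ) (E₃ := Bundle.Trivial M ℝ)
      (ϕ := g y) (v := v) (w := w) hy hy (mem_univ y)
    refine this.trans ?_
    simp [e]
  have hsymm : ∀ y ∈ e.baseSet, ∀ v : TangentSpace I y, e.symm y (e ⟨y, v⟩).2 = v := by
    intro y hy v
    simpa using e.symm_proj_apply ⟨y, v⟩ hy
  have hinv : ∀ y ∈ e.baseSet, (G y).IsInvertible := by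
    intro y hy
    have hinj : Function.Injective (G y) := by
      refine (injective_iff_map_eq_zero (G y)).2 fun v hv => ?_
      have h0 : e.symm y v = 0 := by
        refine hg.nondegenerate y _ fun w => ?_
        rw [← hsymm y hy w, ← hGapp y hy, hv]
        rfl
      have h1 := e.continuousLinearEquivAt ℝ y hy |>.symm.injective
      apply h1
      rw [map_zero]
      exact h0
    have hdim : Module.finrank ℝ E = Module.finrank ℝ (E →L[ℝ] ℝ) := by
      rw [← (LinearMap.toContinuousLinearMap (𝕜 := ℝ) (E := E) (F' := ℝ)).finrank_eq]
      exact (Subspace.dual_finrank_eq (K := ℝ) (V := E)).symm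
    exact ⟨(LinearEquiv.ofInjectiveOfFinrankEq (G y : E →ₗ[ℝ] E →L[ℝ] ℝ) hinj
      hdim).toContinuousLinearEquiv, by ext; rfl⟩
  let α : M → E →L[ℝ] ℝ := fun y => G y (e ⟨y, X y⟩).2
  have hα : ContMDiffAt I 𝓘(ℝ, E →L[ℝ] ℝ) ∞ α x := by
    refine contMDiffAt_clm_of_apply fun w => ?_
    obtain ⟨W, hW, hWe⟩ := exists_isSmoothVField_frame (I := I) x w
    refine (h W hW x).congr_of_eventuallyEq ?_
    filter_upwards [hWe, hb] with y h1 hy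
    simp only [α]
    rw [hGapp y hy, hsymm y hy, h1]
  have hI : ContMDiffAt I 𝓘(ℝ, (E →L[ℝ] ℝ) →L[ℝ] E) ∞ (fun y => (G y).inverse) x := by
    obtain ⟨L, hL⟩ := hinv x hx
    have h1 : ContDiffAt ℝ ∞ ContinuousLinearMap.inverse (G x) := by
      rw [← hL]
      exact contDiffAt_map_inverse L
    exact h1.contMDiffAt.comp x hG
  have : ContMDiffAt I 𝓘(ℝ, E) ∞ (fun y => (G y).inverse (α y)) x := hI.clm_apply hα
  refine this.congr_of_eventuallyEq ?_
  filter_upwards [hb] with y hy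
  exact ((hinv y hy).inverse_apply_self _).symm

theorem mvfderiv_congr {F : Type*} [NormedAddCommGroup F] [NormedSpace ℝ F] {f f' : M → F}
    {x : M} (h : f =ᶠ[𝓝 x] f') : mvfderiv I f x = mvfderiv I f' x := by
  have h1 : mfderiv I 𝓘(ℝ, F) f x = mfderiv I 𝓘(ℝ, F) f' x := h.mfderiv_eq
  ext v
  exact DFunLike.congr_fun h1 v

theorem mvfderiv_mlieBracket [I.Boundaryless] {F : Type*} [NormedAddCommGroup F]
    [NormedSpace ℝ F] {f : M → F} {X Y : VField I M} {x : M}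
    (hf : ContMDiffAt I 𝓘(ℝ, F) 2 f x)
    (hX : MDifferentiableAt I I.tangent (fun y => (TotalSpace.mk' E y (X y) : TangentBundle I M)) x)
    (hY : MDifferentiableAt I I.tangent
      (fun y => (TotalSpace.mk' E y (Y y) : TangentBundle I M)) x) :
    mvfderiv I f x (mlieBracket I X Y x) =
      mvfderiv I (fun y => mvfderiv I f y (Y y)) x (X x)
        - mvfderiv I (fun y => mvfderiv I f y (X y)) x (Y x) := by
  set φ := extChartAt I x with hφ
  set z := φ x with hz
  let h : E → F := f ∘ φ.symm
  have hsrc : φ.source ∈ 𝓝 x := extChartAt_source_mem_nhds x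
  have hh : ContDiffAt ℝ 2 h z := by
    have := (contMDiffAt_iff.1 hf).2
    rw [I.range_eq_univ, contDiffWithinAt_univ] at this
    exact this
  have hcomp : ∀ {k : E → F} {y : M}, y ∈ φ.source → DifferentiableAt ℝ k (φ y) →
      ∀ v, mvfderiv I (k ∘ φ) y v = fderiv ℝ k (φ y) (mfderiv I 𝓘(ℝ, E) φ y v) := by
    intro k y hy hk v
    have hy' : y ∈ (chartAt H x).source := by simpa [hφ] using hy
    have h1 : MDifferentiableAt I 𝓘(ℝ, E) φ y := mdifferentiableAt_extChartAt hy'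
    have h2 : MDifferentiableAt 𝓘(ℝ, E) 𝓘(ℝ, F) k (φ y) := hk.mdifferentiableAt
    have := mfderiv_comp_apply y h2 h1 v
    rw [mfderiv_eq_fderiv] at this
    exact this
  let P : VField I M → E → E := fun Z => mpullbackWithin 𝓘(ℝ, E) I φ.symm Z (range I)
  have hpull : ∀ (Z : VField I M) (y : M), y ∈ φ.source →
      P Z (φ y) = mfderiv I 𝓘(ℝ, E) φ y (Z y) := by
    intro Z y hy
    have h1 : ∀ z' ∈ φ.target,
        P Z z' = (mfderiv I 𝓘(ℝ, E) φ (φ.symm z') (Z (φ.symm z')) : E) := by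
      intro z' hz'
      obtain ⟨B, hB⟩ := isInvertible_mfderivWithin_extChartAt_symm (I := I) (x := x) hz'
      have hAB := mfderiv_extChartAt_comp_mfderivWithin_extChartAt_symm (I := I) (x := x) hz'
      rw [← hB] at hAB
      have h2 : mfderiv I 𝓘(ℝ, E) φ (φ.symm z') (B (B.symm (Z (φ.symm z')))) =
          B.symm (Z (φ.symm z')) := DFunLike.congr_fun hAB (B.symm (Z (φ.symm z')))
      rw [B.apply_symm_apply] at h2
      simp only [P, mpullbackWithin_apply]
      rw [← hB, ContinuousLinearMap.inverse_equiv]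
      exact h2.symm
    have h2 := h1 (φ y) (φ.map_source hy)
    rwa [φ.left_inv hy] at h2
  have key : ∀ Z : VField I M, (fun y => mvfderiv I f y (Z y)) =ᶠ[𝓝 x]
      (fun z' => fderiv ℝ h z' (P Z z')) ∘ φ := by
    intro Z
    have hhn : ∀ᶠ y in 𝓝 x, DifferentiableAt ℝ h (φ y) := by
      have h1 : ∀ᶠ z' in 𝓝 z, DifferentiableAt ℝ h z' := by
        filter_upwards [hh.eventually (by simp)] with z' hz' using hz'.differentiableAt (by simp)
      exact (continuousAt_extChartAt x).eventually h1
    filter_upwards [hhn, hsrc, eventually_mem_nhds_iff.2 hsrc] with y hy hys hyn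
    have h1 : f =ᶠ[𝓝 y] h ∘ φ := by
      filter_upwards [hyn] with y' hy'
      simp [h, φ.left_inv hy']
    have h2 : mvfderiv I f y = mvfderiv I (h ∘ φ) y := mvfderiv_congr h1
    rw [h2, hcomp hys hy, ← hpull Z y hys]
    rfl
  have hdP : ∀ Z : VField I M, MDifferentiableAt I I.tangent
      (fun y => (TotalSpace.mk' E y (Z y) : TangentBundle I M)) x →
      DifferentiableAt ℝ (P Z) z := by
    intro Z hZ
    have : DifferentiableWithinAt ℝ (P Z) (φ.symm ⁻¹' univ ∩ range I) z :=
      MDifferentiableWithinAt.differentiableWithinAt_mpullbackWithin_vectorField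
        (s := univ) hZ.mdifferentiableWithinAt
    have hu : φ.symm ⁻¹' univ ∩ range I = univ := by simp [I.range_eq_univ]
    rw [hu, differentiableWithinAt_univ] at this
    exact this
  have hdh : DifferentiableAt ℝ (fderiv ℝ h) z :=
    (hh.fderiv_right (m := 1) (by norm_num)).differentiableAt (by simp)
  have hder : ∀ Z Z' : VField I M, MDifferentiableAt I I.tangent
      (fun y => (TotalSpace.mk' E y (Z y) : TangentBundle I M)) x →
      mvfderiv I (fun y => mvfderiv I f y (Z y)) x (Z' x) =
        fderiv ℝ (fderiv ℝ h) z (P Z' z) (P Z z) + fderiv ℝ h z (fderiv ℝ (P Z) z (P Z' z)) := by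
    intro Z Z' hZ
    have h2 : mvfderiv I (fun y => mvfderiv I f y (Z y)) x =
        mvfderiv I ((fun z' => fderiv ℝ h z' (P Z z')) ∘ φ) x := mvfderiv_congr (key Z)
    have hx : x ∈ φ.source := mem_extChartAt_source x
    rw [h2, hcomp hx (hdh.clm_apply (hdP Z hZ)), ← hpull Z' x hx]
    rw [fderiv_clm_apply hdh (hdP Z hZ)]
    simp [hz, add_comm]
  rw [hder Y X hY, hder X Y hX]
  have hsymm := (hh.isSymmSndFDerivAt (by simp)).eq (P X z) (P Y z)
  rw [hsymm]
  have hx : x ∈ φ.source := mem_extChartAt_source x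
  have hL : mvfderiv I f x (mlieBracket I X Y x) =
      fderiv ℝ h z (lieBracket ℝ (P X) (P Y) z) := by
    have h0 : mvfderiv I f x (mlieBracket I X Y x) =
        fderiv ℝ h z (P (mlieBracket I X Y) z) := (key (mlieBracket I X Y)).self_of_nhds
    rw [h0, hpull _ x hx]
    obtain ⟨B, hB⟩ := isInvertible_mfderiv_extChartAt (I := I) (x := x) hx
    let b : E := lieBracketWithin ℝ (P X) (P Y) (φ.symm ⁻¹' univ ∩ range I) z
    have h1 : mlieBracket I X Y x = B.symm b := by
      rw [mlieBracket, mlieBracketWithin_apply, ← hB, ContinuousLinearMap.inverse_equiv]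
      rfl
    have hu : φ.symm ⁻¹' univ ∩ range I = univ := by simp [I.range_eq_univ]
    have hb : lieBracket ℝ (P X) (P Y) z = b := by
      simp only [b]
      rw [hu, lieBracketWithin_univ]
    rw [hb, h1, hφ, ← hB]
    congr 1
    exact B.apply_symm_apply _
  rw [hL, lieBracket]
  simp

end SmoothFields

section LeviCivita

variable {E : Type*} [NormedAddCommGroup E] [NormedSpace ℝ E] [FiniteDimensional ℝ E]
  {H : Type*} [TopologicalSpace H] {I : ModelWithCorners ℝ E H}
  {M : Type*} [TopologicalSpace M] [ChartedSpace H M] [IsManifold I ∞ M]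

/-- Differentiability of a vector field at a point. -/
abbrev MDiffVFieldAt (X : VField I M) (x : M) : Prop :=
  MDifferentiableAt I I.tangent (fun y => (TotalSpace.mk' E y (X y) : TangentBundle I M)) x

/-- The function `g(X, Y)`. -/
noncomputable def pairing (g : BilinField I M) (X Y : VField I M) : M → ℝ := fun x => g x (X x) (Y x)

variable {g : BilinField I M}

theorem pairing_add_left (X X' Y : VField I M) :
    pairing g (X + X') Y = pairing g X Y + pairing g X' Y := by
  ext x; simp [pairing]

theorem pairing_add_right (X Y Y' : VField I M) :
    pairing g X (Y + Y') = pairing g X Y + pairing g X Y' := by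
  ext x; simp [pairing]

theorem pairing_smul_left (f : M → ℝ) (X Y : VField I M) :
    pairing g (f • X) Y = f * pairing g X Y := by
  ext x; simp [pairing]

theorem pairing_smul_right (f : M → ℝ) (X Y : VField I M) :
    pairing g X (f • Y) = f * pairing g X Y := by
  ext x; simp [pairing]

theorem IsPseudoRiemannian.mdifferentiableAt_pairing (hg : IsPseudoRiemannian g)
    {X Y : VField I M} {x : M} (hX : MDiffVFieldAt X x) (hY : MDiffVFieldAt Y x) :
    MDifferentiableAt I 𝓘(ℝ, ℝ) (pairing g X Y) x :=
  mdifferentiableAt_apply_bilinField hg.smooth hX hY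

theorem IsPseudoRiemannian.contMDiff_pairing (hg : IsPseudoRiemannian g)
    {X Y : VField I M} (hX : IsSmoothVField X) (hY : IsSmoothVField Y) :
    ContMDiff I 𝓘(ℝ, ℝ) ∞ (pairing g X Y) :=
  contMDiff_apply_bilinField hg.smooth hX hY

/-- The right hand side of the Koszul formula for `2 g(∇_V Y, W)`. -/
noncomputable def koszul (g : BilinField I M) (Y V W : VField I M) (x : M) : ℝ :=
  mvfderiv I (pairing g Y W) x (V x) + mvfderiv I (pairing g V W) x (Y x)
    - mvfderiv I (pairing g V Y) x (W x) + g x (mlieBracket I V Y x) (W x)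
    - g x (mlieBracket I V W x) (Y x) - g x (mlieBracket I Y W x) (V x)

theorem tensorialAt_koszul_left (hg : IsPseudoRiemannian g) {Y W : VField I M} {x : M}
    (hY : MDiffVFieldAt Y x) (hW : MDiffVFieldAt W x) :
    TensorialAt I E (fun V : VField I M => koszul g Y V W x) x where
  smul {f V} hf hV := by
    simp only [koszul, pairing_smul_left]
    rw [mvfderiv_mul hf (hg.mdifferentiableAt_pairing hV hW),
      mvfderiv_mul hf (hg.mdifferentiableAt_pairing hV hY),
      mlieBracket_smul_left hf hV, mlieBracket_smul_left hf hV]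
    simp [pairing]
    ring
  add {V V'} hV hV' := by
    simp only [koszul, pairing_add_left]
    rw [mvfderiv_add (hg.mdifferentiableAt_pairing hV hW) (hg.mdifferentiableAt_pairing hV' hW),
      mvfderiv_add (hg.mdifferentiableAt_pairing hV hY) (hg.mdifferentiableAt_pairing hV' hY),
      mlieBracket_add_left hV hV', mlieBracket_add_left hV hV']
    simp
    ring

theorem tensorialAt_koszul_right (hg : IsPseudoRiemannian g) {Y V : VField I M} {x : M}
    (hY : MDiffVFieldAt Y x) (hV : MDiffVFieldAt V x) :
    TensorialAt I E (fun W : VField I M => koszul g Y V W x) x where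
  smul {f W} hf hW := by
    simp only [koszul, pairing_smul_right]
    rw [mvfderiv_mul hf (hg.mdifferentiableAt_pairing hV hW),
      mvfderiv_mul hf (hg.mdifferentiableAt_pairing hY hW),
      mlieBracket_smul_right hf hW, mlieBracket_smul_right hf hW]
    simp [pairing, hg.symm x (W x)]
    ring
  add {W W'} hW hW' := by
    simp only [koszul, pairing_add_right]
    rw [mvfderiv_add (hg.mdifferentiableAt_pairing hV hW) (hg.mdifferentiableAt_pairing hV hW'),
      mvfderiv_add (hg.mdifferentiableAt_pairing hY hW) (hg.mdifferentiableAt_pairing hY hW'),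
      mlieBracket_add_right hW hW', mlieBracket_add_right hW hW']
    simp
    ring

theorem koszul_add (hg : IsPseudoRiemannian g) {Y Y' V W : VField I M} {x : M}
    (hY : MDiffVFieldAt Y x) (hY' : MDiffVFieldAt Y' x) (hV : MDiffVFieldAt V x)
    (hW : MDiffVFieldAt W x) :
    koszul g (Y + Y') V W x = koszul g Y V W x + koszul g Y' V W x := by
  simp only [koszul, pairing_add_left, pairing_add_right]
  rw [mvfderiv_add (hg.mdifferentiableAt_pairing hY hW) (hg.mdifferentiableAt_pairing hY' hW),
    mvfderiv_add (hg.mdifferentiableAt_pairing hV hY) (hg.mdifferentiableAt_pairing hV hY'),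
    mlieBracket_add_left hY hY', mlieBracket_add_right hY hY']
  simp
  ring

theorem koszul_smul (hg : IsPseudoRiemannian g) {f : M → ℝ} {Y V W : VField I M} {x : M}
    (hf : MDifferentiableAt I 𝓘(ℝ, ℝ) f x)
    (hY : MDiffVFieldAt Y x) (hV : MDiffVFieldAt V x) (hW : MDiffVFieldAt W x) :
    koszul g (f • Y) V W x =
      f x * koszul g Y V W x + 2 * (mvfderiv I f x (V x) * g x (Y x) (W x)) := by
  simp only [koszul, pairing_smul_left, pairing_smul_right]
  rw [mvfderiv_mul hf (hg.mdifferentiableAt_pairing hY hW),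
    mvfderiv_mul hf (hg.mdifferentiableAt_pairing hV hY),
    mlieBracket_smul_left hf hY, mlieBracket_smul_right hf hY]
  simp [pairing, hg.symm x (Y x) (V x)]
  ring

theorem IsPseudoRiemannian.isInvertible (hg : IsPseudoRiemannian g) (x : M) :
    (g x).IsInvertible := by
  have hfd : FiniteDimensional ℝ (TangentSpace I x) := inferInstanceAs (FiniteDimensional ℝ E)
  have ht2 : T2Space (TangentSpace I x) := inferInstanceAs (T2Space E)
  have hinj : Function.Injective (g x) :=
    (injective_iff_map_eq_zero (g x)).2 fun v hv => hg.nondegenerate x v fun w => by rw [hv]; rfl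
  have hdim : Module.finrank ℝ (TangentSpace I x) = Module.finrank ℝ (TangentSpace I x →L[ℝ] ℝ) := by
    rw [← (LinearMap.toContinuousLinearMap (𝕜 := ℝ) (E := TangentSpace I x) (F' := ℝ)).finrank_eq]
    exact (Subspace.dual_finrank_eq (K := ℝ) (V := TangentSpace I x)).symm
  let L := LinearEquiv.ofInjectiveOfFinrankEq
    (g x : TangentSpace I x →ₗ[ℝ] TangentSpace I x →L[ℝ] ℝ) hinj hdim
  exact ⟨L.toContinuousLinearEquiv, by ext; rfl⟩

theorem IsPseudoRiemannian.apply_inverse (hg : IsPseudoRiemannian g) (x : M)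
    (α : TangentSpace I x →L[ℝ] ℝ) : g x ((g x).inverse α) = α :=
  (hg.isInvertible x).self_apply_inverse α

theorem IsPseudoRiemannian.ext (hg : IsPseudoRiemannian g) {x : M} {v v' : TangentSpace I x}
    (h : ∀ w, g x v w = g x v' w) : v = v' :=
  sub_eq_zero.1 (hg.nondegenerate x _ fun w => by simp [h w])

open Classical in
/-- The Levi-Civita derivative of a vector field, given by the Koszul formula. -/
noncomputable def leviCivitaFun (hg : IsPseudoRiemannian g) (Y : VField I M) (x : M) :
    TangentSpace I x →L[ℝ] TangentSpace I x :=
  if hY : MDiffVFieldAt Y x then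
    (1 / 2 : ℝ) • (g x).inverse ∘L TensorialAt.mkHom₂ (fun V W => koszul g Y V W x) x
      (fun _ hW => tensorialAt_koszul_left hg hY hW)
      (fun _ hV => tensorialAt_koszul_right hg hY hV)
  else 0

theorem apply_leviCivitaFun (hg : IsPseudoRiemannian g) {Y V W : VField I M} {x : M}
    (hY : MDiffVFieldAt Y x) (hV : MDiffVFieldAt V x) (hW : MDiffVFieldAt W x) :
    g x (leviCivitaFun hg Y x (V x)) (W x) = 1 / 2 * koszul g Y V W x := by
  rw [leviCivitaFun, dif_pos hY]
  simp only [smul_apply, ContinuousLinearMap.comp_apply, map_smul,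
    hg.apply_inverse, smul_eq_mul]
  rw [TensorialAt.mkHom₂_apply _ _ hV hW]

/-- The Levi-Civita connection of a pseudo-Riemannian metric. -/
noncomputable def leviCivita (hg : IsPseudoRiemannian g) :
    CovariantDerivative I E (TangentSpace I : M → Type _) where
  toFun := leviCivitaFun hg
  isCovariantDerivativeOnUniv :=
    { add := by
        intro Y Y' x hY hY' _
        ext v
        refine hg.ext fun w => ?_
        have hV := FiberBundle.mdifferentiableAt_extend I E v
        have hW := FiberBundle.mdifferentiableAt_extend I E w
        have h1 := apply_leviCivitaFun hg (mdifferentiableAt_add_section hY hY') hV hW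
        have h2 := apply_leviCivitaFun hg hY hV hW
        have h3 := apply_leviCivitaFun hg hY' hV hW
        simp only [FiberBundle.extend_apply_self] at h1 h2 h3
        rw [koszul_add hg hY hY' hV hW] at h1
        rw [h1, add_apply, map_add, add_apply, h2, h3]
        ring
      leibniz := by
        intro Y f x hY hf _
        ext v
        refine hg.ext fun w => ?_
        have hV := FiberBundle.mdifferentiableAt_extend I E v
        have hW := FiberBundle.mdifferentiableAt_extend I E w
        have h1 := apply_leviCivitaFun hg (hf.smul_section hY) hV hW
        have h2 := apply_leviCivitaFun hg hY hV hW
        rw [koszul_smul hg hf hY hV hW] at h1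
        simp only [FiberBundle.extend_apply_self] at h1 h2
        rw [h1]
        simp [h2]
        ring }

theorem contMDiff_mvfderiv_apply {F : Type*} [NormedAddCommGroup F] [NormedSpace ℝ F]
    {f : M → F} {V : VField I M} (hf : ContMDiff I 𝓘(ℝ, F) ∞ f) (hV : IsSmoothVField V) :
    ContMDiff I 𝓘(ℝ, F) ∞ (fun x => mvfderiv I f x (V x)) := by
  have h1 : ContMDiff I.tangent 𝓘(ℝ, F).tangent ∞ (tangentMap I 𝓘(ℝ, F) f) :=
    hf.contMDiff_tangentMap (by simp)
  exact (contMDiff_snd_tangentBundle_modelSpace F 𝓘(ℝ, F)).comp (h1.comp hV)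

theorem contMDiff_koszul (hg : IsPseudoRiemannian g) {Y V W : VField I M}
    (hY : IsSmoothVField Y) (hV : IsSmoothVField V) (hW : IsSmoothVField W) :
    ContMDiff I 𝓘(ℝ, ℝ) ∞ (koszul g Y V W) := by
  have h1 := contMDiff_mvfderiv_apply (hg.contMDiff_pairing hY hW) hV
  have h2 := contMDiff_mvfderiv_apply (hg.contMDiff_pairing hV hW) hY
  have h3 := contMDiff_mvfderiv_apply (hg.contMDiff_pairing hV hY) hW
  have h4 := hg.contMDiff_pairing (hV.mlieBracket hY) hW
  have h5 := hg.contMDiff_pairing (hV.mlieBracket hW) hY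
  have h6 := hg.contMDiff_pairing (hY.mlieBracket hW) hV
  exact ((((h1.add h2).sub h3).add h4).sub h5).sub h6

theorem IsPseudoRiemannian.pairing_comm (hg : IsPseudoRiemannian g) (X Y : VField I M) :
    pairing g X Y = pairing g Y X :=
  funext fun x => hg.symm x _ _

theorem isLeviCivita_leviCivita [T2Space M] (hg : IsPseudoRiemannian g) :
    IsLeviCivita g (leviCivita hg) where
  smooth := by
    refine ⟨⟨fun {Y} hY => ?_⟩⟩
    have hY' : IsSmoothVField Y := by
      rw [contMDiffOn_univ] at hY
      exact hY
    rw [contMDiffOn_univ]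
    refine contMDiff_homField fun V hV => isSmoothVField_of_metric hg fun W hW => ?_
    have : (fun x => g x (leviCivitaFun hg Y x (V x)) (W x)) =
        fun x => 1 / 2 * koszul g Y V W x := by
      funext x
      exact apply_leviCivitaFun hg (hY'.mdifferentiableAt x) (hV.mdifferentiableAt x)
        (hW.mdifferentiableAt x)
    refine this ▸ ?_
    exact contMDiff_const.mul (contMDiff_koszul hg hY' hV hW)
  metric := by
    intro Y Z hY hZ x v
    have hV := FiberBundle.mdifferentiableAt_extend I E v
    have h1 := apply_leviCivitaFun hg (hY.mdifferentiableAt x) hV (hZ.mdifferentiableAt x)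
    have h2 := apply_leviCivitaFun hg (hZ.mdifferentiableAt x) hV (hY.mdifferentiableAt x)
    rw [hg.symm x (Y x)]
    change mvfderiv I (pairing g Y Z) x v =
      g x (leviCivitaFun hg Y x v) (Z x) + g x (leviCivitaFun hg Z x v) (Y x)
    rw [FiberBundle.extend_apply_self] at h1 h2
    rw [h1, h2, koszul, koszul, mlieBracket_swap_apply (V := Z) (W := Y), hg.pairing_comm Z Y,
      FiberBundle.extend_apply_self]
    simp
    ring
  torsion_free := by
    intro x u v
    refine hg.ext fun w => ?_
    have hU := FiberBundle.mdifferentiableAt_extend I E u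
    have hV := FiberBundle.mdifferentiableAt_extend I E v
    have hW := FiberBundle.mdifferentiableAt_extend I E w
    have h1 := apply_leviCivitaFun hg hU hV hW
    have h2 := apply_leviCivitaFun hg hV hU hW
    have h3 := (leviCivita hg).torsion_apply hU hV
    rw [koszul, mlieBracket_swap_apply (V := FiberBundle.extend E v),
      hg.pairing_comm (FiberBundle.extend E v) (FiberBundle.extend E u)] at h1
    rw [koszul] at h2
    simp only [FiberBundle.extend_apply_self] at h1 h2 h3
    rw [h3, map_sub, map_sub, sub_apply, sub_apply]
    change g x (leviCivitaFun hg (FiberBundle.extend E v) x u) w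
      - g x (leviCivitaFun hg (FiberBundle.extend E u) x v) w - _ = _
    rw [h1, h2]
    simp
    ring

end LeviCivita

section Nemytskii

variable {K : Type*} [TopologicalSpace K] [CompactSpace K]

/-- The pointwise extension of a bilinear map to continuous functions. -/
noncomputable def bilinCM (K : Type*) [TopologicalSpace K] [CompactSpace K]
    {G E F : Type*} [NormedAddCommGroup G] [NormedSpace ℝ G] [NormedAddCommGroup E]
    [NormedSpace ℝ E] [NormedAddCommGroup F] [NormedSpace ℝ F] (B : G →L[ℝ] E →L[ℝ] F) :
    C(K, G) →L[ℝ] C(K, E) →L[ℝ] C(K, F) :=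
  LinearMap.mkContinuous₂
    (LinearMap.mk₂ ℝ (fun (A : C(K, G)) (h : C(K, E)) =>
        (⟨fun t => B (A t) (h t), by fun_prop⟩ : C(K, F)))
      (fun _ _ _ => by ext; simp) (fun _ _ _ => by ext; simp)
      (fun _ _ _ => by ext; simp) (fun _ _ _ => by ext; simp)) ‖B‖ <| by
    intro A h
    refine (ContinuousMap.norm_le _ (by positivity)).2 fun t => ?_
    refine (B.le_opNorm₂ _ _).trans ?_
    gcongr
    exacts [A.norm_coe_le_norm t, h.norm_coe_le_norm t]

theorem hasFDerivAt_postcomp {G E F : Type*} [NormedAddCommGroup G] [NormedSpace ℝ G]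
    [NormedAddCommGroup E] [NormedSpace ℝ E] [NormedAddCommGroup F] [NormedSpace ℝ F]
    (B : G →L[ℝ] E →L[ℝ] F) (v : C(E, F)) (v' : C(E, G))
    (hv : ∀ x, HasFDerivAt v (B (v' x)) x) (γ : C(K, E)) :
    HasFDerivAt (fun γ : C(K, E) => v.comp γ) (bilinCM K B (v'.comp γ)) γ := by
  rw [hasFDerivAt_iff_isLittleO, Asymptotics.isLittleO_iff]
  intro c hc
  have hcont : Continuous (fun γ : C(K, E) => v'.comp γ) := v'.continuous_postcomp
  have hB : 0 < ‖B‖ + 1 := by positivity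
  obtain ⟨δ, hδ, h⟩ := Metric.continuous_iff.1 hcont γ (c / (‖B‖ + 1)) (by positivity)
  filter_upwards [Metric.ball_mem_nhds γ hδ] with η hη
  refine (ContinuousMap.norm_le _ (by positivity)).2 fun t => ?_
  have key : ‖v (η t) - v (γ t) - B (v' (γ t)) (η t - γ t)‖ ≤ c * ‖η t - γ t‖ := by
    refine Convex.norm_image_sub_le_of_norm_hasFDerivWithin_le' (s := segment ℝ (γ t) (η t))
      (f' := fun x => B (v' x)) (fun x _ => (hv x).hasFDerivWithinAt) ?_ (convex_segment _ _)
      (left_mem_segment ℝ _ _) (right_mem_segment ℝ _ _)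
    rw [segment_eq_image']
    rintro _ ⟨r, hr, rfl⟩
    have h1 : dist (γ + r • (η - γ)) γ < δ := by
      rw [dist_eq_norm, add_sub_cancel_left, norm_smul, Real.norm_of_nonneg hr.1]
      rw [Metric.mem_ball, dist_eq_norm] at hη
      nlinarith [norm_nonneg (η - γ), hr.2]
    have h2 := (h _ h1).le
    rw [dist_eq_norm] at h2
    have h3 := (((v'.comp (γ + r • (η - γ)) - v'.comp γ).norm_coe_le_norm t)).trans h2
    rw [← map_sub]
    refine (B.le_opNorm _).trans ?_
    rw [le_div_iff₀ hB] at h3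
    refine le_trans ?_ h3
    rw [mul_comm]
    exact mul_le_mul_of_nonneg_left (by linarith) (norm_nonneg _)
  refine key.trans ?_
  gcongr
  exact (η - γ).norm_coe_le_norm t

theorem contDiff_postcomp_nat {E : Type u} [NormedAddCommGroup E] [NormedSpace ℝ E] (n : ℕ) :
    ∀ {F : Type u} [NormedAddCommGroup F] [NormedSpace ℝ F] (v : C(E, F)), ContDiff ℝ n v →
      ContDiff ℝ n (fun γ : C(K, E) => v.comp γ) := by
  induction n with
  | zero =>
    intro F _ _ v _
    simpa using v.continuous_postcomp
  | succ n ih =>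
    intro F _ _ v hv
    push_cast at hv ⊢
    rw [contDiff_succ_iff_hasFDerivAt] at hv ⊢
    obtain ⟨v', hv', h⟩ := hv
    let V' : C(E, E →L[ℝ] F) := ⟨v', hv'.continuous⟩
    let B := bilinCM K (ContinuousLinearMap.id ℝ (E →L[ℝ] F))
    exact ⟨fun γ => B (V'.comp γ), B.contDiff.comp (ih V' hv'),
      fun γ => hasFDerivAt_postcomp (.id ℝ (E →L[ℝ] F)) v V' h γ⟩

theorem contDiff_postcomp {E : Type u} [NormedAddCommGroup E] [NormedSpace ℝ E]
    {F : Type u} [NormedAddCommGroup F] [NormedSpace ℝ F] (v : C(E, F)) (hv : ContDiff ℝ ∞ v) :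
    ContDiff ℝ ∞ (fun γ : C(K, E) => v.comp γ) :=
  contDiff_infty.2 fun n => contDiff_postcomp_nat n v (contDiff_infty.1 hv n)

end Nemytskii

section LocalFlow

variable {E : Type u} [NormedAddCommGroup E] [NormedSpace ℝ E] [CompleteSpace E]

/-- The primitive vanishing at `0` of a curve on `[-1, 1]`. -/
noncomputable def primitiveCM (E : Type*) [NormedAddCommGroup E] [NormedSpace ℝ E]
    [CompleteSpace E] : C(Icc (-1 : ℝ) 1, E) →L[ℝ] C(Icc (-1 : ℝ) 1, E) :=
  LinearMap.mkContinuous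
    { toFun := fun γ => ⟨fun t => ∫ s in (0 : ℝ)..t, IccExtend (by norm_num) γ s, by
        have h : Continuous (IccExtend (by norm_num : (-1 : ℝ) ≤ 1) γ) := γ.continuous.Icc_extend'
        exact (intervalIntegral.continuous_primitive (fun a b => h.intervalIntegrable a b) 0).comp
          continuous_subtype_val⟩
      map_add' := by
        intro γ η
        ext t
        have h : ∀ γ : C(Icc (-1 : ℝ) 1, E), Continuous (IccExtend (by norm_num : (-1 : ℝ) ≤ 1) γ) :=
          fun γ => γ.continuous.Icc_extend'
        exact intervalIntegral.integral_add ((h γ).intervalIntegrable _ _)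
          ((h η).intervalIntegrable _ _)
      map_smul' := by
        intro c γ
        ext t
        exact intervalIntegral.integral_smul c _ } 1 <| by
    intro γ
    refine (ContinuousMap.norm_le _ (by positivity)).2 fun t => ?_
    have h := intervalIntegral.norm_integral_le_of_norm_le_const (a := 0) (b := (t : ℝ)) (C := ‖γ‖)
      (f := IccExtend (by norm_num : (-1 : ℝ) ≤ 1) γ) (fun s _ => γ.norm_coe_le_norm _)
    refine h.trans ?_
    have ht : |(t : ℝ) - 0| ≤ 1 := by
      rw [sub_zero, abs_le]; exact t.2
    nlinarith [norm_nonneg γ]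

theorem primitiveCM_apply (γ : C(Icc (-1 : ℝ) 1, E)) (t : Icc (-1 : ℝ) 1) :
    primitiveCM E γ t = ∫ s in (0 : ℝ)..t, IccExtend (by norm_num : (-1 : ℝ) ≤ 1) γ s := rfl

theorem hasDerivAt_primitiveCM (γ : C(Icc (-1 : ℝ) 1, E)) {t : ℝ} (ht : t ∈ Ioo (-1 : ℝ) 1) :
    HasDerivAt (IccExtend (by norm_num : (-1 : ℝ) ≤ 1) (primitiveCM E γ))
      (γ ⟨t, Ioo_subset_Icc_self ht⟩) t := by
  have h : Continuous (IccExtend (by norm_num : (-1 : ℝ) ≤ 1) γ) := γ.continuous.Icc_extend'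
  have h1 := (h.integral_hasStrictDerivAt 0 t).hasDerivAt
  rw [IccExtend_of_mem _ _ (Ioo_subset_Icc_self ht)] at h1
  refine h1.congr_of_eventuallyEq ?_
  filter_upwards [Ioo_mem_nhds ht.1 ht.2] with s hs
  rw [IccExtend_of_mem _ _ (Ioo_subset_Icc_self hs), primitiveCM_apply]

/-- Smooth dependence on initial values: the solutions `γ` of `γ' = s v(γ)`, `γ(0) = x`. -/
theorem exists_contDiffAt_localFlow {v : E → E} (hv : ContDiff ℝ ∞ v) (x₀ : E) :
    ∃ ψ : ℝ × E → ℝ → E,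
      (∀ᶠ p in 𝓝 ((0 : ℝ), x₀), ψ p 0 = p.2 ∧
        ∀ t ∈ Ioo (-1 : ℝ) 1, HasDerivAt (ψ p) (p.1 • v (ψ p t)) t) ∧
      ContDiffAt ℝ ∞ (fun p => ψ p (1 / 2)) (0, x₀) ∧
      ∀ U ∈ 𝓝 x₀, ∀ᶠ p in 𝓝 ((0 : ℝ), x₀), ∀ t, ψ p t ∈ U := by
  let V : C(E, E) := ⟨v, hv.continuous⟩
  let K := Icc (-1 : ℝ) 1
  let cst : E →L[ℝ] C(K, E) := ContinuousLinearMap.const ℝ K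
  let f : (ℝ × E) × C(K, E) → C(K, E) := fun u =>
    u.2 - cst u.1.2 - u.1.1 • primitiveCM E (V.comp u.2)
  have hf : ContDiff ℝ ∞ f := by
    have h1 : ContDiff ℝ ∞ (fun u : (ℝ × E) × C(K, E) => V.comp u.2) :=
      (contDiff_postcomp V hv).comp contDiff_snd
    have h2 := (primitiveCM E).contDiff.comp h1
    have h3 : ContDiff ℝ ∞ (fun u : (ℝ × E) × C(K, E) => cst u.1.2) :=
      cst.contDiff.comp (contDiff_snd.comp contDiff_fst)
    exact (contDiff_snd.sub h3).sub ((contDiff_fst.comp contDiff_fst).smul h2)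
  let u₀ : (ℝ × E) × C(K, E) := ((0, x₀), cst x₀)
  have hf0 : f u₀ = 0 := by simp [f, u₀]
  have hcdf : ContDiffAt ℝ ∞ f u₀ := hf.contDiffAt
  have hd : fderiv ℝ f u₀ ∘L .inr ℝ (ℝ × E) C(K, E) = .id ℝ _ := by
    have h1 : HasFDerivAt (fun γ : C(K, E) => f (u₀.1, γ))
        (fderiv ℝ f u₀ ∘L .inr ℝ (ℝ × E) C(K, E)) u₀.2 :=
      HasFDerivAt.comp u₀.2 (hcdf.differentiableAt (by simp)).hasFDerivAt
        (hasFDerivAt_prodMk_right u₀.1 u₀.2)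
    have h2 : (fun γ : C(K, E) => f (u₀.1, γ)) = fun γ => γ - cst x₀ := by
      funext γ; simp [f, u₀]
    rw [h2] at h1
    exact h1.unique ((hasFDerivAt_id _).sub_const _)
  have hinv : (fderiv ℝ f u₀ ∘L .inr ℝ (ℝ × E) C(K, E)).IsInvertible := by
    rw [hd]
    exact ⟨ContinuousLinearEquiv.refl ℝ _, rfl⟩
  have hne : (∞ : WithTop ℕ∞) ≠ 0 := by simp
  let Ψ : ℝ × E → C(K, E) := hcdf.implicitFunction hne hinv
  have hΨ : ContDiffAt ℝ ∞ Ψ (0, x₀) := hcdf.contDiffAt_implicitFunction hne hinv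
  have hΨ0 : Ψ (0, x₀) = cst x₀ := hcdf.implicitFunction_apply_self hne hinv
  have hle : (-1 : ℝ) ≤ 1 := by norm_num
  have hΨe : ∀ᶠ p in 𝓝 ((0 : ℝ), x₀), f (p, Ψ p) = f u₀ :=
    hcdf.eventually_apply_implicitFunction hne hinv
  refine ⟨fun p => IccExtend hle (Ψ p), ?_, ?_, ?_⟩
  · filter_upwards [hΨe] with p hp
    rw [hf0] at hp
    have hp' : Ψ p = cst p.2 + p.1 • primitiveCM E (V.comp (Ψ p)) := by
      have : Ψ p - cst p.2 - p.1 • primitiveCM E (V.comp (Ψ p)) = 0 := hp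
      rw [sub_sub, sub_eq_zero] at this
      exact this
    refine ⟨?_, fun t ht => ?_⟩
    · rw [IccExtend_of_mem hle _ (by norm_num : (0 : ℝ) ∈ Icc (-1 : ℝ) 1), hp']
      have hz : ∀ η : C(K, E), primitiveCM E η ⟨0, by norm_num⟩ = 0 :=
        fun η => intervalIntegral.integral_same
      rw [ContinuousMap.add_apply, ContinuousMap.smul_apply, hz, smul_zero, add_zero]
      rfl
    · have h1 := (hasDerivAt_primitiveCM (V.comp (Ψ p)) ht).const_smul p.1 |>.const_add p.2
      rw [IccExtend_of_mem hle _ (Ioo_subset_Icc_self ht)]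
      refine h1.congr_of_eventuallyEq (Eventually.of_forall fun s => ?_)
      exact congrArg (fun γ : C(K, E) => γ (projIcc (-1) 1 hle s)) hp'
  · have h1 := (ContinuousMap.evalCLM ℝ (⟨1 / 2, by norm_num, by norm_num⟩ : K)
      : C(K, E) →L[ℝ] E).contDiff.contDiffAt.comp (0, x₀) hΨ
    refine h1.congr_of_eventuallyEq (Eventually.of_forall fun p => ?_)
    exact IccExtend_of_mem hle _ _
  · intro U hU
    obtain ⟨δ, hδ, hδU⟩ := Metric.mem_nhds_iff.1 hU
    have h1 := hΨ.continuousAt.eventually (Metric.ball_mem_nhds _ hδ)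
    filter_upwards [h1] with p hp t
    refine hδU ?_
    rw [hΨ0] at hp
    exact (ContinuousMap.dist_apply_le_dist (f := Ψ p) (g := cst x₀) _).trans_lt hp

end LocalFlow

section Flow

variable {E : Type u} [NormedAddCommGroup E] [NormedSpace ℝ E] [FiniteDimensional ℝ E]
  {H : Type*} [TopologicalSpace H] {I : ModelWithCorners ℝ E H}
  {M : Type*} [TopologicalSpace M] [ChartedSpace H M] [IsManifold I ∞ M]

theorem exists_localRepresentative [I.Boundaryless] {ξ : VField I M} (hξ : IsSmoothVField ξ)
    (x₀ : M) :
    ∃ v : E → E, ContDiff ℝ ∞ v ∧ ∀ᶠ z in 𝓝 (extChartAt I x₀ x₀),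
      v z = mfderiv I 𝓘(ℝ, E) (extChartAt I x₀) ((extChartAt I x₀).symm z)
        (ξ ((extChartAt I x₀).symm z)) := by
  set φ := extChartAt I x₀ with hφ
  let e := trivializationAt E (TangentSpace I) x₀
  let v₀ : E → E := fun z => (e ⟨φ.symm z, ξ (φ.symm z)⟩).2
  have hopen : IsOpen φ.target := isOpen_extChartAt_target x₀
  have hmaps : ∀ z ∈ φ.target, φ.symm z ∈ e.baseSet := by
    intro z hz
    have := φ.map_target hz
    simpa [e, hφ] using this
  have hv₀ : ContDiffOn ℝ ∞ v₀ φ.target := by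
    have h1 : ContMDiffOn I 𝓘(ℝ, E) ∞ (fun x => (e ⟨x, ξ x⟩).2) e.baseSet :=
      e.contMDiffOn_section_baseSet_iff.1 (ContMDiff.contMDiffOn hξ)
    have h2 : ContMDiffOn 𝓘(ℝ, E) I ∞ φ.symm φ.target := contMDiffOn_extChartAt_symm x₀
    exact (h1.comp h2 hmaps).contDiffOn
  have hz₀ : φ x₀ ∈ φ.target := mem_extChartAt_target x₀
  obtain ⟨r, hr, hrt⟩ := Metric.nhds_basis_closedBall.mem_iff.1 (hopen.mem_nhds hz₀)
  let b : ContDiffBump (φ x₀) := ⟨r / 2, r, by positivity, by linarith⟩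
  refine ⟨fun z => b z • v₀ z, ?_, ?_⟩
  · rw [contDiff_iff_contDiffAt]
    intro z
    by_cases hz : z ∈ Metric.closedBall (φ x₀) r
    · exact b.contDiffAt.smul (hv₀.contDiffAt (hopen.mem_nhds (hrt hz)))
    · refine (contDiffAt_const (c := (0 : E))).congr_of_eventuallyEq ?_
      filter_upwards [Metric.isClosed_closedBall.isOpen_compl.mem_nhds hz] with y hy
      have : b y = 0 := by
        have h1 : y ∉ Function.support b := by
          rw [b.support_eq]
          exact fun h => hy (Metric.ball_subset_closedBall h)
        simpa using h1
      rw [this, zero_smul]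
  · filter_upwards [b.eventuallyEq_one, hopen.mem_nhds hz₀] with z hz hzt
    have hs : φ.symm z ∈ (chartAt H x₀).source := by
      simpa [hφ] using φ.map_target hzt
    rw [hz, Pi.one_apply, one_smul, ← TangentBundle.continuousLinearMapAt_trivializationAt hs]
    exact (e.continuousLinearMapAt_apply_of_mem ℝ (hmaps z hzt) _).symm

theorem hasMFDerivAt_extChartAt_symm_comp [I.Boundaryless] {x₀ : M} {c : ℝ → E} {t : ℝ}
    (ht : c t ∈ (extChartAt I x₀).target)
    {w : TangentSpace I ((extChartAt I x₀).symm (c t))}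
    (hc : HasDerivAt c (mfderiv I 𝓘(ℝ, E) (extChartAt I x₀) ((extChartAt I x₀).symm (c t)) w) t) :
    HasMFDerivAt 𝓘(ℝ, ℝ) I (fun s => (extChartAt I x₀).symm (c s)) t
      ((1 : ℝ →L[ℝ] ℝ).smulRight w) := by
  let φ := extChartAt I x₀
  have h1 : MDifferentiableAt 𝓘(ℝ, E) I φ.symm (c t) := by
    have := mdifferentiableWithinAt_extChartAt_symm (I := I) ht
    rwa [I.range_eq_univ, mdifferentiableWithinAt_univ] at this
  have h2 : HasMFDerivAt 𝓘(ℝ, ℝ) 𝓘(ℝ, E) c t _ := hc.hasFDerivAt.hasMFDerivAt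
  have h3 := h1.hasMFDerivAt.comp t h2
  have h4 := mfderivWithin_extChartAt_symm_comp_mfderiv_extChartAt (I := I) ht
  rw [I.range_eq_univ, mfderivWithin_univ] at h4
  have h5 : mfderiv 𝓘(ℝ, E) I φ.symm (c t) (mfderiv I 𝓘(ℝ, E) φ (φ.symm (c t)) w) = w :=
    DFunLike.congr_fun h4 w
  refine h3.congr_mfderiv ?_
  ext
  have : (mfderiv 𝓘(ℝ, E) I φ.symm (c t)) ((1 : ℝ) • mfderiv I 𝓘(ℝ, E) φ (φ.symm (c t)) w)
      = (1 : ℝ) • w := by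
    rw [one_smul, one_smul, h5]
  exact this

/-- A global flow of the vector field `ξ`. -/
structure IsGlobalFlow (ξ : VField I M) (Φ : ℝ → M → M) : Prop where
  zero : ∀ x, Φ 0 x = x
  integralCurve : ∀ x, IsMIntegralCurve (fun t => Φ t x) ξ

theorem IsCompleteVField.exists_isGlobalFlow {ξ : VField I M} (hξ : IsCompleteVField ξ) :
    ∃ Φ, IsGlobalFlow ξ Φ := by
  choose γ h0 h1 using hξ
  exact ⟨fun t x => γ x t, h0, h1⟩

variable [T2Space M] [I.Boundaryless] {ξ : VField I M} {Φ : ℝ → M → M}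

theorem IsGlobalFlow.eq_of_isMIntegralCurve (hΦ : IsGlobalFlow ξ Φ) (hξ : IsSmoothVField ξ)
    {γ : ℝ → M} (hγ : IsMIntegralCurve γ ξ) (t : ℝ) : γ t = Φ t (γ 0) := by
  have := isMIntegralCurve_Ioo_eq_of_contMDiff_boundaryless (t₀ := 0)
    (ContMDiff.of_le hξ (by simp)) hγ (hΦ.integralCurve (γ 0)) (hΦ.zero _).symm
  exact congrFun this t

theorem IsGlobalFlow.add (hΦ : IsGlobalFlow ξ Φ) (hξ : IsSmoothVField ξ) (s t : ℝ) (x : M) :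
    Φ (s + t) x = Φ s (Φ t x) := by
  have h := hΦ.eq_of_isMIntegralCurve hξ ((hΦ.integralCurve x).comp_add t) s
  simpa using h

theorem IsGlobalFlow.contMDiffAt_zero (hΦ : IsGlobalFlow ξ Φ) (hξ : IsSmoothVField ξ) (x₀ : M) :
    ContMDiffAt (𝓘(ℝ, ℝ).prod I) I ∞ (fun p : ℝ × M => Φ p.1 p.2) (0, x₀) := by
  set φ := extChartAt I x₀ with hφ
  obtain ⟨v, hv, hve⟩ := exists_localRepresentative hξ x₀
  have hopen : IsOpen φ.target := isOpen_extChartAt_target x₀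
  have hz₀ : φ x₀ ∈ φ.target := mem_extChartAt_target x₀
  obtain ⟨ψ, hψ1, hψ2, hψ3⟩ := exists_contDiffAt_localFlow hv (φ x₀)
  have hψ4 := hψ3 _ (hve.and (hopen.mem_nhds hz₀))
  let j : ℝ × M → ℝ × E := fun p => (2 * p.1, φ p.2)
  have hj : ContMDiffAt (𝓘(ℝ, ℝ).prod I) 𝓘(ℝ, ℝ × E) ∞ j (0, x₀) := by
    refine ContMDiffAt.prodMk_space ?_ ?_
    · exact (contMDiffAt_const (c := (2 : ℝ))).mul contMDiffAt_fst
    · exact (contMDiffAt_extChartAt (I := I) (x := x₀)).comp ((0 : ℝ), x₀) contMDiffAt_snd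
  have hj0 : j (0, x₀) = (0, φ x₀) := by simp [j]
  have hψz : ψ (0, φ x₀) (1 / 2) = φ x₀ := by
    have h1 := fun U hU => (hψ3 U hU).self_of_nhds (1 / 2)
    by_contra hne
    exact h1 {ψ (0, φ x₀) (1 / 2)}ᶜ (isOpen_compl_singleton.mem_nhds (Ne.symm hne)) rfl
  have hsm : ContMDiffAt (𝓘(ℝ, ℝ).prod I) I ∞ (fun p : ℝ × M => φ.symm (ψ (j p) (1 / 2)))
      (0, x₀) := by
    have h1 : ContMDiffAt (𝓘(ℝ, ℝ).prod I) 𝓘(ℝ, E) ∞ (fun p : ℝ × M => ψ (j p) (1 / 2))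
        (0, x₀) := by
      rw [← hj0] at hψ2
      exact hψ2.contMDiffAt.comp (0, x₀) hj
    have h2 : ContMDiffAt 𝓘(ℝ, E) I ∞ φ.symm (ψ (j (0, x₀)) (1 / 2)) := by
      rw [hj0, hψz]
      exact (contMDiffOn_extChartAt_symm x₀).contMDiffAt (hopen.mem_nhds hz₀)
    exact h2.comp (0, x₀) h1
  refine hsm.congr_of_eventuallyEq ?_
  have hev := hj.continuousAt.eventually (hj0.symm ▸ hψ1.and hψ4)
  have hsrc : ∀ᶠ p : ℝ × M in 𝓝 (0, x₀), p.2 ∈ φ.source :=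
    continuousAt_snd.eventually (extChartAt_source_mem_nhds x₀)
  filter_upwards [hev, hsrc] with p ⟨⟨hp0, hp1⟩, hp2⟩ hps
  have hint : IsMIntegralCurveOn (fun t => φ.symm (ψ (j p) t)) ((2 * p.1) • ξ) (Ioo (-1) 1) := by
    intro t ht
    have hd := hp1 t ht
    rw [(hp2 t).1] at hd
    refine (hasMFDerivAt_extChartAt_symm_comp (hp2 t).2 (hd.congr_deriv ?_)).hasMFDerivWithinAt
    exact (map_smul _ _ _).symm
  have hint' : IsMIntegralCurveOn ((fun t => Φ t p.2) ∘ (· * (2 * p.1))) ((2 * p.1) • ξ)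
      (Ioo (-1) 1) := ((hΦ.integralCurve p.2).comp_mul _).isMIntegralCurveOn _
  have hsm' : IsSmoothVField ((2 * p.1) • ξ) := IsSmoothVField.smul contMDiff_const hξ
  have h0 : φ.symm (ψ (j p) 0) = ((fun t => Φ t p.2) ∘ (· * (2 * p.1))) 0 := by
    simp [hp0, j, φ.left_inv hps, hΦ.zero]
  have := isMIntegralCurveOn_Ioo_eqOn_of_contMDiff_boundaryless (t₀ := 0) (by norm_num)
    (ContMDiff.of_le hsm' (by simp)) hint hint' h0 (by norm_num : (1 / 2 : ℝ) ∈ Ioo (-1) 1)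
  simp only [Function.comp_apply] at this
  rw [this]
  congr 1
  ring

/-- The flow of a complete smooth vector field is smooth. -/
theorem IsGlobalFlow.contMDiff (hΦ : IsGlobalFlow ξ Φ) (hξ : IsSmoothVField ξ) :
    ContMDiff (𝓘(ℝ, ℝ).prod I) I ∞ (fun p : ℝ × M => Φ p.1 p.2) := by
  rw [contMDiff_infty]
  rintro n ⟨t, x⟩
  let S : Set ℝ := {t | ContMDiffAt (𝓘(ℝ, ℝ).prod I) I n (fun p : ℝ × M => Φ p.1 p.2) (t, x)}
  have hnhds : ∀ {t : ℝ} {x : M},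
      ContMDiffAt (𝓘(ℝ, ℝ).prod I) I n (fun p : ℝ × M => Φ p.1 p.2) (t, x) →
      ∀ᶠ q in 𝓝 (t, x), ContMDiffAt (𝓘(ℝ, ℝ).prod I) I n (fun p : ℝ × M => Φ p.1 p.2) q := by
    intro t x h
    exact (contMDiffAt_iff_contMDiffAt_nhds (by simp)).1 h
  have hopen : IsOpen S := by
    rw [isOpen_iff_mem_nhds]
    intro t ht
    exact (Continuous.prodMk_left x).continuousAt.eventually (hnhds ht)
  have hclosed : IsClosed S := by
    rw [← closure_subset_iff_isClosed]
    intro t ht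
    have h0 := hnhds ((hΦ.contMDiffAt_zero hξ (Φ t x)).of_le (m := n) (by exact_mod_cast le_top))
    have hc : ContinuousAt (fun s => (t - s, Φ s x)) t := by
      refine ContinuousAt.prodMk (by fun_prop) (hΦ.integralCurve x).continuous.continuousAt
    have h1 := hc.eventually (by simpa using h0)
    obtain ⟨s, hs, hsS⟩ := mem_closure_iff_nhds.1 ht _ h1
    have h2 : ContMDiffAt (𝓘(ℝ, ℝ).prod I) I n (fun p : ℝ × M => Φ (p.1 - s) (Φ s p.2)) (t, x) := by
      have h3 : ContMDiffAt (𝓘(ℝ, ℝ).prod I) I n (fun p : ℝ × M => Φ s p.2) (t, x) := by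
        have h4 : ContMDiffAt (𝓘(ℝ, ℝ).prod I) (𝓘(ℝ, ℝ).prod I) n
            (fun p : ℝ × M => ((s, p.2) : ℝ × M)) (t, x) := contMDiffAt_const.prodMk contMDiffAt_snd
        have h6 : ContMDiffAt (𝓘(ℝ, ℝ).prod I) I n (fun p : ℝ × M => Φ p.1 p.2) (s, x) := hsS
        exact ContMDiffAt.comp (t, x) (g := fun p : ℝ × M => Φ p.1 p.2)
          (f := fun p : ℝ × M => ((s, p.2) : ℝ × M)) h6 h4
      have h5 : ContMDiffAt (𝓘(ℝ, ℝ).prod I) (𝓘(ℝ, ℝ).prod I) n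
          (fun p : ℝ × M => ((p.1 - s, Φ s p.2) : ℝ × M)) (t, x) :=
        (contMDiffAt_fst.sub contMDiffAt_const).prodMk h3
      have h6 : ContMDiffAt (𝓘(ℝ, ℝ).prod I) I n (fun p : ℝ × M => Φ p.1 p.2) (t - s, Φ s x) := hs
      exact ContMDiffAt.comp (t, x) (g := fun p : ℝ × M => Φ p.1 p.2)
        (f := fun p : ℝ × M => ((p.1 - s, Φ s p.2) : ℝ × M)) h6 h5
    refine h2.congr_of_eventuallyEq (Eventually.of_forall fun p => ?_)
    change Φ p.1 p.2 = Φ (p.1 - s) (Φ s p.2)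
    rw [← hΦ.add hξ, sub_add_cancel]
  have huniv : S = univ := IsClopen.eq_univ ⟨hclosed, hopen⟩
    ⟨0, (hΦ.contMDiffAt_zero hξ x).of_le (m := n) (by exact_mod_cast le_top)⟩
  have ht : t ∈ S := huniv ▸ mem_univ t
  exact ht

end Flow

section Gluing

/-- The real numbers with the discrete topology. -/
def DiscreteReal : Type := ℝ

instance : TopologicalSpace DiscreteReal := ⊥

instance : DiscreteTopology DiscreteReal := ⟨rfl⟩

/-- The underlying real number. -/
def DiscreteReal.toReal (v : DiscreteReal) : ℝ := v

/-- A real number as a point of the discrete space. -/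
def DiscreteReal.ofReal (v : ℝ) : DiscreteReal := v

/-- Functions on open sets of a simply connected space that differ by locally constant functions
can be corrected by constants to a global function. -/
theorem exists_glue_of_sub_locallyConstant {X : Type*} [TopologicalSpace X]
    [SimplyConnectedSpace X] [LocallyPathConnectedSpace X] (U : X → Set X)
    (hU : ∀ i, IsOpen (U i)) (hmem : ∀ i, i ∈ U i) (f : X → X → ℝ)
    (hf : ∀ i j, ∀ x ∈ U i ∩ U j, ∀ᶠ y in 𝓝 x, f i y - f j y = f i x - f j x) :
    ∃ F : X → ℝ, ∀ i, ∀ᶠ y in 𝓝 i, F y - f i y = F i - f i i := by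
  let Z : FiberBundleCore X X DiscreteReal :=
    { baseSet := U
      isOpen_baseSet := hU
      indexAt := id
      mem_baseSet_at := hmem
      coordChange := fun i j x v => .ofReal (v.toReal + (f i x - f j x))
      coordChange_self := fun i x _ v => by
        rw [sub_self, add_zero]
        rfl
      continuousOn_coordChange := by
        rintro i j ⟨x, v⟩ ⟨hx, -⟩
        refine ContinuousAt.continuousWithinAt ?_
        refine (continuousAt_const (y := DiscreteReal.ofReal (v.toReal + (f i x - f j x)))).congr ?_
        have h1 : ∀ᶠ p : X × DiscreteReal in 𝓝 (x, v), p.2 = v := by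
          have h := (continuousAt_snd (p := (x, v))).tendsto
          rw [nhds_discrete DiscreteReal, tendsto_pure] at h
          exact h
        filter_upwards [h1, continuousAt_fst.eventually (hf i j x hx)] with p hp1 hp2
        rw [hp1, hp2]
      coordChange_comp := fun i j k x _ v => by
        change v.toReal + (f i x - f j x) + (f j x - f k x) = v.toReal + (f i x - f k x)
        ring }
  have hcov : IsCoveringMap (TotalSpace.proj : TotalSpace DiscreteReal Z.Fiber → X) :=
    FiberBundle.isCoveringMap
  obtain ⟨x₀⟩ : Nonempty X := inferInstance
  obtain ⟨σ, ⟨-, hσ⟩, -⟩ := hcov.existsUnique_continuousMap_lifts (ContinuousMap.id X) x₀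
    ⟨x₀, DiscreteReal.ofReal 0⟩ rfl
  have hσ' : ∀ x, (σ x).1 = x := fun x => congrFun hσ x
  let F : X → ℝ := fun x => f (σ x).1 x + DiscreteReal.toReal (σ x).2
  refine ⟨F, fun i => ?_⟩
  have hcont : ContinuousAt (fun x => (Z.localTriv i (σ x)).2) i := by
    refine ContinuousAt.comp continuousAt_snd (ContinuousAt.comp ?_ σ.continuous.continuousAt)
    refine (Z.localTriv i).continuousAt ?_
    rw [Z.mem_localTriv_source, ← Z.baseSet_at]
    change (σ i).1 ∈ U i
    rw [hσ']
    exact hmem i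
  have hev : ∀ᶠ x in 𝓝 i, (Z.localTriv i (σ x)).2 = (Z.localTriv i (σ i)).2 :=
    by
    have h := hcont.tendsto
    rw [nhds_discrete DiscreteReal, tendsto_pure] at h
    exact h
  have hval : ∀ x, DiscreteReal.toReal (Z.localTriv i (σ x)).2 = F x - f i x := by
    intro x
    have : DiscreteReal.toReal (Z.localTriv i (σ x)).2
        = DiscreteReal.toReal (σ x).2 + (f (σ x).1 (σ x).1 - f i (σ x).1) := rfl
    rw [this]
    simp only [F, hσ']
    ring
  filter_upwards [hev] with y hy
  rw [← hval, ← hval, hy]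

end Gluing

section Primitive

variable {E : Type*} [NormedAddCommGroup E] [NormedSpace ℝ E] [FiniteDimensional ℝ E]
  {H : Type*} [TopologicalSpace H] {I : ModelWithCorners ℝ E H}
  {M : Type*} [TopologicalSpace M] [ChartedSpace H M] [IsManifold I ∞ M]

/-- A smooth closed 1-form. -/
structure IsClosedOneForm (θ : (x : M) → TangentSpace I x →L[ℝ] ℝ) : Prop where
  smooth : ∀ X : VField I M, IsSmoothVField X → ContMDiff I 𝓘(ℝ, ℝ) ∞ (fun x => θ x (X x))
  closed : ∀ X Y : VField I M, IsSmoothVField X → IsSmoothVField Y → ∀ x,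
    mvfderiv I (fun y => θ y (Y y)) x (X x) - mvfderiv I (fun y => θ y (X y)) x (Y x)
      = θ x (mlieBracket I X Y x)

theorem mvfderiv_comp_extChartAt {F : Type*} [NormedAddCommGroup F] [NormedSpace ℝ F] {x₀ y : M}
    (hy : y ∈ (chartAt H x₀).source) {k : E → F}
    (hk : DifferentiableAt ℝ k (extChartAt I x₀ y)) (v : TangentSpace I y) :
    mvfderiv I (k ∘ extChartAt I x₀) y v =
      fderiv ℝ k (extChartAt I x₀ y) (mvfderiv I (extChartAt I x₀) y v) := by
  have h1 : MDifferentiableAt I 𝓘(ℝ, E) (extChartAt I x₀) y := mdifferentiableAt_extChartAt hy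
  have h2 : MDifferentiableAt 𝓘(ℝ, E) 𝓘(ℝ, F) k (extChartAt I x₀ y) := hk.mdifferentiableAt
  have := mfderiv_comp_apply y h2 h1 v
  rw [mfderiv_eq_fderiv] at this
  exact this

theorem exists_isSmoothVField_trivialization_symm [T2Space M] {x₀ y : M}
    (hy : y ∈ (trivializationAt E (TangentSpace I) x₀).baseSet) (w : E) :
    ∃ X : VField I M, IsSmoothVField X ∧
      ∀ᶠ y' in 𝓝 y, X y' = (trivializationAt E (TangentSpace I) x₀).symm y' w := by
  let e := trivializationAt E (TangentSpace I) x₀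
  refine exists_isSmoothVField_eventuallyEq (e.open_baseSet.mem_nhds hy) ?_
  rw [e.contMDiffOn_section_baseSet_iff]
  refine (contMDiffOn_const (c := w)).congr fun z hz => ?_
  rw [e.apply_mk_symm hz]

theorem mvfderiv_extChartAt_trivialization_symm {x₀ y : M}
    (hy : y ∈ (trivializationAt E (TangentSpace I) x₀).baseSet) (w : E) :
    mvfderiv I (extChartAt I x₀) y ((trivializationAt E (TangentSpace I) x₀).symm y w) = w := by
  let e := trivializationAt E (TangentSpace I) x₀
  have hs : y ∈ (chartAt H x₀).source := by simpa using hy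
  have h1 := TangentBundle.continuousLinearMapAt_trivializationAt (I := I) hs
  have h2 : e.continuousLinearMapAt ℝ y (e.symmL ℝ y w) = w :=
    e.continuousLinearMapAt_symmL hy w
  rw [e.symmL_apply hy, h1] at h2
  exact h2

theorem mvfderiv_extChartAt_injective {x₀ y : M}
    (hy : y ∈ (trivializationAt E (TangentSpace I) x₀).baseSet) :
    Function.Injective (mvfderiv I (extChartAt I x₀) y) := by
  let e := trivializationAt E (TangentSpace I) x₀
  have hs : y ∈ (chartAt H x₀).source := by simpa using hy
  have h1 := TangentBundle.continuousLinearMapAt_trivializationAt (I := I) hs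
  have h2 : Function.Injective (e.continuousLinearMapAt ℝ y) :=
    Function.LeftInverse.injective (g := e.symmL ℝ y) fun v => e.symmL_continuousLinearMapAt hy v
  rw [h1] at h2
  exact h2

theorem mlieBracket_frame_eq_zero [I.Boundaryless] {x₀ y : M}
    (hy : y ∈ (trivializationAt E (TangentSpace I) x₀).baseSet) {u w : E} {X Y : VField I M}
    (hX : IsSmoothVField X) (hY : IsSmoothVField Y)
    (hXu : ∀ᶠ y' in 𝓝 y, X y' = (trivializationAt E (TangentSpace I) x₀).symm y' u)
    (hYw : ∀ᶠ y' in 𝓝 y, Y y' = (trivializationAt E (TangentSpace I) x₀).symm y' w) :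
    mlieBracket I X Y y = 0 := by
  let e := trivializationAt E (TangentSpace I) x₀
  have hs : y ∈ (chartAt H x₀).source := by simpa using hy
  apply mvfderiv_extChartAt_injective hy
  have hconst : ∀ (Z : VField I M) (w : E), (∀ᶠ y' in 𝓝 y, Z y' = e.symm y' w) →
      mvfderiv I (fun y' => mvfderiv I (extChartAt I x₀) y' (Z y')) y = 0 := by
    intro Z w hZ
    have : (fun y' => mvfderiv I (extChartAt I x₀) y' (Z y')) =ᶠ[𝓝 y] fun _ => w := by
      filter_upwards [hZ, e.open_baseSet.mem_nhds hy] with y' h1 h2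
      rw [h1]
      exact mvfderiv_extChartAt_trivialization_symm h2 w
    rw [mvfderiv_congr this, mvfderiv_const]
  rw [mvfderiv_mlieBracket ((contMDiffAt_extChartAt' hs)) (hX.mdifferentiableAt y)
    (hY.mdifferentiableAt y), hconst X u hXu, hconst Y w hYw]
  simp

theorem IsClosedOneForm.exists_local_primitive [T2Space M] [I.Boundaryless]
    {θ : (x : M) → TangentSpace I x →L[ℝ] ℝ} (hθ : IsClosedOneForm θ) (x₀ : M) :
    ∃ U : Set M, IsOpen U ∧ x₀ ∈ U ∧ ∃ f : M → ℝ, ContMDiffOn I 𝓘(ℝ, ℝ) ∞ f U ∧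
      ∀ x ∈ U, ∀ v, mvfderiv I f x v = θ x v := by
  let e := trivializationAt E (TangentSpace I) x₀
  set φ := extChartAt I x₀ with hφ
  have hopen : IsOpen φ.target := isOpen_extChartAt_target x₀
  have hbase : ∀ {y}, y ∈ e.baseSet ↔ y ∈ φ.source := by intro y; simp [e, hφ]
  let Ω : M → E →L[ℝ] ℝ := fun y => (θ y).comp (e.symmL ℝ y)
  have hΩ : ContMDiffOn I 𝓘(ℝ, E →L[ℝ] ℝ) ∞ Ω e.baseSet := by
    intro y hy
    refine (contMDiffAt_clm_of_apply fun w => ?_).contMDiffWithinAt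
    obtain ⟨X, hX, hXe⟩ := exists_isSmoothVField_trivialization_symm hy w
    refine (hθ.smooth X hX y).congr_of_eventuallyEq ?_
    filter_upwards [hXe, e.open_baseSet.mem_nhds hy] with y' hy' hye
    rw [hy']
    exact congrArg (θ y') (e.symmL_apply (R := ℝ) hye w)
  let α : E → E →L[ℝ] ℝ := fun z => Ω (φ.symm z)
  have hmaps : MapsTo φ.symm φ.target e.baseSet := fun z hz => hbase.2 (φ.map_target hz)
  have hα : ContDiffOn ℝ ∞ α φ.target :=
    (hΩ.comp (contMDiffOn_extChartAt_symm x₀) hmaps).contDiffOn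
  have hαd : DifferentiableOn ℝ α φ.target := hα.differentiableOn (by simp)
  have hsymm : ∀ z ∈ φ.target, ∀ u w, fderiv ℝ α z u w = fderiv ℝ α z w u := by
    intro z hz u w
    set y := φ.symm z with hy
    have hyb : y ∈ e.baseSet := hmaps hz
    have hys : y ∈ (chartAt H x₀).source := by simpa [e] using hyb
    have hφy : φ y = z := φ.right_inv hz
    have hαz : DifferentiableAt ℝ α z := hαd.differentiableAt (hopen.mem_nhds hz)
    have hder : ∀ (Z Z' : VField I M) (u w : E), (∀ᶠ y' in 𝓝 y, Z y' = e.symm y' u) →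
        (∀ᶠ y' in 𝓝 y, Z' y' = e.symm y' w) →
        mvfderiv I (fun y' => θ y' (Z' y')) y (Z y) = fderiv ℝ α z u w := by
      intro Z Z' u w hZ hZ'
      have h1 : (fun y' => θ y' (Z' y')) =ᶠ[𝓝 y] (fun z => α z w) ∘ φ := by
        filter_upwards [hZ', e.open_baseSet.mem_nhds hyb] with y' h1 h2
        rw [h1]
        change θ y' (e.symm y' w) = θ (φ.symm (φ y')) (e.symmL ℝ (φ.symm (φ y')) w)
        rw [φ.left_inv (hbase.1 h2), e.symmL_apply h2]
      rw [mvfderiv_congr h1, mvfderiv_comp_extChartAt hys, hZ.self_of_nhds,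
        mvfderiv_extChartAt_trivialization_symm hyb]
      · rw [← hφ, hφy, fderiv_clm_apply hαz (differentiableAt_const w)]
        simp
      · rw [← hφ, hφy]
        exact hαz.clm_apply (differentiableAt_const w)
    obtain ⟨X, hX, hXe⟩ := exists_isSmoothVField_trivialization_symm hyb u
    obtain ⟨Y, hY, hYe⟩ := exists_isSmoothVField_trivialization_symm hyb w
    have h := hθ.closed X Y hX hY y
    rw [hder X Y u w hXe hYe, hder Y X w u hYe hXe, mlieBracket_frame_eq_zero hyb hX hY hXe hYe,
      map_zero, sub_eq_zero] at h
    exact h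
  obtain ⟨r, hr, hrt⟩ := Metric.isOpen_iff.1 hopen (φ x₀) (mem_extChartAt_target x₀)
  obtain ⟨F, hF⟩ := (convex_ball (φ x₀) r).exists_forall_hasFDerivAt_of_fderiv_symmetric
    Metric.isOpen_ball (hαd.mono hrt) (fun z hz => hsymm z (hrt hz))
  have hFs : ContDiffOn ℝ ∞ F (Metric.ball (φ x₀) r) := by
    rw [contDiffOn_infty_iff_fderiv_of_isOpen Metric.isOpen_ball]
    exact ⟨fun z hz => (hF z hz).differentiableAt.differentiableWithinAt,
      (hα.mono hrt).congr fun z hz => (hF z hz).fderiv⟩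
  refine ⟨φ.source ∩ φ ⁻¹' Metric.ball (φ x₀) r,
    (continuousOn_extChartAt x₀).isOpen_inter_preimage (isOpen_extChartAt_source x₀)
      Metric.isOpen_ball, ⟨mem_extChartAt_source x₀, Metric.mem_ball_self hr⟩, F ∘ φ, ?_, ?_⟩
  · refine hFs.contMDiffOn.comp (contMDiffOn_extChartAt.mono ?_) fun y hy => hy.2
    intro y hy
    simpa [hφ] using hy.1
  · rintro x ⟨hx, hxb⟩ v
    have hxs : x ∈ (chartAt H x₀).source := by simpa [hφ] using hx
    have hxe : x ∈ e.baseSet := hbase.2 hx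
    rw [mvfderiv_comp_extChartAt hxs (hF _ hxb).differentiableAt, ← hφ, (hF _ hxb).fderiv]
    change θ (φ.symm (φ x)) (e.symmL ℝ (φ.symm (φ x)) _) = _
    rw [φ.left_inv hx, e.symmL_apply hxe]
    congr 1
    apply mvfderiv_extChartAt_injective hxe
    exact mvfderiv_extChartAt_trivialization_symm hxe _

theorem eventually_eq_of_mvfderiv_eq_zero [I.Boundaryless] {f : M → ℝ} {x : M}
    (h : ∀ᶠ y in 𝓝 x, MDifferentiableAt I 𝓘(ℝ, ℝ) f y ∧ mvfderiv I f y = 0) :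
    ∀ᶠ y in 𝓝 x, f y = f x := by
  set φ := extChartAt I x with hφ
  have hopen : IsOpen φ.target := isOpen_extChartAt_target x
  have hzt : φ x ∈ φ.target := mem_extChartAt_target x
  have hc : ContinuousAt φ.symm (φ x) :=
    (continuousOn_extChartAt_symm x).continuousAt (hopen.mem_nhds hzt)
  have h1 : ∀ᶠ z in 𝓝 (φ x), HasFDerivAt (f ∘ φ.symm) (0 : E →L[ℝ] ℝ) z := by
    have h2 := hc.eventually (by rw [φ.left_inv (mem_extChartAt_source x)]; exact h)
    filter_upwards [h2, hopen.mem_nhds hzt] with z hz hzt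
    have h3 : MDifferentiableAt 𝓘(ℝ, E) I φ.symm z := by
      have := mdifferentiableWithinAt_extChartAt_symm (I := I) hzt
      rwa [I.range_eq_univ, mdifferentiableWithinAt_univ] at this
    have h4 := hz.1.hasMFDerivAt.comp z h3.hasMFDerivAt
    have h5 : mfderiv I 𝓘(ℝ, ℝ) f (φ.symm z) = 0 := hz.2
    rw [h5] at h4
    exact (h4.congr_mfderiv (ContinuousLinearMap.zero_comp _)).hasFDerivAt
  obtain ⟨r, hr, hrt⟩ := Metric.eventually_nhds_iff_ball.1 h1
  have hball : ∀ᶠ y in 𝓝 x, φ y ∈ Metric.ball (φ x) r :=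
    (continuousAt_extChartAt x).eventually (Metric.ball_mem_nhds _ hr)
  filter_upwards [hball, extChartAt_source_mem_nhds (I := I) x] with y hy hys
  have := Metric.isOpen_ball.is_const_of_fderiv_eq_zero (𝕜 := ℝ)
    (convex_ball (φ x) r).isPreconnected
    (fun z hz => (hrt z hz).differentiableAt.differentiableWithinAt)
    (fun z hz => (hrt z hz).fderiv) hy (Metric.mem_ball_self hr)
  simpa [φ.left_inv hys, φ.left_inv (mem_extChartAt_source x)] using this

theorem IsClosedOneForm.exists_primitive [T2Space M] [I.Boundaryless] [SimplyConnectedSpace M]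
    [LocallyPathConnectedSpace M]
    {θ : (x : M) → TangentSpace I x →L[ℝ] ℝ} (hθ : IsClosedOneForm θ) :
    ∃ f : M → ℝ, ContMDiff I 𝓘(ℝ, ℝ) ∞ f ∧ ∀ x v, mvfderiv I f x v = θ x v := by
  choose U hU hmem f hf hfθ using hθ.exists_local_primitive
  have hdiff : ∀ i, ∀ x ∈ U i, MDifferentiableAt I 𝓘(ℝ, ℝ) (f i) x := fun i x hx =>
    ((hf i x hx).contMDiffAt ((hU i).mem_nhds hx)).mdifferentiableAt (by simp)
  have hsub : ∀ i j, ∀ x ∈ U i ∩ U j, ∀ᶠ y in 𝓝 x, f i y - f j y = f i x - f j x := by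
    intro i j x hx
    refine eventually_eq_of_mvfderiv_eq_zero (I := I) (f := fun y => f i y - f j y) ?_
    filter_upwards [((hU i).inter (hU j)).mem_nhds hx] with y hy
    refine ⟨(hdiff i y hy.1).sub (hdiff j y hy.2), ?_⟩
    have h1 : mvfderiv I (fun y => f i y - f j y) y = mvfderiv I (f i) y - mvfderiv I (f j) y :=
      mvfderiv_sub (hdiff i y hy.1) (hdiff j y hy.2)
    rw [h1]
    ext v
    rw [sub_apply, hfθ i y hy.1, hfθ j y hy.2, sub_self]
    rfl
  obtain ⟨F, hF⟩ := exists_glue_of_sub_locallyConstant U hU hmem f hsub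
  have hF' : ∀ i, F =ᶠ[𝓝 i] fun y => f i y + (F i - f i i) := by
    intro i
    filter_upwards [hF i] with y hy
    linarith
  refine ⟨F, fun i => ?_, fun i v => ?_⟩
  · exact (((hf i i (hmem i)).contMDiffAt ((hU i).mem_nhds (hmem i))).add
      contMDiffAt_const).congr_of_eventuallyEq (hF' i)
  · have h1 : mvfderiv I (fun y => f i y + (F i - f i i)) i
        = mvfderiv I (f i) i + mvfderiv I (fun _ => F i - f i i) i :=
      mvfderiv_add (hdiff i i (hmem i)) mdifferentiableAt_const
    rw [mvfderiv_congr (hF' i), h1, mvfderiv_const, add_zero, hfθ i i (hmem i)]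

end Primitive

section LevelSet

variable {E : Type*} [NormedAddCommGroup E] [NormedSpace ℝ E] [FiniteDimensional ℝ E]
  {F : Type*} [NormedAddCommGroup F] [NormedSpace ℝ F] [FiniteDimensional ℝ F]

theorem exists_continuousLinearEquiv_snd (hE : Module.finrank ℝ E = Module.finrank ℝ F + 1)
    {L : E →L[ℝ] ℝ} (hL : L ≠ 0) : ∃ A : E ≃L[ℝ] F × ℝ, ∀ w, (A w).2 = L w := by
  obtain ⟨v, hv⟩ : ∃ v, L v = 1 := by
    obtain ⟨w, hw⟩ := DFunLike.ne_iff.1 hL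
    exact ⟨(L w)⁻¹ • w, by simpa using inv_mul_cancel₀ hw⟩
  let K := LinearMap.ker (L : E →ₗ[ℝ] ℝ)
  have hK : Module.finrank ℝ K = Module.finrank ℝ F := by
    have h1 := LinearMap.finrank_range_add_finrank_ker (L : E →ₗ[ℝ] ℝ)
    have h2 : LinearMap.range (L : E →ₗ[ℝ] ℝ) = ⊤ :=
      LinearMap.range_eq_top.2 fun r => ⟨r • v, by simp [hv]⟩
    rw [h2, finrank_top, Module.finrank_self] at h1
    change 1 + Module.finrank ℝ K = _ at h1
    omega
  let B := LinearEquiv.ofFinrankEq K F hK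
  let P : E →ₗ[ℝ] K := LinearMap.codRestrict K
    (LinearMap.id - (L : E →ₗ[ℝ] ℝ).smulRight v) fun w => by simp [K, hv]
  let A : E →ₗ[ℝ] F × ℝ := ((B : K →ₗ[ℝ] F).comp P).prod (L : E →ₗ[ℝ] ℝ)
  have hA : Function.Injective A := by
    refine (injective_iff_map_eq_zero A).2 fun w hw => ?_
    have h1 : L w = 0 := congrArg Prod.snd hw
    have h2 : B (P w) = 0 := congrArg Prod.fst hw
    have h3 : P w = 0 := by simpa using h2
    have h4 : w - L w • v = 0 := congrArg Subtype.val h3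
    simpa [h1] using h4
  have hdim : Module.finrank ℝ E = Module.finrank ℝ (F × ℝ) := by
    rw [Module.finrank_prod, Module.finrank_self, hE]
  exact ⟨(LinearEquiv.ofInjectiveOfFinrankEq A hA hdim).toContinuousLinearEquiv, fun w => rfl⟩

theorem exists_straightening (hE : Module.finrank ℝ E = Module.finrank ℝ F + 1) {k : E → ℝ}
    {s : Set E} (hs : IsOpen s) (hk : ContDiffOn ℝ ∞ k s) {z₀ : E} (hz₀ : z₀ ∈ s)
    (hd : fderiv ℝ k z₀ ≠ 0) :
    ∃ e : OpenPartialHomeomorph E (F × ℝ), z₀ ∈ e.source ∧ e.source ⊆ s ∧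
      (∀ z, (e z).2 = k z) ∧ ContDiffOn ℝ ∞ e e.source ∧ ContDiffOn ℝ ∞ e.symm e.target := by
  obtain ⟨A, hA⟩ := exists_continuousLinearEquiv_snd (F := F) hE hd
  let G : E → F × ℝ := fun z => ((A z).1, k z)
  have hG : ContDiffOn ℝ ∞ G s := (A.contDiff.fst.contDiffOn).prodMk hk
  have hk₀ : HasFDerivAt k (fderiv ℝ k z₀) z₀ :=
    ((hk.contDiffAt (hs.mem_nhds hz₀)).differentiableAt (by simp)).hasFDerivAt
  have hGd : HasFDerivAt G (A : E →L[ℝ] F × ℝ) z₀ := by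
    have h1 : HasFDerivAt (fun z => (A z).1)
        ((ContinuousLinearMap.fst ℝ F ℝ).comp (A : E →L[ℝ] F × ℝ)) z₀ :=
      ((ContinuousLinearMap.fst ℝ F ℝ).comp (A : E →L[ℝ] F × ℝ)).hasFDerivAt
    refine (h1.prodMk hk₀).congr_fderiv ?_
    ext w
    · rfl
    · exact (hA w).symm
  have hGc := hG.contDiffAt (hs.mem_nhds hz₀)
  have hne : (∞ : WithTop ℕ∞) ≠ 0 := by simp
  let e₀ := hGc.toOpenPartialHomeomorph G hGd hne
  have hfd : ContinuousOn (fderiv ℝ G) s := (hG.fderiv_of_isOpen hs (m := 0) (by simp)).continuousOn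
  let t : Set E := s ∩ fderiv ℝ G ⁻¹' range ((↑) : (E ≃L[ℝ] F × ℝ) → E →L[ℝ] F × ℝ)
  have ht : IsOpen t := hfd.isOpen_inter_preimage hs ContinuousLinearEquiv.isOpen
  have hsrc : (e₀.restrOpen t ht).source = e₀.source ∩ t := rfl
  refine ⟨e₀.restrOpen t ht, ?_, ?_, fun z => rfl, ?_, ?_⟩
  · rw [hsrc]
    exact ⟨hGc.mem_toOpenPartialHomeomorph_source hGd hne, hz₀, A, hGd.fderiv.symm⟩
  · rw [hsrc]
    exact fun z hz => hz.2.1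
  · rw [hsrc]
    exact hG.mono fun z hz => hz.2.1
  · intro a ha
    have h1 := (e₀.restrOpen t ht).map_target ha
    rw [hsrc] at h1
    obtain ⟨h2, h3, B, hB⟩ := h1
    have hc := hG.contDiffAt (hs.mem_nhds h3)
    refine ((e₀.restrOpen t ht).contDiffAt_symm ha (f₀' := B) ?_ hc).contDiffWithinAt
    rw [hB]
    exact (hc.differentiableAt hne).hasFDerivAt

variable {M : Type u} [TopologicalSpace M] [ChartedSpace E M] [IsManifold 𝓘(ℝ, E) ∞ M]

/-- A smooth chart of `M` whose last coordinate is the function `f`. -/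
structure IsSliceChart (f : M → ℝ) (e : OpenPartialHomeomorph M (F × ℝ)) : Prop where
  snd_eq : ∀ x ∈ e.source, (e x).2 = f x
  contMDiffOn : ContMDiffOn 𝓘(ℝ, E) 𝓘(ℝ, F × ℝ) ∞ e e.source
  contMDiffOn_symm : ContMDiffOn 𝓘(ℝ, F × ℝ) 𝓘(ℝ, E) ∞ e.symm e.target

theorem exists_isSliceChart (hE : Module.finrank ℝ E = Module.finrank ℝ F + 1) {f : M → ℝ}
    (hf : ContMDiff 𝓘(ℝ, E) 𝓘(ℝ, ℝ) ∞ f) {p : M} (hp : mvfderiv 𝓘(ℝ, E) f p ≠ 0) :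
    ∃ e : OpenPartialHomeomorph M (F × ℝ), IsSliceChart (E := E) f e ∧ p ∈ e.source := by
  let c := chartAt E p
  have hcs : ContMDiffOn 𝓘(ℝ, E) 𝓘(ℝ, E) ∞ c.symm c.target := contMDiffOn_chart_symm
  have hk : ContDiffOn ℝ ∞ (f ∘ c.symm) c.target := (hf.comp_contMDiffOn hcs).contDiffOn
  have hpc : p ∈ c.source := mem_chart_source E p
  have hd : fderiv ℝ (f ∘ c.symm) (c p) ≠ 0 := by
    intro h0
    apply hp
    have h1 : f =ᶠ[𝓝 p] (f ∘ c.symm) ∘ extChartAt 𝓘(ℝ, E) p := by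
      filter_upwards [c.open_source.mem_nhds hpc] with y hy
      simp [c, c.left_inv hy]
    rw [mvfderiv_congr h1]
    ext v
    have hdiff : DifferentiableAt ℝ (f ∘ c.symm) (extChartAt 𝓘(ℝ, E) p p) :=
      ((hk.contDiffAt (c.open_target.mem_nhds (c.map_source hpc))).differentiableAt (by simp))
    rw [mvfderiv_comp_extChartAt hpc hdiff]
    have h2 : fderiv ℝ (f ∘ c.symm) (extChartAt 𝓘(ℝ, E) p p) = 0 := h0
    rw [h2]
    rfl
  obtain ⟨e, he1, he2, he3, he4, he5⟩ := exists_straightening (F := F) hE c.open_target hk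
    (c.map_source hpc) hd
  have hsrc : (c ≫ₕ e).source = c.source ∩ c ⁻¹' e.source := c.trans_source e
  have htgt : (c ≫ₕ e).target = e.target ∩ e.symm ⁻¹' c.target := c.trans_target e
  refine ⟨c ≫ₕ e, ⟨fun x hx => ?_, ?_, ?_⟩, ?_⟩
  · rw [hsrc] at hx
    change (e (c x)).2 = f x
    rw [he3, Function.comp_apply, c.left_inv hx.1]
  · rw [hsrc]
    exact he4.contMDiffOn.comp (contMDiffOn_chart.mono inter_subset_left) fun x hx => hx.2
  · rw [htgt]
    exact hcs.comp (he5.contMDiffOn.mono inter_subset_left) fun x hx => hx.2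
  · rw [hsrc]
    exact ⟨hpc, he1⟩

open Classical in
/-- The chart of a level set induced by a slice chart. -/
noncomputable def levelSetChart {f : M → ℝ} {e : OpenPartialHomeomorph M (F × ℝ)}
    (he : IsSliceChart (E := E) f e) (p : {x // f x = 0}) :
    OpenPartialHomeomorph {x // f x = 0} F where
  toFun y := (e y).1
  invFun a := if h : f (e.symm (a, 0)) = 0 then ⟨e.symm (a, 0), h⟩ else p
  source := {y | (y : M) ∈ e.source}
  target := {a | (a, (0 : ℝ)) ∈ e.target}
  map_source' := by
    intro y hy
    have h1 : ((e y).1, (0 : ℝ)) = e y := Prod.ext rfl (by rw [he.snd_eq y hy, y.2])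
    rw [mem_ofPred_eq, h1]
    exact e.map_source hy
  map_target' := by
    intro a ha
    have h1 : f (e.symm (a, 0)) = 0 := by
      rw [← he.snd_eq _ (e.map_target ha), e.right_inv ha]
    rw [dif_pos h1]
    exact e.map_target ha
  left_inv' := by
    intro y hy
    have h1 : ((e y).1, (0 : ℝ)) = e y := Prod.ext rfl (by rw [he.snd_eq y hy, y.2])
    have h2 : e.symm ((e y).1, (0 : ℝ)) = y := by rw [h1]; exact e.left_inv hy
    have h3 : f (e.symm ((e y).1, (0 : ℝ))) = 0 := by rw [h2, y.2]
    rw [dif_pos h3]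
    exact Subtype.ext h2
  right_inv' := by
    intro a ha
    have h1 : f (e.symm (a, 0)) = 0 := by
      rw [← he.snd_eq _ (e.map_target ha), e.right_inv ha]
    rw [dif_pos h1]
    change (e (e.symm (a, 0))).1 = a
    rw [e.right_inv ha]
  open_source := e.open_source.preimage continuous_subtype_val
  open_target := e.open_target.preimage (Continuous.prodMk_left 0)
  continuousOn_toFun := continuous_fst.comp_continuousOn
    (e.continuousOn.comp continuous_subtype_val.continuousOn fun y hy => hy)
  continuousOn_invFun := by
    have hind : IsInducing (Subtype.val : {x // f x = 0} → M) := ⟨rfl⟩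
    rw [hind.continuousOn_iff]
    refine (e.continuousOn_symm.comp (Continuous.prodMk_left (0 : ℝ)).continuousOn
      fun a ha => ha).congr fun a ha => ?_
    have h1 : f (e.symm (a, 0)) = 0 := by
      rw [← he.snd_eq _ (e.map_target ha), e.right_inv ha]
    simp [h1]

theorem coe_levelSetChart_symm {f : M → ℝ} {e : OpenPartialHomeomorph M (F × ℝ)}
    (he : IsSliceChart (E := E) f e) (p : {x // f x = 0}) {a : F}
    (ha : a ∈ (levelSetChart he p).target) :
    ((levelSetChart he p).symm a : M) = e.symm (a, 0) := by
  have h1 : f (e.symm (a, 0)) = 0 := by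
    rw [← he.snd_eq _ (e.map_target ha), e.right_inv ha]
  change ((if h : f (e.symm (a, 0)) = 0 then ⟨e.symm (a, 0), h⟩ else p : {x // f x = 0}) : M) = _
  rw [dif_pos h1]

theorem contMDiffOn_coe_levelSetChart_symm {f : M → ℝ} {e : OpenPartialHomeomorph M (F × ℝ)}
    (he : IsSliceChart (E := E) f e) (p : {x // f x = 0}) :
    ContMDiffOn 𝓘(ℝ, F) 𝓘(ℝ, E) ∞ (fun a => ((levelSetChart he p).symm a : M))
      (levelSetChart he p).target := by
  have h1 : ContMDiff 𝓘(ℝ, F) 𝓘(ℝ, F × ℝ) ∞ (fun a : F => (a, (0 : ℝ))) :=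
    (contDiff_id.prodMk contDiff_const).contMDiff
  exact (he.contMDiffOn_symm.comp h1.contMDiffOn fun a ha => ha).congr
    fun a ha => coe_levelSetChart_symm he p ha

/-- A level set with nowhere vanishing differential is a manifold. -/
theorem exists_levelSet_manifold [T2Space M] [SecondCountableTopology M]
    (hE : Module.finrank ℝ E = Module.finrank ℝ F + 1) {f : M → ℝ}
    (hf : ContMDiff 𝓘(ℝ, E) 𝓘(ℝ, ℝ) ∞ f) (hd : ∀ p, mvfderiv 𝓘(ℝ, E) f p ≠ 0) :
    ∃ (N : Type u) (_ : TopologicalSpace N) (_ : T2Space N) (_ : SecondCountableTopology N)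
      (_ : ChartedSpace F N) (_ : IsManifold 𝓘(ℝ, F) ∞ N) (j : N → M),
      ContMDiff 𝓘(ℝ, F) 𝓘(ℝ, E) ∞ j ∧ Function.Injective j ∧ range j = {x | f x = 0} ∧
      ∀ g : M → N, ContMDiff 𝓘(ℝ, E) 𝓘(ℝ, E) ∞ (j ∘ g) → ContMDiff 𝓘(ℝ, E) 𝓘(ℝ, F) ∞ g := by
  choose e he hmem using fun p => exists_isSliceChart (F := F) hE hf (hd p)
  let N := {x // f x = 0}
  let cs : ChartedSpace F N :=
    { atlas := range fun p : N => levelSetChart (he p) p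
      chartAt := fun p => levelSetChart (he p) p
      mem_chart_source := fun p => hmem p
      chart_mem_atlas := fun p => mem_range_self p }
  have hman : IsManifold 𝓘(ℝ, F) ∞ N := by
    refine isManifold_of_contDiffOn _ _ _ ?_
    rintro _ _ ⟨p, rfl⟩ ⟨p', rfl⟩
    simp only [modelWithCornersSelf_coe, modelWithCornersSelf_coe_symm, Function.id_comp,
      Function.comp_id, preimage_id, range_id, inter_univ]
    have h1 := (he p').contMDiffOn.comp
      ((contMDiffOn_coe_levelSetChart_symm (he p) p).mono inter_subset_left)
      (s := (levelSetChart (he p) p).target ∩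
        (levelSetChart (he p) p).symm ⁻¹' (levelSetChart (he p') p').source) fun a ha => ha.2
    have h2 := contDiff_fst.comp_contDiffOn h1.contDiffOn
    rw [OpenPartialHomeomorph.trans_source]
    exact h2
  refine ⟨N, inferInstance, inferInstance,
    TopologicalSpace.Subtype.secondCountableTopology {x | f x = 0}, cs, hman, Subtype.val, ?_,
    Subtype.val_injective, Subtype.range_val, ?_⟩
  · intro y
    let c := chartAt F y
    have hc : ContMDiffOn 𝓘(ℝ, F) 𝓘(ℝ, F) ∞ c c.source := contMDiffOn_chart
    have h1 := (contMDiffOn_coe_levelSetChart_symm (he y) y).comp hc fun z hz => c.map_source hz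
    have hs : c.source ∈ 𝓝 y := c.open_source.mem_nhds (mem_chart_source F y)
    refine (h1.contMDiffAt hs).congr_of_eventuallyEq ?_
    filter_upwards [hs] with z hz
    exact congrArg Subtype.val (c.left_inv hz).symm
  · intro g hg x
    have hgc : Continuous g := IsInducing.subtypeVal.continuous_iff.2 hg.continuous
    let c := chartAt F (g x)
    have hs : c.source ∈ 𝓝 (g x) := c.open_source.mem_nhds (mem_chart_source F (g x))
    have hcs : ContMDiffOn 𝓘(ℝ, F) 𝓘(ℝ, F) ∞ c.symm c.target := contMDiffOn_chart_symm
    have h1 : ContMDiffAt 𝓘(ℝ, E) 𝓘(ℝ, F × ℝ) ∞ (fun x' => e (g x) (g x')) x :=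
      ((he (g x)).contMDiffOn.contMDiffAt ((e (g x)).open_source.mem_nhds (hmem (g x)))).comp x
        (hg x)
    have h2 : ContMDiffAt 𝓘(ℝ, E) 𝓘(ℝ, F) ∞ (fun x' => c (g x')) x :=
      contDiff_fst.contMDiff.contMDiffAt.comp x h1
    have h3 : ContMDiffAt 𝓘(ℝ, E) 𝓘(ℝ, F) ∞ (fun x' => c.symm (c (g x'))) x :=
      (hcs.contMDiffAt (c.open_target.mem_nhds (c.map_source (mem_chart_source F (g x))))).comp x h2
    refine h3.congr_of_eventuallyEq ?_
    filter_upwards [hgc.continuousAt.eventually hs] with z hz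
    exact (c.left_inv hz).symm

theorem hasDerivAt_comp_isMIntegralCurve {ξ : VField 𝓘(ℝ, E) M} {γ : ℝ → M}
    (hγ : IsMIntegralCurve γ ξ) {f : M → ℝ} {t : ℝ}
    (hf : MDifferentiableAt 𝓘(ℝ, E) 𝓘(ℝ, ℝ) f (γ t)) :
    HasDerivAt (fun s => f (γ s)) (mvfderiv 𝓘(ℝ, E) f (γ t) (ξ (γ t))) t := by
  let L : ℝ →L[ℝ] ℝ := (mfderiv 𝓘(ℝ, E) 𝓘(ℝ, ℝ) f (γ t)).comp
    ((1 : ℝ →L[ℝ] ℝ).smulRight (ξ (γ t)))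
  have h1 : HasFDerivAt (fun s => f (γ s)) L t := (hf.hasMFDerivAt.comp t (hγ t)).hasFDerivAt
  have h2 : mfderiv 𝓘(ℝ, E) 𝓘(ℝ, ℝ) f (γ t) ((1 : ℝ) • ξ (γ t))
      = mfderiv 𝓘(ℝ, E) 𝓘(ℝ, ℝ) f (γ t) (ξ (γ t)) := by rw [one_smul]
  exact h1.hasDerivAt.congr_deriv h2

theorem apply_isMIntegralCurve_eq {ξ : VField 𝓘(ℝ, E) M} {γ : ℝ → M}
    (hγ : IsMIntegralCurve γ ξ) {f : M → ℝ} (hf : ContMDiff 𝓘(ℝ, E) 𝓘(ℝ, ℝ) ∞ f) {q : ℝ}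
    (hq : ∀ x, mvfderiv 𝓘(ℝ, E) f x (ξ x) = q) (t : ℝ) : f (γ t) = f (γ 0) + q * t := by
  have h1 : ∀ t, HasDerivAt (fun s => f (γ s) - q * s) 0 t := by
    intro t
    have h2 := hasDerivAt_comp_isMIntegralCurve hγ (t := t) (hf.mdifferentiableAt (by simp))
    rw [hq] at h2
    exact (h2.sub ((hasDerivAt_id t).const_mul q)).congr_deriv (by ring)
  have h3 := is_const_of_deriv_eq_zero (fun t => (h1 t).differentiableAt) (fun t => (h1 t).deriv) t 0
  beta_reduce at h3
  linarith

/-- The flow of `ξ` splits `M` as `ℝ × N` when `ξ f` is a nonzero constant. -/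
theorem exists_flow_diffeomorph {E : Type u} [NormedAddCommGroup E] [NormedSpace ℝ E]
    [FiniteDimensional ℝ E] {M : Type v} [TopologicalSpace M] [ChartedSpace E M]
    [IsManifold 𝓘(ℝ, E) ∞ M] [T2Space M] [SecondCountableTopology M]
    (hE : Module.finrank ℝ E = Module.finrank ℝ F + 1) {f : M → ℝ}
    (hf : ContMDiff 𝓘(ℝ, E) 𝓘(ℝ, ℝ) ∞ f) {ξ : VField 𝓘(ℝ, E) M} (hξ : IsSmoothVField ξ)
    (hc : IsCompleteVField ξ) {q : ℝ} (hq : ∀ x, mvfderiv 𝓘(ℝ, E) f x (ξ x) = q) (hq0 : q ≠ 0) :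
    ∃ (N : Type v) (_ : TopologicalSpace N) (_ : T2Space N) (_ : SecondCountableTopology N)
      (_ : ChartedSpace F N) (_ : IsManifold 𝓘(ℝ, F) ∞ N)
      (Ψ : Diffeomorph (𝓘(ℝ, ℝ).prod 𝓘(ℝ, F)) 𝓘(ℝ, E) (ℝ × N) M ∞),
      (∀ y, IsMIntegralCurve (fun s => Ψ (s, y)) ξ) ∧ ∀ p, f (Ψ p) = q * p.1 := by
  obtain ⟨N, tN, t2N, scN, csN, mN, j, hj, hinj, hran, hlift⟩ :=
    exists_levelSet_manifold (F := F) hE hf fun p h => hq0 (by rw [← hq p, h]; rfl)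
  obtain ⟨Φ, hΦ⟩ := hc.exists_isGlobalFlow
  have hΦs := hΦ.contMDiff hξ
  have hfΦ : ∀ s x, f (Φ s x) = f x + q * s := fun s x => by
    have := apply_isMIntegralCurve_eq (hΦ.integralCurve x) hf hq s
    rwa [hΦ.zero] at this
  have hj0 : ∀ y, f (j y) = 0 := fun y => by
    have : j y ∈ {x | f x = 0} := hran ▸ mem_range_self y
    exact this
  have hproj : ∀ x, ∃ y, j y = Φ (-(f x / q)) x := fun x => by
    have : Φ (-(f x / q)) x ∈ range j := by
      rw [hran, mem_ofPred_eq, hfΦ]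
      field_simp
      ring
    exact this
  choose g hg using hproj
  have hfq : ContMDiff 𝓘(ℝ, E) 𝓘(ℝ, ℝ) ∞ fun x => f x / q := hf.div_const q
  have hgs : ContMDiff 𝓘(ℝ, E) 𝓘(ℝ, F) ∞ g := by
    refine hlift g ?_
    have h1 : j ∘ g = (fun p : ℝ × M => Φ p.1 p.2) ∘ fun x => (-(f x / q), x) := funext hg
    rw [h1]
    exact hΦs.comp (hfq.neg.prodMk contMDiff_id)
  have hΨs : ContMDiff (𝓘(ℝ, ℝ).prod 𝓘(ℝ, F)) 𝓘(ℝ, E) ∞ fun p : ℝ × N => Φ p.1 (j p.2) :=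
    hΦs.comp (contMDiff_fst.prodMk (hj.comp contMDiff_snd))
  have hfs : ∀ s y, f (Φ s (j y)) = q * s := fun s y => by rw [hfΦ, hj0, zero_add]
  refine ⟨N, tN, t2N, scN, csN, mN,
    { toFun := fun p => Φ p.1 (j p.2)
      invFun := fun x => (f x / q, g x)
      left_inv := ?_
      right_inv := ?_
      contMDiff_toFun := hΨs
      contMDiff_invFun := hfq.prodMk hgs }, fun y => hΦ.integralCurve (j y), fun p => hfs _ _⟩
  · rintro ⟨s, y⟩
    have h1 : f (Φ s (j y)) / q = s := by rw [hfs]; field_simp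
    refine Prod.ext h1 (hinj ?_)
    rw [hg, h1, ← hΦ.add hξ, neg_add_cancel, hΦ.zero]
  · intro x
    change Φ (f x / q) (j (g x)) = x
    rw [hg, ← hΦ.add hξ, add_neg_cancel, hΦ.zero]

end LevelSet

section ProductCoordinates

variable {E : Type*} [NormedAddCommGroup E] [NormedSpace ℝ E] [FiniteDimensional ℝ E]
  {H : Type*} [TopologicalSpace H] {I : ModelWithCorners ℝ E H}
  {M : Type*} [TopologicalSpace M] [ChartedSpace H M] [IsManifold I ∞ M]
  {F : Type*} [NormedAddCommGroup F] [NormedSpace ℝ F] [FiniteDimensional ℝ F]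
  {H' : Type*} [TopologicalSpace H'] {J : ModelWithCorners ℝ F H'}
  {N : Type*} [TopologicalSpace N] [ChartedSpace H' N] [IsManifold J ∞ N]

theorem isInvertible_mfderiv (f : Diffeomorph I (𝓘(ℝ, ℝ).prod J) M (ℝ × N) ∞) (x : M) :
    (mfderiv I (𝓘(ℝ, ℝ).prod J) f x).IsInvertible :=
  ⟨f.mfderivToContinuousLinearEquiv (by simp) x, rfl⟩

/-- The vector field on `M` with constant first component `a` and second component `Y` in the
product coordinates `f`. -/
noncomputable def prodField (f : Diffeomorph I (𝓘(ℝ, ℝ).prod J) M (ℝ × N) ∞) (a : ℝ)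
    (Y : VField J N) : VField I M :=
  mpullback I (𝓘(ℝ, ℝ).prod J) f fun p => ((a, Y p.2) : ℝ × F)

variable (f : Diffeomorph I (𝓘(ℝ, ℝ).prod J) M (ℝ × N) ∞)

theorem mfderiv_prodField (a : ℝ) (Y : VField J N) (x : M) :
    mfderiv I (𝓘(ℝ, ℝ).prod J) f x (prodField f a Y x) = ((a, Y (f x).2) : ℝ × F) :=
  (isInvertible_mfderiv f x).self_apply_inverse _

theorem isSmoothVField_prodField (a : ℝ) {Y : VField J N} (hY : IsSmoothVField Y) :
    IsSmoothVField (prodField f a Y) := by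
  have h1 : ContMDiff (𝓘(ℝ, ℝ).prod J) (𝓘(ℝ, ℝ).prod J).tangent ∞ (fun p : ℝ × N =>
      (TotalSpace.mk' (ℝ × F) p ((a, Y p.2) : ℝ × F) :
        TangentBundle (𝓘(ℝ, ℝ).prod J) (ℝ × N))) := by
    have h2 : ContMDiff 𝓘(ℝ, ℝ) 𝓘(ℝ, ℝ).tangent ∞ (fun t : ℝ =>
        (TotalSpace.mk' ℝ t a : TangentBundle 𝓘(ℝ, ℝ) ℝ)) := by
      intro t
      exact contMDiffAt_vectorSpace_iff_contDiffAt.2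
        (contDiffAt_const (c := a) : ContDiffAt ℝ ∞ (fun _ : ℝ => a) t)
    have h3 := (h2.comp (contMDiff_fst (I := 𝓘(ℝ, ℝ)) (J := J) (M := ℝ) (N := N))).prodMk
      (ContMDiff.comp hY (contMDiff_snd (I := 𝓘(ℝ, ℝ)) (J := J) (M := ℝ) (N := N)))
    exact (contMDiff_equivTangentBundleProd_symm (n := ∞) (I := 𝓘(ℝ, ℝ)) (M := ℝ) (I' := J)
      (M' := N)).comp h3
  exact ContMDiff.mpullback_vectorField (m := ∞) (n := ∞) h1 f.contMDiff (isInvertible_mfderiv f)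
    (by simp)

theorem contMDiff_fst_comp : ContMDiff I 𝓘(ℝ, ℝ) ∞ fun x => (f x).1 :=
  contMDiff_fst.comp f.contMDiff

theorem contMDiff_snd_comp : ContMDiff I J ∞ fun x => (f x).2 :=
  contMDiff_snd.comp f.contMDiff

theorem mvfderiv_fst_comp (x : M) (v : TangentSpace I x) :
    mvfderiv I (fun x => (f x).1) x v = (mfderiv I (𝓘(ℝ, ℝ).prod J) f x v : ℝ × F).1 := by
  have h := mfderiv_comp_apply x (mdifferentiableAt_fst (I := 𝓘(ℝ, ℝ)) (I' := J))
    (f.contMDiff.mdifferentiableAt (x := x) (by simp)) v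
  rw [mfderiv_fst] at h
  exact h

theorem mfderiv_snd_comp (x : M) (v : TangentSpace I x) :
    mfderiv I J (fun x => (f x).2) x v = (mfderiv I (𝓘(ℝ, ℝ).prod J) f x v : ℝ × F).2 := by
  have h := mfderiv_comp_apply x (mdifferentiableAt_snd (I := 𝓘(ℝ, ℝ)) (I' := J))
    (f.contMDiff.mdifferentiableAt (x := x) (by simp)) v
  rw [mfderiv_snd] at h
  exact h

theorem mvfderiv_comp_snd_prodField {G : Type*} [NormedAddCommGroup G] [NormedSpace ℝ G]
    {k : N → G} (x : M) (hk : MDifferentiableAt J 𝓘(ℝ, G) k (f x).2) (a : ℝ) (Y : VField J N) :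
    mvfderiv I (fun x => k (f x).2) x (prodField f a Y x) = mvfderiv J k (f x).2 (Y (f x).2) := by
  have h := mfderiv_comp_apply x hk ((contMDiff_snd_comp f).mdifferentiableAt (x := x) (by simp))
    (prodField f a Y x)
  rw [mfderiv_snd_comp, mfderiv_prodField] at h
  exact h

theorem mvfderiv_comp_fst_prodField {k : ℝ → ℝ} (x : M) (hk : DifferentiableAt ℝ k (f x).1)
    (a : ℝ) (Y : VField J N) :
    mvfderiv I (fun x => k (f x).1) x (prodField f a Y x) = a * deriv k (f x).1 := by
  have h := mfderiv_comp_apply x hk.mdifferentiableAt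
    ((contMDiff_fst_comp f).mdifferentiableAt (x := x) (by simp)) (prodField f a Y x)
  have h2 : mfderiv I 𝓘(ℝ, ℝ) (fun x => (f x).1) x (prodField f a Y x) = a := by
    refine (mvfderiv_fst_comp f x (prodField f a Y x)).trans ?_
    rw [mfderiv_prodField]
  rw [h2, mfderiv_eq_fderiv] at h
  refine h.trans ?_
  have h3 : fderiv ℝ k (f x).1 (a • (1 : ℝ)) = a • fderiv ℝ k (f x).1 1 := map_smul _ _ _
  rw [smul_eq_mul, mul_one, smul_eq_mul, fderiv_apply_one_eq_deriv] at h3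
  exact h3

theorem exists_prodField_apply_eq [T2Space N] (x : M) (v : TangentSpace I x) :
    ∃ (a : ℝ) (Y : VField J N), IsSmoothVField Y ∧ prodField f a Y x = v := by
  obtain ⟨Y, hY, hYx⟩ := exists_isSmoothVField_apply_eq (I := J) (x := (f x).2)
    (mfderiv I (𝓘(ℝ, ℝ).prod J) f x v : ℝ × F).2
  refine ⟨(mfderiv I (𝓘(ℝ, ℝ).prod J) f x v : ℝ × F).1, Y, hY, ?_⟩
  apply (f.mfderivToContinuousLinearEquiv (by simp) x).injective
  change mfderiv I (𝓘(ℝ, ℝ).prod J) f x _ = mfderiv I (𝓘(ℝ, ℝ).prod J) f x v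
  rw [mfderiv_prodField, hYx]
  rfl

theorem exists_contMDiff_eventuallyEq_extChartAt [T2Space N] (y₀ : N) :
    ∃ k : N → F, ContMDiff J 𝓘(ℝ, F) ∞ k ∧ k =ᶠ[𝓝 y₀] extChartAt J y₀ := by
  let b : SmoothBumpFunction J y₀ := Classical.arbitrary _
  refine ⟨fun y => b y • extChartAt J y₀ y, b.contMDiff_smul contMDiffOn_extChartAt, ?_⟩
  filter_upwards [b.eventuallyEq_one] with y hy
  simp [hy]

theorem two_le_infty : (2 : WithTop ℕ∞) ≤ ∞ :=
  ENat.LEInfty.out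

theorem mfderiv_mlieBracket_prodField [T2Space N] [I.Boundaryless] [J.Boundaryless] (a b : ℝ)
    {Y Z : VField J N} (hY : IsSmoothVField Y) (hZ : IsSmoothVField Z) (x : M) :
    mfderiv I (𝓘(ℝ, ℝ).prod J) f x (mlieBracket I (prodField f a Y) (prodField f b Z) x)
      = ((0, mlieBracket J Y Z (f x).2) : ℝ × F) := by
  have hYs := isSmoothVField_prodField f a hY
  have hZs := isSmoothVField_prodField f b hZ
  refine Prod.ext ?_ ?_
  · refine (mvfderiv_fst_comp f x _).symm.trans ?_
    rw [mvfderiv_mlieBracket (((contMDiff_fst_comp f) x).of_le two_le_infty)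
      (hYs.mdifferentiableAt x) (hZs.mdifferentiableAt x)]
    have h1 : ∀ (c : ℝ) (W : VField J N),
        (fun x' => mvfderiv I (fun x => (f x).1) x' (prodField f c W x')) = fun _ => c := by
      intro c W
      funext x'
      rw [mvfderiv_fst_comp, mfderiv_prodField]
    rw [h1, h1, mvfderiv_const, mvfderiv_const]
    simp
  · obtain ⟨k, hk, hke⟩ := exists_contMDiff_eventuallyEq_extChartAt (J := J) (f x).2
    have hkd := mvfderiv_congr (I := J) hke
    have hinj : Function.Injective (mvfderiv J k (f x).2) := by
      rw [hkd]
      exact mvfderiv_extChartAt_injective (I := J)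
        (FiberBundle.mem_baseSet_trivializationAt' (f x).2)
    apply hinj
    have h1 := mfderiv_comp_apply x (hk.mdifferentiableAt (x := (f x).2) (by simp))
      ((contMDiff_snd_comp f).mdifferentiableAt (x := x) (by simp))
      (mlieBracket I (prodField f a Y) (prodField f b Z) x)
    rw [mfderiv_snd_comp] at h1
    refine Eq.trans h1.symm ?_
    have hks : ContMDiff I 𝓘(ℝ, F) ∞ (fun x => k (f x).2) := hk.comp (contMDiff_snd_comp f)
    refine (mvfderiv_mlieBracket ((hks x).of_le two_le_infty)
      (hYs.mdifferentiableAt x) (hZs.mdifferentiableAt x)).trans ?_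
    have h2 : ∀ (c : ℝ) (W : VField J N),
        (fun x' => mvfderiv I (fun x => k (f x).2) x' (prodField f c W x'))
          = fun x' => (fun y => mvfderiv J k y (W y)) (f x').2 := by
      intro c W
      funext x'
      rw [mvfderiv_comp_snd_prodField f x' (hk.mdifferentiableAt (by simp))]
    rw [h2, h2, mvfderiv_comp_snd_prodField f x
      ((contMDiff_mvfderiv_apply hk hZ).mdifferentiableAt (by simp)),
      mvfderiv_comp_snd_prodField f x
      ((contMDiff_mvfderiv_apply hk hY).mdifferentiableAt (by simp))]
    exact (mvfderiv_mlieBracket ((hk _).of_le two_le_infty)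
      (hY.mdifferentiableAt _) (hZ.mdifferentiableAt _)).symm

theorem mlieBracket_prodField [T2Space N] [I.Boundaryless] [J.Boundaryless] (a b : ℝ)
    {Y Z : VField J N} (hY : IsSmoothVField Y) (hZ : IsSmoothVField Z) :
    mlieBracket I (prodField f a Y) (prodField f b Z) = prodField f 0 (mlieBracket J Y Z) := by
  funext x
  apply (f.mfderivToContinuousLinearEquiv (by simp) x).injective
  change mfderiv I (𝓘(ℝ, ℝ).prod J) f x _ = mfderiv I (𝓘(ℝ, ℝ).prod J) f x _
  rw [mfderiv_mlieBracket_prodField f a b hY hZ, mfderiv_prodField]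

theorem isSmoothVField_zero : IsSmoothVField (0 : VField I M) :=
  Bundle.contMDiff_zeroSection ℝ (TangentSpace I : M → Type _)

theorem prodField_add (a b : ℝ) (Y Z : VField J N) :
    prodField f (a + b) (Y + Z) = prodField f a Y + prodField f b Z := by
  funext x
  apply (f.mfderivToContinuousLinearEquiv (by simp) x).injective
  change mfderiv I (𝓘(ℝ, ℝ).prod J) f x _ =
    mfderiv I (𝓘(ℝ, ℝ).prod J) f x (prodField f a Y x + prodField f b Z x)
  rw [map_add, mfderiv_prodField, mfderiv_prodField, mfderiv_prodField]
  rfl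

theorem prodField_const_smul (c a : ℝ) (Y : VField J N) :
    prodField f (c * a) (c • Y) = c • prodField f a Y := by
  funext x
  apply (f.mfderivToContinuousLinearEquiv (by simp) x).injective
  change mfderiv I (𝓘(ℝ, ℝ).prod J) f x _ =
    mfderiv I (𝓘(ℝ, ℝ).prod J) f x (c • prodField f a Y x)
  rw [map_smul, mfderiv_prodField, mfderiv_prodField]
  rfl

theorem warpedProduct_apply (ε : ℝ) (h : BilinField J N) (p : ℝ × N)
    (v w : TangentSpace (𝓘(ℝ, ℝ).prod J) p) :
    warpedProduct ε h p v w = ε * ((v : ℝ × F).1 * (w : ℝ × F).1)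
      + Real.exp (2 * ε * p.1) * h p.2 (v : ℝ × F).2 (w : ℝ × F).2 := by
  have h1 : ∀ v : TangentSpace (𝓘(ℝ, ℝ).prod J) p,
      mfderiv (𝓘(ℝ, ℝ).prod J) 𝓘(ℝ, ℝ) Prod.fst p v = (v : ℝ × F).1 := by
    intro v; rw [mfderiv_fst]; rfl
  have h2 : ∀ v : TangentSpace (𝓘(ℝ, ℝ).prod J) p,
      mfderiv (𝓘(ℝ, ℝ).prod J) J Prod.snd p v = (v : ℝ × F).2 := by
    intro v; rw [mfderiv_snd]; rfl
  let α : TangentSpace (𝓘(ℝ, ℝ).prod J) p → ℝ :=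
    fun v => mfderiv (𝓘(ℝ, ℝ).prod J) 𝓘(ℝ, ℝ) Prod.fst p v
  have h1 : ∀ v, α v = (v : ℝ × F).1 := h1
  have h3 : warpedProduct ε h p v w = ε * (α v * α w)
        + Real.exp (2 * ε * p.1) * h p.2 (mfderiv (𝓘(ℝ, ℝ).prod J) J Prod.snd p v)
          (mfderiv (𝓘(ℝ, ℝ).prod J) J Prod.snd p w) := rfl
  rw [h3, h1, h1, h2, h2]

theorem pullback_warpedProduct_prodField (ε : ℝ) (h : BilinField J N) (a b : ℝ)
    (Y Z : VField J N) (x : M) :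
    pullback I f (warpedProduct ε h) x (prodField f a Y x) (prodField f b Z x)
      = ε * (a * b) + Real.exp (2 * ε * (f x).1) * h (f x).2 (Y (f x).2) (Z (f x).2) := by
  change warpedProduct ε h (f x) (mfderiv I (𝓘(ℝ, ℝ).prod J) f x (prodField f a Y x))
    (mfderiv I (𝓘(ℝ, ℝ).prod J) f x (prodField f b Z x)) = _
  rw [warpedProduct_apply, mfderiv_prodField, mfderiv_prodField]

end ProductCoordinates

section ExteriorDerivative

variable {E : Type*} [NormedAddCommGroup E] [NormedSpace ℝ E] [FiniteDimensional ℝ E]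
  {H : Type*} [TopologicalSpace H] {I : ModelWithCorners ℝ E H}
  {M : Type*} [TopologicalSpace M] [ChartedSpace H M] [IsManifold I ∞ M]

/-- The exterior derivative of a 1-form, evaluated on two vector fields. -/
noncomputable def oneFormDeriv (θ : (x : M) → TangentSpace I x →L[ℝ] ℝ) (X Y : VField I M) (x : M) :
    ℝ :=
  mvfderiv I (fun y => θ y (Y y)) x (X x) - mvfderiv I (fun y => θ y (X y)) x (Y x)
    - θ x (mlieBracket I X Y x)

/-- The exterior derivative of an exact 2-form vanishes. -/
theorem cyclic_oneFormDeriv [I.Boundaryless] {θ : (x : M) → TangentSpace I x →L[ℝ] ℝ}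
    (hθ : ∀ X : VField I M, IsSmoothVField X → ContMDiff I 𝓘(ℝ, ℝ) ∞ (fun x => θ x (X x)))
    {X Y Z : VField I M} (hX : IsSmoothVField X) (hY : IsSmoothVField Y) (hZ : IsSmoothVField Z)
    (x : M) :
    mvfderiv I (oneFormDeriv θ Y Z) x (X x) + mvfderiv I (oneFormDeriv θ Z X) x (Y x)
      + mvfderiv I (oneFormDeriv θ X Y) x (Z x)
      = oneFormDeriv θ (mlieBracket I X Y) Z x + oneFormDeriv θ (mlieBracket I Y Z) X x
        + oneFormDeriv θ (mlieBracket I Z X) Y x := by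
  have hmd : ∀ {f : M → ℝ}, ContMDiff I 𝓘(ℝ, ℝ) ∞ f → MDifferentiableAt I 𝓘(ℝ, ℝ) f x :=
    fun hf => hf.mdifferentiableAt (by simp)
  have hexp : ∀ {X Y Z : VField I M}, IsSmoothVField X → IsSmoothVField Y → IsSmoothVField Z →
      mvfderiv I (oneFormDeriv θ Y Z) x (X x) =
        mvfderiv I (fun z => mvfderiv I (fun y => θ y (Z y)) z (Y z)) x (X x)
        - mvfderiv I (fun z => mvfderiv I (fun y => θ y (Y y)) z (Z z)) x (X x)
        - mvfderiv I (fun y => θ y (mlieBracket I Y Z y)) x (X x) := by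
    intro X Y Z hX hY hZ
    have h1 := hmd (contMDiff_mvfderiv_apply (hθ Z hZ) hY)
    have h2 := hmd (contMDiff_mvfderiv_apply (hθ Y hY) hZ)
    have h3 := hmd (hθ _ (hY.mlieBracket hZ))
    have h4 : oneFormDeriv θ Y Z = ((fun z => mvfderiv I (fun y => θ y (Z y)) z (Y z))
        - (fun z => mvfderiv I (fun y => θ y (Y y)) z (Z z)))
        - fun y => θ y (mlieBracket I Y Z y) := rfl
    rw [h4, mvfderiv_sub (h1.sub h2) h3, mvfderiv_sub h1 h2]
    rfl
  have hbr : ∀ {X Y Z : VField I M}, IsSmoothVField X → IsSmoothVField Y → IsSmoothVField Z →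
      mvfderiv I (fun y => θ y (Z y)) x (mlieBracket I X Y x) =
        mvfderiv I (fun z => mvfderiv I (fun y => θ y (Z y)) z (Y z)) x (X x)
        - mvfderiv I (fun z => mvfderiv I (fun y => θ y (Z y)) z (X z)) x (Y x) :=
    fun hX hY hZ => mvfderiv_mlieBracket ((hθ _ hZ x).of_le two_le_infty) (hX.mdifferentiableAt x)
      (hY.mdifferentiableAt x)
  have hjac : θ x (mlieBracket I (mlieBracket I X Y) Z x)
      + θ x (mlieBracket I (mlieBracket I Y Z) X x)
      + θ x (mlieBracket I (mlieBracket I Z X) Y x) = 0 := by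
    have hs : ∀ {X : VField I M}, IsSmoothVField X → ContMDiffAt I I.tangent (minSmoothness ℝ 2)
        (fun y => (TotalSpace.mk' E y (X y) : TangentBundle I M)) x :=
      fun hX => (hX x).of_le (by simpa using two_le_infty)
    have h1 := leibniz_identity_mlieBracket_apply (hs hX) (hs hY) (hs hZ)
    rw [mlieBracket_swap_apply (V := X) (W := mlieBracket I Y Z),
      mlieBracket_swap_apply (V := Y) (W := mlieBracket I X Z),
      mlieBracket_swap (V := X) (W := Z)] at h1
    have h2 : mlieBracket I (-mlieBracket I Z X) Y x = - mlieBracket I (mlieBracket I Z X) Y x := by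
      have := mlieBracket_const_smul_left (I := I) (c := (-1 : ℝ)) (W := Y)
        ((hZ.mlieBracket hX).mdifferentiableAt x)
      simpa using this
    rw [h2, neg_neg, neg_eq_iff_eq_neg] at h1
    rw [h1]
    simp
  rw [hexp hX hY hZ, hexp hY hZ hX, hexp hZ hX hY]
  simp only [oneFormDeriv]
  rw [hbr hX hY hZ, hbr hY hZ hX, hbr hZ hX hY]
  linarith

end ExteriorDerivative

section Connection

variable {E : Type*} [NormedAddCommGroup E] [NormedSpace ℝ E] [FiniteDimensional ℝ E]
  {H : Type*} [TopologicalSpace H] {I : ModelWithCorners ℝ E H}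
  {M : Type*} [TopologicalSpace M] [ChartedSpace H M] [IsManifold I ∞ M]
  {g : BilinField I M} {D : CovariantDerivative I E (TangentSpace I : M → Type _)}
  {ξ : VField I M} {S : TrilinField I M}

theorem isSmoothVField_connection (hD : D.ContMDiffCovariantDerivative ∞) {Y V : VField I M}
    (hY : IsSmoothVField Y) (hV : IsSmoothVField V) : IsSmoothVField (fun x => D Y x (V x)) := by
  intro x
  have h := hD.contMDiff.contMDiff (σ := Y) (contMDiffOn_univ.2 hY)
  rw [contMDiffOn_univ] at h
  exact ContMDiffAt.clm_bundle_apply (h x) (hV x)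

theorem isSmoothVField_torsion (hD : D.ContMDiffCovariantDerivative ∞) {Y Z : VField I M}
    (hY : IsSmoothVField Y) (hZ : IsSmoothVField Z) :
    IsSmoothVField (fun x => D.torsion x (Y x) (Z x)) := by
  have h : (fun x => D.torsion x (Y x) (Z x)) =
      fun x => D Z x (Y x) - D Y x (Z x) - mlieBracket I Y Z x :=
    funext fun x => D.torsion_apply (hY.mdifferentiableAt x) (hZ.mdifferentiableAt x)
  rw [h]
  exact ((isSmoothVField_connection hD hZ hY).sub_section
    (isSmoothVField_connection hD hY hZ)).sub_section (hY.mlieBracket hZ)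

/-- A metric connection with parallel twistor-free torsion, whose vectorial component is a
vector field `ξ` without null vectors. -/
structure IsParallelTwistorFree (g : BilinField I M)
    (D : CovariantDerivative I E (TangentSpace I : M → Type _)) (ξ : VField I M)
    (S : TrilinField I M) : Prop extends IsMetricConnection g D where
  pseudo : IsPseudoRiemannian g
  parallel : HasParallelTorsion D
  smooth_vfield : IsSmoothVField ξ
  three_form : IsThreeForm S
  components : HasTorsionComponents g D ξ S
  nonnull : ∀ x, g x (ξ x) (ξ x) ≠ 0

namespace IsParallelTwistorFree

theorem apply_torsion (h : IsParallelTwistorFree g D ξ S) (x : M) (u v w : TangentSpace I x) :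
    g x (D.torsion x u v) w
      = g x u (ξ x) * g x v w - g x v (ξ x) * g x u w + S x u v w := by
  rw [h.components]
  simp

theorem apply_torsion_add (h : IsParallelTwistorFree g D ξ S) (x : M)
    (u v w : TangentSpace I x) :
    g x (D.torsion x u v) w + g x (D.torsion x u w) v
      = 2 * (g x u (ξ x) * g x v w) - g x v (ξ x) * g x u w - g x w (ξ x) * g x u v := by
  rw [h.apply_torsion, h.apply_torsion, h.three_form.swap_right x u w v, h.pseudo.symm x w v]
  ring

theorem apply_connection_mul (h : IsParallelTwistorFree g D ξ S) [T2Space M] (x : M)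
    (w u z : TangentSpace I x) :
    g x u (D ξ x w) * g x z z = g x z (D ξ x w) * g x u z := by
  obtain ⟨Y, hY, rfl⟩ := exists_isSmoothVField_apply_eq u
  obtain ⟨Z, hZ, rfl⟩ := exists_isSmoothVField_apply_eq z
  have hT := isSmoothVField_torsion h.smooth hY hZ
  have hmd : ∀ {X Y : VField I M}, IsSmoothVField X → IsSmoothVField Y →
      MDifferentiableAt I 𝓘(ℝ, ℝ) (pairing g X Y) x :=
    fun hX hY => (h.pseudo.contMDiff_pairing hX hY).mdifferentiableAt (by simp)
  have hm : ∀ {X Y : VField I M}, IsSmoothVField X → IsSmoothVField Y →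
      mvfderiv I (pairing g X Y) x w = g x (D X x w) (Y x) + g x (X x) (D Y x w) :=
    fun hX hY => h.metric _ _ hX hY x w
  have h1 : pairing g (fun y => D.torsion y (Y y) (Z y)) Z
      = pairing g Y ξ * pairing g Z Z - pairing g Z ξ * pairing g Y Z := by
    funext y
    simp only [pairing, Pi.sub_apply, Pi.mul_apply]
    linarith [h.apply_torsion_add y (Y y) (Z y) (Z y)]
  have h2 := DFunLike.congr_fun (congrArg (fun f => mvfderiv I f x) h1) w
  have hξ := h.smooth_vfield
  rw [mvfderiv_sub ((hmd hY hξ).mul (hmd hZ hZ)) ((hmd hZ hξ).mul (hmd hY hZ)),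
    mvfderiv_mul (hmd hY hξ) (hmd hZ hZ), mvfderiv_mul (hmd hZ hξ) (hmd hY hZ)] at h2
  simp only [sub_apply, add_apply, smul_apply, smul_eq_mul, hm hT hZ, hm hY hξ, hm hZ hZ, hm hZ hξ,
    hm hY hZ] at h2
  rw [h.parallel Y Z hY hZ, map_add, add_apply] at h2
  have h3 := h.apply_torsion_add x (Y x) (Z x) (D Z x w)
  have h4 := h.apply_torsion_add x (D Y x w) (Z x) (Z x)
  simp only [pairing] at h2
  rw [h.pseudo.symm x (D Z x w) (Z x)] at h2
  linarith

/-- The vectorial component is parallel. -/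
theorem connection_eq_zero (h : IsParallelTwistorFree g D ξ S) [T2Space M]
    (hE : 2 ≤ Module.finrank ℝ E) (x : M) (w : TangentSpace I x) : D ξ x w = 0 := by
  have hg := h.pseudo
  have hq := h.nonnull x
  set q := g x (ξ x) (ξ x)
  have key := h.apply_connection_mul x w
  set e := D ξ x w
  set c := g x (ξ x) e with hc
  have he : ∀ u, g x u e * q = c * g x u (ξ x) := fun u => key u (ξ x)
  by_cases hc0 : c = 0
  · refine hg.nondegenerate x _ fun u => ?_
    have := he u
    rw [hc0, zero_mul] at this
    rw [hg.symm]
    exact (mul_eq_zero.1 this).resolve_right hq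
  exfalso
  have hnull : ∀ z, g x z (ξ x) = 0 → g x z z = 0 := by
    intro z hz
    have h1 := key (ξ x) z
    rw [hg.symm x (ξ x) z, hz, mul_zero] at h1
    exact (mul_eq_zero.1 h1).resolve_left hc0
  have hzero : ∀ z, g x z (ξ x) = 0 → z = 0 := by
    intro z hz
    refine hg.nondegenerate x z fun v => ?_
    let v' := v - (g x v (ξ x) / q) • ξ x
    have hv' : g x v' (ξ x) = 0 := by
      simp only [v', map_sub, map_smul, sub_apply, smul_apply, smul_eq_mul]
      rw [div_mul_cancel₀ _ hq, sub_self]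
    have h1 := hnull (z + v') (by rw [map_add, add_apply, hz, hv', add_zero])
    simp only [map_add, add_apply] at h1
    rw [hnull z hz, hnull v' hv', hg.symm x v' z] at h1
    have h2 : g x z v' = g x z v := by simp [v', hz]
    linarith
  have hspan : ∀ v : TangentSpace I x, ∃ c : ℝ, c • ξ x = v := by
    intro v
    refine ⟨g x v (ξ x) / q, ?_⟩
    symm
    rw [← sub_eq_zero]
    refine hzero _ ?_
    simp only [map_sub, map_smul, sub_apply, smul_apply, smul_eq_mul]
    rw [div_mul_cancel₀ _ hq, sub_self]
  have h1 : Module.finrank ℝ E ≤ 1 := finrank_le_one (ξ x : E) hspan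
  omega

theorem mvfderiv_pairing_self (h : IsParallelTwistorFree g D ξ S) [T2Space M]
    (hE : 2 ≤ Module.finrank ℝ E) (x : M) : mvfderiv I (pairing g ξ ξ) x = 0 := by
  ext v
  have h1 := h.metric ξ ξ h.smooth_vfield h.smooth_vfield x v
  rw [h.connection_eq_zero hE, map_zero, map_zero, zero_apply, add_zero] at h1
  exact h1

/-- The vectorial component has constant square. -/
theorem exists_apply_self_eq (h : IsParallelTwistorFree g D ξ S) [T2Space M] [I.Boundaryless]
    [ConnectedSpace M] (hE : 2 ≤ Module.finrank ℝ E) : ∃ q, ∀ x, g x (ξ x) (ξ x) = q := by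
  have h1 : IsLocallyConstant (pairing g ξ ξ) := by
    rw [IsLocallyConstant.iff_eventually_eq]
    intro x
    exact eventually_eq_of_mvfderiv_eq_zero (Eventually.of_forall fun y =>
      ⟨(h.pseudo.contMDiff_pairing h.smooth_vfield h.smooth_vfield).mdifferentiableAt (by simp),
        h.mvfderiv_pairing_self hE y⟩)
  obtain ⟨x₀⟩ := (inferInstance : Nonempty M)
  exact ⟨pairing g ξ ξ x₀, fun x => h1.apply_eq_of_preconnectedSpace x x₀⟩

/-- The exterior derivative of the 1-form dual to `ξ`. -/
theorem oneFormDeriv_dual (h : IsParallelTwistorFree g D ξ S) [T2Space M]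
    (hE : 2 ≤ Module.finrank ℝ E) {X Y : VField I M} (hX : IsSmoothVField X)
    (hY : IsSmoothVField Y) (x : M) :
    oneFormDeriv (fun x => g x (ξ x)) X Y x = g x (ξ x) (D.torsion x (X x) (Y x)) := by
  have h1 : ∀ {X : VField I M}, IsSmoothVField X → ∀ v,
      mvfderiv I (fun y => g y (ξ y) (X y)) x v = g x (ξ x) (D X x v) := by
    intro X hX v
    rw [h.metric ξ X h.smooth_vfield hX x v, h.connection_eq_zero hE, map_zero, zero_apply,
      zero_add]
  rw [oneFormDeriv, h1 hX, h1 hY, D.torsion_apply (hX.mdifferentiableAt x) (hY.mdifferentiableAt x),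
    map_sub, map_sub]

theorem apply_vfield_torsion (h : IsParallelTwistorFree g D ξ S) (x : M) (u v : TangentSpace I x) :
    g x (ξ x) (D.torsion x u v) = S x u v (ξ x) := by
  rw [h.pseudo.symm, h.apply_torsion]
  ring

theorem cyclic_apply_torsion (h : IsParallelTwistorFree g D ξ S) [T2Space M] [I.Boundaryless]
    (hE : 2 ≤ Module.finrank ℝ E) (x : M) (u v w : TangentSpace I x) :
    g x (ξ x) (D.torsion x (D.torsion x u v) w) + g x (ξ x) (D.torsion x (D.torsion x v w) u)
      + g x (ξ x) (D.torsion x (D.torsion x w u) v) = 0 := by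
  obtain ⟨X, hX, rfl⟩ := exists_isSmoothVField_apply_eq u
  obtain ⟨Y, hY, rfl⟩ := exists_isSmoothVField_apply_eq v
  obtain ⟨Z, hZ, rfl⟩ := exists_isSmoothVField_apply_eq w
  have h1 := cyclic_oneFormDeriv (θ := fun x => g x (ξ x))
    (fun X hX => h.pseudo.contMDiff_pairing h.smooth_vfield hX) hX hY hZ x
  have h2 : ∀ {X Y : VField I M}, IsSmoothVField X → IsSmoothVField Y →
      oneFormDeriv (fun x => g x (ξ x)) X Y = fun x => g x (ξ x) (D.torsion x (X x) (Y x)) :=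
    fun hX hY => funext fun x => h.oneFormDeriv_dual hE hX hY x
  have h3 : ∀ {X Y : VField I M}, IsSmoothVField X → IsSmoothVField Y → ∀ v,
      mvfderiv I (fun x => g x (ξ x) (D.torsion x (X x) (Y x))) x v =
        g x (ξ x) (D.torsion x (D X x v) (Y x)) + g x (ξ x) (D.torsion x (X x) (D Y x v)) := by
    intro X Y hX hY v
    rw [h.metric ξ _ h.smooth_vfield (isSmoothVField_torsion h.smooth hX hY) x v,
      h.connection_eq_zero hE, map_zero, zero_apply, zero_add, h.parallel X Y hX hY, map_add]
  have h4 : ∀ {X Y : VField I M}, IsSmoothVField X → IsSmoothVField Y →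
      mlieBracket I X Y x = D Y x (X x) - D X x (Y x) - D.torsion x (X x) (Y x) := by
    intro X Y hX hY
    rw [D.torsion_apply (hX.mdifferentiableAt x) (hY.mdifferentiableAt x)]
    abel
  rw [h2 hX hY, h2 hY hZ, h2 hZ hX, h2 (hX.mlieBracket hY) hZ, h2 (hY.mlieBracket hZ) hX,
    h2 (hZ.mlieBracket hX) hY, h3 hX hY, h3 hY hZ, h3 hZ hX] at h1
  beta_reduce at h1
  rw [h4 hX hY, h4 hY hZ, h4 hZ hX] at h1
  simp only [map_sub, sub_apply] at h1
  rw [D.torsion_antisymm (X x) (D Y x (Z x)), D.torsion_antisymm (Y x) (D Z x (X x)),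
    D.torsion_antisymm (Z x) (D X x (Y x))] at h1
  simp only [map_neg] at h1
  linarith

theorem apply_vfield_torsion_eq_zero (h : IsParallelTwistorFree g D ξ S) [T2Space M]
    [I.Boundaryless] (hE : 2 ≤ Module.finrank ℝ E) (x : M) (u v : TangentSpace I x) :
    g x (ξ x) (D.torsion x u v) = 0 := by
  have hg := h.pseudo
  have hS := h.three_form
  have hSξ : ∀ u, S x u (ξ x) (ξ x) = 0 := fun u => by
    have := hS.swap_right x u (ξ x) (ξ x)
    linarith
  have hξS : ∀ u v, S x (ξ x) u v = S x u v (ξ x) := fun u v => by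
    rw [hS.swap_left x, hS.swap_right x, neg_neg]
  have h1 := h.cyclic_apply_torsion hE x (ξ x) u v
  rw [D.torsion_antisymm v (ξ x), map_neg, neg_apply, map_neg] at h1
  rw [h.apply_vfield_torsion x _ (ξ x), hSξ, h.apply_vfield_torsion, h.apply_vfield_torsion] at h1
  have h2 : ∀ u z, S x u z (ξ x) = g x (D.torsion x (ξ x) u) z - g x (ξ x) (ξ x) * g x u z
      + g x u (ξ x) * g x (ξ x) z := fun u z => by
    rw [h.apply_torsion, hξS]
    ring
  have h3 : ∀ u, g x (ξ x) (D.torsion x (ξ x) u) = 0 := fun u => by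
    rw [h.apply_vfield_torsion, hS.swap_left, hSξ, neg_zero]
  have h4 : ∀ u v, S x (D.torsion x (ξ x) u) v (ξ x) =
      - g x (D.torsion x (ξ x) v) (D.torsion x (ξ x) u)
        + g x (ξ x) (ξ x) * g x v (D.torsion x (ξ x) u) := fun u v => by
    rw [hS.swap_left, h2, h3]
    ring
  have h6 := h2 u v
  have h7 := h2 v u
  rw [h4 u v, h4 v u, hg.symm x (D.torsion x (ξ x) v) (D.torsion x (ξ x) u),
    hg.symm x v (D.torsion x (ξ x) u), hg.symm x u (D.torsion x (ξ x) v)] at h1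
  rw [hg.symm x u (ξ x)] at h6
  rw [hg.symm x v (ξ x), hS.swap_left x v u, hg.symm x v u] at h7
  rw [h.apply_vfield_torsion]
  have h5 : g x (ξ x) (ξ x) * S x u v (ξ x) = 0 := by
    linear_combination h1 / 2 + g x (ξ x) (ξ x) / 2 * (h6 - h7)
  exact (mul_eq_zero.1 h5).resolve_left (h.nonnull x)

/-- The 1-form dual to `ξ` is closed. -/
theorem isClosedOneForm (h : IsParallelTwistorFree g D ξ S) [T2Space M] [I.Boundaryless]
    (hE : 2 ≤ Module.finrank ℝ E) : IsClosedOneForm (fun x => g x (ξ x)) where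
  smooth X hX := h.pseudo.contMDiff_pairing h.smooth_vfield hX
  closed X Y hX hY x := by
    have h1 := h.oneFormDeriv_dual hE hX hY x
    rw [h.apply_vfield_torsion_eq_zero hE, oneFormDeriv] at h1
    exact sub_eq_zero.1 h1

theorem torsion_vfield (h : IsParallelTwistorFree g D ξ S) [T2Space M] [I.Boundaryless]
    (hE : 2 ≤ Module.finrank ℝ E) (x : M) (u : TangentSpace I x) (hu : g x (ξ x) u = 0) :
    D.torsion x (ξ x) u = g x (ξ x) (ξ x) • u := by
  refine h.pseudo.ext fun z => ?_
  have h1 := h.apply_vfield_torsion_eq_zero hE x u z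
  rw [h.apply_vfield_torsion] at h1
  rw [h.apply_torsion, h.pseudo.symm x u (ξ x), hu, h.three_form.swap_left,
    h.three_form.swap_right, h1]
  simp

/-- Along `ξ`, the metric on fields orthogonal to `ξ` and commuting with `ξ` grows exponentially. -/
theorem mvfderiv_pairing_of_commute (h : IsParallelTwistorFree g D ξ S) [T2Space M]
    [I.Boundaryless] (hE : 2 ≤ Module.finrank ℝ E) {X Y : VField I M} (hX : IsSmoothVField X)
    (hY : IsSmoothVField Y) (hξX : mlieBracket I ξ X = 0) (hξY : mlieBracket I ξ Y = 0)
    (hX0 : ∀ x, g x (ξ x) (X x) = 0) (hY0 : ∀ x, g x (ξ x) (Y x) = 0) (x : M) :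
    mvfderiv I (pairing g X Y) x (ξ x) = 2 * g x (ξ x) (ξ x) * pairing g X Y x := by
  have h1 : ∀ {X : VField I M}, IsSmoothVField X → mlieBracket I ξ X = 0 →
      (∀ x, g x (ξ x) (X x) = 0) → D X x (ξ x) = g x (ξ x) (ξ x) • X x := by
    intro X hX hξX hX0
    rw [← h.torsion_vfield hE x _ (hX0 x), D.torsion_apply (h.smooth_vfield.mdifferentiableAt x)
      (hX.mdifferentiableAt x), hξX, h.connection_eq_zero hE]
    simp
  have h2 := h.metric X Y hX hY x (ξ x)
  rw [h1 hX hξX hX0, h1 hY hξY hY0] at h2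
  refine Eq.trans h2 ?_
  simp only [map_smul, smul_apply, smul_eq_mul, pairing]
  ring

end IsParallelTwistorFree

end Connection

section Signature

variable {E : Type*} [NormedAddCommGroup E] [NormedSpace ℝ E] [FiniteDimensional ℝ E]
  {H : Type*} [TopologicalSpace H] {I : ModelWithCorners ℝ E H}
  {M : Type*} [TopologicalSpace M] [ChartedSpace H M] [IsManifold I ∞ M]
  {F : Type*} [NormedAddCommGroup F] [NormedSpace ℝ F] [FiniteDimensional ℝ F]
  {H' : Type*} [TopologicalSpace H'] {J : ModelWithCorners ℝ F H'}
  {N : Type*} [TopologicalSpace N] [ChartedSpace H' N] [IsManifold J ∞ N]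

/-- The orthogonal complement of a timelike vector is positive definite. -/
theorem IsLorentzian.pos_of_orthogonal {g : BilinField I M} (hg : IsLorentzian g) {x : M}
    {v w : TangentSpace I x} (hv : g x v v < 0) (hvw : g x v w = 0) (hw : w ≠ 0) :
    0 < g x w w := by
  obtain ⟨v₀, -, h₀⟩ := hg.index_one x
  have hα : g x v₀ v ≠ 0 := by
    intro h
    rcases eq_or_ne v 0 with rfl | hv0
    · simp at hv
    · exact absurd (h₀ v h hv0) (not_lt.2 hv.le)
  set α := g x v₀ v
  set β := g x v₀ w with hβ
  have hz : g x v₀ (α • w - β • v) = 0 := by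
    simp only [map_sub, map_smul, smul_eq_mul]
    ring
  have hzz : g x (α • w - β • v) (α • w - β • v) = α ^ 2 * g x w w + β ^ 2 * g x v v := by
    simp only [map_sub, map_smul, smul_eq_mul, sub_apply, smul_apply]
    rw [hvw, hg.symm x w v, hvw]
    ring
  have hα2 : 0 < α ^ 2 := by positivity
  by_cases h0 : α • w - β • v = 0
  · exfalso
    have h1 : g x v (α • w - β • v) = 0 := by rw [h0, map_zero]
    simp only [map_sub, map_smul, smul_eq_mul, hvw, mul_zero, zero_sub, neg_eq_zero] at h1
    have hβ0 : β = 0 := (mul_eq_zero.1 h1).resolve_right hv.ne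
    rw [hβ0, zero_smul, sub_zero] at h0
    exact (smul_eq_zero.1 h0).elim hα hw
  · have h1 := h₀ _ hz h0
    rw [hzz] at h1
    have h2 : 0 ≤ β ^ 2 * -g x v v := mul_nonneg (sq_nonneg _) (by linarith)
    refine pos_of_mul_pos_right (a := α ^ 2) ?_ hα2.le
    linarith

variable {g : BilinField I M} {h : BilinField J N} {c ε : ℝ}
  {f : Diffeomorph I (𝓘(ℝ, ℝ).prod J) M (ℝ × N) ∞}

theorem apply_prodField_of_homothetic
    (hfg : ∀ x, g x = c • pullback I f (warpedProduct ε h) x) (a b : ℝ) (Y Z : VField J N) (x : M) :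
    g x (prodField f a Y x) (prodField f b Z x)
      = c * (ε * (a * b) + Real.exp (2 * ε * (f x).1) * h (f x).2 (Y (f x).2) (Z (f x).2)) := by
  rw [hfg, ← pullback_warpedProduct_prodField]
  rfl

theorem apply_slice_of_homothetic (hfg : ∀ x, g x = c • pullback I f (warpedProduct ε h) x)
    (hc : 0 < c) (Y Z : VField J N) (y : N) :
    h y (Y y) (Z y) = c⁻¹ * pairing g (prodField f 0 Y) (prodField f 0 Z) (f.symm (0, y)) := by
  have h1 := apply_prodField_of_homothetic hfg 0 0 Y Z (f.symm (0, y))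
  rw [pairing, h1, f.apply_symm_apply]
  simp only [mul_zero, Real.exp_zero, one_mul, zero_add]
  rw [inv_mul_cancel_left₀ hc.ne']

theorem isPseudoRiemannian_of_homothetic [T2Space N]
    (hfg : ∀ x, g x = c • pullback I f (warpedProduct ε h) x) (hc : 0 < c)
    (hg : IsPseudoRiemannian g) : IsPseudoRiemannian h where
  smooth := by
    refine contMDiff_bilinField fun Y Z hY hZ => ?_
    have h1 : (fun y => h y (Y y) (Z y)) = fun y =>
        c⁻¹ * pairing g (prodField f 0 Y) (prodField f 0 Z) (f.symm (0, y)) :=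
      funext fun y => apply_slice_of_homothetic hfg hc Y Z y
    rw [h1]
    refine contMDiff_const.mul ((hg.contMDiff_pairing (isSmoothVField_prodField f 0 hY)
      (isSmoothVField_prodField f 0 hZ)).comp (f.symm.contMDiff.comp ?_))
    exact contMDiff_const.prodMk contMDiff_id
  symm y v w := by
    obtain ⟨Y, hY, rfl⟩ := exists_isSmoothVField_apply_eq v
    obtain ⟨Z, hZ, rfl⟩ := exists_isSmoothVField_apply_eq w
    rw [apply_slice_of_homothetic hfg hc, apply_slice_of_homothetic hfg hc, hg.pairing_comm]
  nondegenerate y v hv := by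
    obtain ⟨Y, hY, rfl⟩ := exists_isSmoothVField_apply_eq v
    have h1 : prodField f 0 Y (f.symm (0, y)) = 0 := by
      refine hg.nondegenerate _ _ fun w => ?_
      obtain ⟨b, Z, hZ, rfl⟩ := exists_prodField_apply_eq f (f.symm (0, y)) w
      rw [apply_prodField_of_homothetic hfg, f.apply_symm_apply]
      simp [hv]
    have h2 := mfderiv_prodField f 0 Y (f.symm (0, y))
    rw [h1, map_zero, f.apply_symm_apply] at h2
    exact (congrArg Prod.snd h2).symm

theorem eq_zero_of_prodField_eq_zero {a : ℝ} {Y : VField J N} {y : N} {t : ℝ}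
    (hY : prodField f a Y (f.symm (t, y)) = 0) : Y y = 0 := by
  have h2 := mfderiv_prodField f a Y (f.symm (t, y))
  rw [hY, map_zero, f.apply_symm_apply] at h2
  exact (congrArg Prod.snd h2).symm

theorem isRiemannian_of_homothetic [T2Space N]
    (hfg : ∀ x, g x = c • pullback I f (warpedProduct (-1) h) x) (hc : 0 < c)
    (hg : IsLorentzian g) : IsRiemannian h where
  toIsPseudoRiemannian := isPseudoRiemannian_of_homothetic hfg hc hg.toIsPseudoRiemannian
  pos y v hv := by
    obtain ⟨Y, hY, rfl⟩ := exists_isSmoothVField_apply_eq v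
    rw [apply_slice_of_homothetic hfg hc]
    refine mul_pos (inv_pos.2 hc) ?_
    refine hg.pos_of_orthogonal (v := prodField f 1 0 (f.symm (0, y))) ?_ ?_ fun h0 =>
      hv (eq_zero_of_prodField_eq_zero h0)
    · rw [apply_prodField_of_homothetic hfg]
      simp [hc]
    · rw [apply_prodField_of_homothetic hfg]
      simp

theorem isLorentzian_of_homothetic [T2Space N]
    (hfg : ∀ x, g x = c • pullback I f (warpedProduct 1 h) x) (hc : 0 < c)
    (hg : IsLorentzian g) : IsLorentzian h where
  toIsPseudoRiemannian := isPseudoRiemannian_of_homothetic hfg hc hg.toIsPseudoRiemannian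
  index_one y := by
    obtain ⟨v₀, hv₀, -⟩ := hg.index_one (f.symm (0, y))
    obtain ⟨a, Y, hY, rfl⟩ := exists_prodField_apply_eq f (f.symm (0, y)) v₀
    rw [apply_prodField_of_homothetic hfg, f.apply_symm_apply] at hv₀
    simp only [mul_zero, Real.exp_zero, one_mul] at hv₀
    have hYY : h y (Y y) (Y y) < 0 := by
      have h1 := neg_of_mul_neg_right hv₀ hc.le
      nlinarith [mul_self_nonneg a]
    refine ⟨Y y, hYY, fun w hYw hw => ?_⟩
    obtain ⟨Z, hZ, rfl⟩ := exists_isSmoothVField_apply_eq w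
    rw [apply_slice_of_homothetic hfg hc]
    refine mul_pos (inv_pos.2 hc) ?_
    refine hg.pos_of_orthogonal (v := prodField f 0 Y (f.symm (0, y))) ?_ ?_ fun h0 =>
      hw (eq_zero_of_prodField_eq_zero h0)
    · rw [apply_slice_of_homothetic hfg hc] at hYY
      exact neg_of_mul_neg_right hYY (inv_pos.2 hc).le
    · rw [apply_slice_of_homothetic hfg hc] at hYw
      exact (mul_eq_zero.1 hYw).resolve_left (inv_pos.2 hc).ne'

end Signature

section Splitting

variable {E : Type u} [NormedAddCommGroup E] [NormedSpace ℝ E] [FiniteDimensional ℝ E]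
  {M : Type v} [TopologicalSpace M] [ChartedSpace E M] [IsManifold 𝓘(ℝ, E) ∞ M]
  {F : Type*} [NormedAddCommGroup F] [NormedSpace ℝ F] [FiniteDimensional ℝ F]
  {g : BilinField 𝓘(ℝ, E) M}
  {D : CovariantDerivative 𝓘(ℝ, E) E (TangentSpace 𝓘(ℝ, E) : M → Type _)}
  {ξ : VField 𝓘(ℝ, E) M} {S : TrilinField 𝓘(ℝ, E) M}

/-- Multiplication of the first factor of `ℝ × N` by a nonzero number. -/
noncomputable def scaleFst (N : Type*) [TopologicalSpace N] [ChartedSpace F N] {a : ℝ}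
    (ha : a ≠ 0) :
    Diffeomorph (𝓘(ℝ, ℝ).prod 𝓘(ℝ, F)) (𝓘(ℝ, ℝ).prod 𝓘(ℝ, F)) (ℝ × N) (ℝ × N) ∞ :=
  (ContinuousLinearEquiv.toDiffeomorph
    (ContinuousLinearEquiv.smulLeft (M₁ := ℝ) (Units.mk0 a ha))).prodCongr
    (Diffeomorph.refl 𝓘(ℝ, F) N ∞)

theorem eq_prodField_of_isMIntegralCurve {N : Type*} [TopologicalSpace N] [ChartedSpace F N]
    [IsManifold 𝓘(ℝ, F) ∞ N] (f : Diffeomorph 𝓘(ℝ, E) (𝓘(ℝ, ℝ).prod 𝓘(ℝ, F)) M (ℝ × N) ∞) {a : ℝ}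
    {γ : ℝ → N → M} (hγ : ∀ y, IsMIntegralCurve (fun s => γ s y) ξ)
    (hfγ : ∀ s y, f (γ s y) = (a * s, y)) (hsurj : ∀ x, ∃ s y, γ s y = x) :
    ξ = prodField f a 0 := by
  funext x
  obtain ⟨s, y, rfl⟩ := hsurj x
  apply (f.mfderivToContinuousLinearEquiv (by simp) _).injective
  change mfderiv 𝓘(ℝ, E) (𝓘(ℝ, ℝ).prod 𝓘(ℝ, F)) f (γ s y) _ =
    mfderiv 𝓘(ℝ, E) (𝓘(ℝ, ℝ).prod 𝓘(ℝ, F)) f (γ s y) _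
  rw [mfderiv_prodField]
  refine Prod.ext ?_ ?_
  · refine (mvfderiv_fst_comp f _ _).symm.trans ?_
    have h1 := hasDerivAt_comp_isMIntegralCurve (hγ y) (f := fun x => (f x).1) (t := s)
      ((contMDiff_fst_comp f).mdifferentiableAt (by simp))
    have h2 : HasDerivAt (fun s => (f (γ s y)).1) a s := by
      simp only [hfγ]
      simpa using (hasDerivAt_id s).const_mul a
    exact h1.unique h2
  · refine (mfderiv_snd_comp f _ _).symm.trans ?_
    have h1 := ((contMDiff_snd_comp f).mdifferentiableAt (x := γ s y) (by simp)).hasMFDerivAt.comp s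
      (hγ y s)
    have h2 : ((fun x => (f x).2) ∘ fun s => γ s y) = fun _ => y := by
      funext s
      simp [hfγ]
    rw [h2] at h1
    have h3 := h1.mfderiv
    rw [mfderiv_const] at h3
    have h4 := DFunLike.congr_fun h3 (1 : ℝ)
    refine Eq.trans ?_ h4.symm
    change _ = mfderiv 𝓘(ℝ, E) 𝓘(ℝ, F) (fun x => (f x).2) (γ s y) ((1 : ℝ) • ξ (γ s y))
    rw [one_smul]

theorem IsParallelTwistorFree.exists_warpedProduct (h : IsParallelTwistorFree g D ξ S) [T2Space M]
    [SecondCountableTopology M] [SimplyConnectedSpace M]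
    (hE : Module.finrank ℝ E = Module.finrank ℝ F + 1) (hF : 1 ≤ Module.finrank ℝ F)
    (hξ : IsCompleteVField ξ) {ε : ℝ} (hε : ε = 1 ∨ ε = -1)
    (hpos : ∀ x, 0 < ε * g x (ξ x) (ξ x)) :
    ∃ (N : Type v) (_ : TopologicalSpace N) (_ : T2Space N) (_ : SecondCountableTopology N)
      (_ : ChartedSpace F N) (_ : IsManifold 𝓘(ℝ, F) ∞ N) (k : BilinField 𝓘(ℝ, F) N) (c : ℝ)
      (f : Diffeomorph 𝓘(ℝ, E) (𝓘(ℝ, ℝ).prod 𝓘(ℝ, F)) M (ℝ × N) ∞), 0 < c ∧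
      ∀ x, g x = c • pullback 𝓘(ℝ, E) f (warpedProduct ε k) x := by
  have hE2 : 2 ≤ Module.finrank ℝ E := by omega
  have hlpc : LocallyPathConnectedSpace M := ChartedSpace.locallyPathConnectedSpace E M
  obtain ⟨q, hq⟩ := h.exists_apply_self_eq hE2
  obtain ⟨φ, hφ, hdφ⟩ := (h.isClosedOneForm hE2).exists_primitive
  obtain ⟨x₀⟩ := (inferInstance : Nonempty M)
  have hεε : ε * ε = 1 := by rcases hε with rfl | rfl <;> norm_num
  have ha : 0 < ε * q := hq x₀ ▸ hpos x₀
  set a := ε * q with ha_def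
  have hqa : q = ε * a := by rw [ha_def, ← mul_assoc, hεε, one_mul]
  have hq0 : q ≠ 0 := by
    rintro rfl
    simp [ha_def] at ha
  obtain ⟨N, tN, t2N, scN, csN, mN, Ψ, hΨ, hφΨ⟩ := exists_flow_diffeomorph (F := F) hE hφ
    h.smooth_vfield hξ (fun x => (hdφ x _).trans (hq x)) hq0
  let f := Ψ.symm.trans (scaleFst (F := F) N ha.ne')
  have hfΨ : ∀ s y, f (Ψ (s, y)) = (a * s, y) := by
    intro s y
    change scaleFst (F := F) N ha.ne' (Ψ.symm (Ψ (s, y))) = _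
    rw [Ψ.symm_apply_apply]
    rfl
  have hsurj : ∀ x, ∃ s y, Ψ (s, y) = x := fun x =>
    ⟨(Ψ.symm x).1, (Ψ.symm x).2, Ψ.apply_symm_apply x⟩
  have hξf : ξ = prodField f a 0 :=
    eq_prodField_of_isMIntegralCurve f (γ := fun s y => Ψ (s, y)) hΨ hfΨ hsurj
  have hφf : ∀ x, φ x = ε * (f x).1 := by
    intro x
    obtain ⟨s, y, rfl⟩ := hsurj x
    rw [hφΨ, hfΨ, hqa]
    ring
  have hθ : ∀ (Y : VField 𝓘(ℝ, F) N) (x : M), g x (ξ x) (prodField f 0 Y x) = 0 := by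
    intro Y x
    rw [← hdφ, funext hφf, mvfderiv_comp_fst_prodField f (k := fun t => ε * t) x
      (by fun_prop), zero_mul]
  have hgrow : ∀ {Y Z : VField 𝓘(ℝ, F) N}, IsSmoothVField Y → IsSmoothVField Z → ∀ s y,
      pairing g (prodField f 0 Y) (prodField f 0 Z) (Ψ (s, y)) =
        Real.exp (2 * q * s) * pairing g (prodField f 0 Y) (prodField f 0 Z) (Ψ (0, y)) := by
    intro Y Z hY hZ s y
    have hYs := isSmoothVField_prodField f 0 hY
    have hZs := isSmoothVField_prodField f 0 hZ
    have hbr : ∀ {Y : VField 𝓘(ℝ, F) N}, IsSmoothVField Y →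
        mlieBracket 𝓘(ℝ, E) ξ (prodField f 0 Y) = 0 := by
      intro Y hY
      rw [hξf, mlieBracket_prodField f a 0 isSmoothVField_zero hY, mlieBracket_zero_left]
      have := prodField_const_smul f 0 0 (0 : VField 𝓘(ℝ, F) N)
      simpa using this
    have h1 : ∀ s, HasDerivAt (fun s => Real.exp (-(2 * q * s)) *
        pairing g (prodField f 0 Y) (prodField f 0 Z) (Ψ (s, y))) 0 s := by
      intro s
      have h2 := hasDerivAt_comp_isMIntegralCurve (hΨ y) (t := s)
        ((h.pseudo.contMDiff_pairing hYs hZs).mdifferentiableAt (by simp))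
      rw [h.mvfderiv_pairing_of_commute hE2 hYs hZs (hbr hY) (hbr hZ) (hθ Y) (hθ Z), hq] at h2
      have h3 := (((hasDerivAt_id s).const_mul (2 * q)).neg.exp).mul h2
      refine h3.congr_deriv ?_
      simp only [id]
      ring
    have h2 := is_const_of_deriv_eq_zero (fun s => (h1 s).differentiableAt)
      (fun s => (h1 s).deriv) s 0
    simp only [mul_zero, neg_zero, Real.exp_zero, one_mul] at h2
    rw [← h2, ← mul_assoc, ← Real.exp_add]
    simp
  let ι : N → M := fun y => f.symm (0, y)
  have hι : ContMDiff 𝓘(ℝ, F) 𝓘(ℝ, E) ∞ ι :=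
    f.symm.contMDiff.comp (contMDiff_const.prodMk contMDiff_id)
  have hdι : ∀ (Y : VField 𝓘(ℝ, F) N) (y : N),
      mfderiv 𝓘(ℝ, F) 𝓘(ℝ, E) ι y (Y y) = prodField f 0 Y (ι y) := by
    intro Y y
    have hιd := hι.mdifferentiableAt (x := y) (by simp)
    apply (f.mfderivToContinuousLinearEquiv (by simp) _).injective
    change mfderiv 𝓘(ℝ, E) (𝓘(ℝ, ℝ).prod 𝓘(ℝ, F)) f (ι y) _ =
      mfderiv 𝓘(ℝ, E) (𝓘(ℝ, ℝ).prod 𝓘(ℝ, F)) f (ι y) _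
    rw [mfderiv_prodField]
    have hfι : ∀ y, f (ι y) = (0, y) := fun y => f.apply_symm_apply (0, y)
    refine Prod.ext ?_ ?_
    · refine (mvfderiv_fst_comp f _ _).symm.trans ?_
      have h1 := mfderiv_comp_apply y
        ((contMDiff_fst_comp f).mdifferentiableAt (x := ι y) (by simp)) hιd (Y y)
      have h2 : ((fun x => (f x).1) ∘ ι) = fun _ => 0 := funext fun y => by simp [hfι]
      rw [h2, mfderiv_const] at h1
      exact h1.symm
    · refine (mfderiv_snd_comp f _ _).symm.trans ?_
      have h1 := mfderiv_comp_apply y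
        ((contMDiff_snd_comp f).mdifferentiableAt (x := ι y) (by simp)) hιd (Y y)
      have h2 : ((fun x => (f x).2) ∘ ι) = id := funext fun y => by simp [hfι]
      rw [h2, mfderiv_id] at h1
      exact h1.symm.trans (congrArg (fun z => (Y z : F)) (congrArg Prod.snd (hfι y))).symm
  refine ⟨N, tN, t2N, scN, csN, mN, fun y => a • pullback 𝓘(ℝ, F) ι g y, a⁻¹, f, inv_pos.2 ha, ?_⟩
  intro x
  ext v w
  obtain ⟨b, Y, hY, rfl⟩ := exists_prodField_apply_eq f x v
  obtain ⟨b', Z, hZ, rfl⟩ := exists_prodField_apply_eq f x w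
  have hsplit : ∀ (b : ℝ) (Y : VField 𝓘(ℝ, F) N), prodField f b Y x
      = (b / a) • ξ x + prodField f 0 Y x := by
    intro b Y
    have h1 := prodField_const_smul f (b / a) a (0 : VField 𝓘(ℝ, F) N)
    rw [div_mul_cancel₀ _ ha.ne', ← hξf, smul_zero] at h1
    have h2 := prodField_add f b 0 0 Y
    rw [add_zero, zero_add, h1] at h2
    exact congrFun h2 x
  change _ = a⁻¹ * pullback 𝓘(ℝ, E) f (warpedProduct ε _) x (prodField f b Y x) (prodField f b' Z x)
  rw [pullback_warpedProduct_prodField]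
  have hk : (a • pullback 𝓘(ℝ, F) ι g (f x).2) (Y (f x).2) (Z (f x).2)
      = a * pairing g (prodField f 0 Y) (prodField f 0 Z) (ι (f x).2) := by
    rw [pairing, ← hdι, ← hdι]
    rfl
  refine Eq.trans ?_ (congrArg (fun r => a⁻¹ * (ε * (b * b')
    + Real.exp (2 * ε * (f x).1) * r)) hk.symm)
  rw [hsplit b Y, hsplit b' Z]
  simp only [map_add, map_smul, add_apply, smul_apply, smul_eq_mul, hq, hθ,
    h.pseudo.symm x (prodField f 0 Y x) (ξ x)]
  obtain ⟨s, y, rfl⟩ := hsurj x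
  have h3 : ι y = Ψ (0, y) := by
    rw [← f.symm_apply_apply (Ψ (0, y)), hfΨ, mul_zero]
  have h4 := hgrow hY hZ s y
  rw [hfΨ, h3]
  rw [pairing] at h4
  rw [h4, hqa]
  have h5 : 2 * ε * (a * s) = 2 * (ε * a) * s := by ring
  rw [h5]
  field_simp
  ring

end Splitting

section ThreeFormZero

variable {E : Type*} [NormedAddCommGroup E] [NormedSpace ℝ E] [FiniteDimensional ℝ E]
  {H : Type*} [TopologicalSpace H] {I : ModelWithCorners ℝ E H}
  {M : Type*} [TopologicalSpace M] [ChartedSpace H M] [IsManifold I ∞ M]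

/-- The zero 3-form. -/
noncomputable def zeroTrilinField : TrilinField I M := fun _ => (0 : E →L[ℝ] E →L[ℝ] E →L[ℝ] ℝ)

theorem zeroTrilinField_apply (x : M) (u v w : TangentSpace I x) :
    zeroTrilinField x u v w = 0 := rfl

theorem isThreeForm_zeroTrilinField : IsThreeForm (zeroTrilinField : TrilinField I M) where
  smooth _ _ _ _ _ _ := contMDiff_const
  swap_left _ _ _ _ := by simp [zeroTrilinField_apply]
  swap_right _ _ _ _ := by simp [zeroTrilinField_apply]

theorem isParallelForm_zeroTrilinField
    (D : CovariantDerivative I E (TangentSpace I : M → Type _)) :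
    IsParallelForm D zeroTrilinField := by
  intro Y Z W _ _ _ x v
  simp only [zeroTrilinField_apply, mvfderiv_const, zero_apply, add_zero]

theorem sigma_zeroTrilinField {g : BilinField I M} (hg : IsPseudoRiemannian g) (x : M)
    (u v w : TangentSpace I x) : sigma g zeroTrilinField x u v w = 0 := by
  have h1 : ∀ u v, raise g zeroTrilinField x u v = 0 := fun u v =>
    hg.nondegenerate x _ fun w => by rw [raise, sharp_spec hg, zeroTrilinField_apply]
  simp only [sigma, h1, add_zero]

end ThreeFormZero

section VectorialTorsion

variable {E : Type*} [NormedAddCommGroup E] [NormedSpace ℝ E] [FiniteDimensional ℝ E]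
  {H : Type*} [TopologicalSpace H] {I : ModelWithCorners ℝ E H}
  {M : Type*} [TopologicalSpace M] [ChartedSpace H M] [IsManifold I ∞ M]
  {g : BilinField I M} {D : CovariantDerivative I E (TangentSpace I : M → Type _)}
  {ξ : VField I M}

/-- The endomorphism-valued 1-form `Y ↦ (X ↦ g(X, Y) ξ - g(Y, ξ) X)`. -/
noncomputable def vectorialForm (g : BilinField I M) (ξ : VField I M) (x : M) :
    TangentSpace I x →L[ℝ] TangentSpace I x →L[ℝ] TangentSpace I x :=
  let b : E →L[ℝ] E →L[ℝ] ℝ := g x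
  let v : E := ξ x
  ((ContinuousLinearMap.smulRightL ℝ E E).flip v ∘L b
    - (b v).smulRight (ContinuousLinearMap.id ℝ E) : E →L[ℝ] E →L[ℝ] E)

/-- The metric connection with vectorial torsion given by `ξ`:
`∇_X Y = ∇ᵍ_X Y + g(X, Y) ξ - g(Y, ξ) X`. -/
noncomputable def vectorialConnection (hg : IsPseudoRiemannian g) (ξ : VField I M) :
    CovariantDerivative I E (TangentSpace I : M → Type _) :=
  (leviCivita hg).addOneForm (vectorialForm g ξ)

theorem vectorialConnection_apply (hg : IsPseudoRiemannian g) (Y : VField I M) (x : M)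
    (v : TangentSpace I x) :
    vectorialConnection hg ξ Y x v
      = leviCivita hg Y x v + g x (Y x) v • ξ x - g x (ξ x) (Y x) • v := by
  rw [add_sub_assoc]
  rfl

theorem isMetricConnection_vectorialConnection [T2Space M] (hg : IsPseudoRiemannian g)
    (hξ : IsSmoothVField ξ) : IsMetricConnection g (vectorialConnection hg ξ) where
  smooth := by
    refine ⟨⟨fun {Y} hY => ?_⟩⟩
    have hY' : IsSmoothVField Y := by
      rw [contMDiffOn_univ] at hY
      exact hY
    rw [contMDiffOn_univ]
    refine contMDiff_homField fun V hV => ?_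
    have h1 : (fun x => vectorialConnection hg ξ Y x (V x)) = fun x =>
        leviCivita hg Y x (V x) + pairing g Y V x • ξ x - pairing g ξ Y x • V x :=
      funext fun x => vectorialConnection_apply hg Y x (V x)
    refine h1 ▸ ?_
    exact ((isSmoothVField_connection (isLeviCivita_leviCivita hg).smooth hY' hV).add
      (hξ.smul (hg.contMDiff_pairing hY' hV))).sub_section (hV.smul (hg.contMDiff_pairing hξ hY'))
  metric Y Z hY hZ x v := by
    rw [(isLeviCivita_leviCivita hg).metric Y Z hY hZ, vectorialConnection_apply,
      vectorialConnection_apply]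
    simp only [map_add, map_sub, map_smul, add_apply, sub_apply, smul_apply, smul_eq_mul]
    rw [hg.symm x (Y x) (ξ x), hg.symm x v (Z x)]
    ring

theorem torsion_vectorialConnection [T2Space M] (hg : IsPseudoRiemannian g) (x : M)
    (u v : TangentSpace I x) :
    (vectorialConnection hg ξ).torsion x u v = g x u (ξ x) • v - g x v (ξ x) • u := by
  obtain ⟨X, hX, rfl⟩ := exists_isSmoothVField_apply_eq u
  obtain ⟨Y, hY, rfl⟩ := exists_isSmoothVField_apply_eq v
  have h1 := (isLeviCivita_leviCivita hg).torsion_free x (X x) (Y x)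
  rw [(leviCivita hg).torsion_apply (hX.mdifferentiableAt x) (hY.mdifferentiableAt x),
    sub_eq_zero] at h1
  rw [(vectorialConnection hg ξ).torsion_apply (hX.mdifferentiableAt x) (hY.mdifferentiableAt x),
    vectorialConnection_apply, vectorialConnection_apply, ← h1, hg.symm x (X x) (ξ x),
    hg.symm x (Y x) (ξ x), hg.symm x (Y x) (X x)]
  module

theorem isTwistorFreeWith_vectorialConnection [T2Space M] (hg : IsPseudoRiemannian g) :
    IsTwistorFreeWith g (vectorialConnection hg ξ) ξ :=
  ⟨zeroTrilinField, isThreeForm_zeroTrilinField, fun x u v w => by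
    rw [torsion_vectorialConnection, zeroTrilinField_apply, add_zero]⟩

theorem hasParallelTorsion_vectorialConnection [T2Space M] (hg : IsPseudoRiemannian g)
    (hξ : IsSmoothVField ξ) (hD : ∀ x v, vectorialConnection hg ξ ξ x v = 0) :
    HasParallelTorsion (vectorialConnection hg ξ) := by
  intro Y Z hY hZ x v
  set D := vectorialConnection hg ξ with hDdef
  have hT : (fun y => D.torsion y (Y y) (Z y)) =
      pairing g Y ξ • Z + (-pairing g Z ξ) • Y := by
    funext y
    rw [torsion_vectorialConnection, sub_eq_add_neg, ← neg_smul]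
    rfl
  have hmd : ∀ {Y : VField I M}, IsSmoothVField Y →
      MDifferentiableAt I 𝓘(ℝ, ℝ) (pairing g Y ξ) x :=
    fun hY => (hg.contMDiff_pairing hY hξ).mdifferentiableAt (by simp)
  have hdp : ∀ {Y : VField I M}, IsSmoothVField Y →
      mvfderiv I (pairing g Y ξ) x v = g x (D Y x v) (ξ x) := by
    intro Y hY
    have h1 := (isMetricConnection_vectorialConnection hg hξ).metric Y ξ hY hξ x v
    rw [hD, map_zero, add_zero] at h1
    exact h1
  have hYx := hY.mdifferentiableAt x
  have hZx := hZ.mdifferentiableAt x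
  have hZ' : MDifferentiableAt I 𝓘(ℝ, ℝ) (-pairing g Z ξ) x := (hmd hZ).neg
  rw [hT, D.isCovariantDerivativeOnUniv.add ((hmd hY).smul_section hZx) (hZ'.smul_section hYx),
    D.isCovariantDerivativeOnUniv.leibniz hZx (hmd hY),
    D.isCovariantDerivativeOnUniv.leibniz hYx hZ', mvfderiv_neg,
    torsion_vectorialConnection, torsion_vectorialConnection]
  simp only [add_apply, smul_apply, ContinuousLinearMap.smulRight_apply, neg_apply, hdp hY, hdp hZ,
    Pi.neg_apply]
  simp only [pairing]
  change g x (Y x) (ξ x) • D Z x v + _ + (-g x (Z x) (ξ x) • D Y x v + _) = _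
  module

end VectorialTorsion

section WarpedProduct

variable {E : Type*} [NormedAddCommGroup E] [NormedSpace ℝ E] [FiniteDimensional ℝ E]
  {H : Type*} [TopologicalSpace H] {I : ModelWithCorners ℝ E H} [I.Boundaryless]
  {M : Type*} [TopologicalSpace M] [ChartedSpace H M] [IsManifold I ∞ M] [T2Space M]
  {F : Type*} [NormedAddCommGroup F] [NormedSpace ℝ F] [FiniteDimensional ℝ F]
  {H' : Type*} [TopologicalSpace H'] {J : ModelWithCorners ℝ F H'} [J.Boundaryless]
  {N : Type*} [TopologicalSpace N] [ChartedSpace H' N] [IsManifold J ∞ N] [T2Space N]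
  {g : BilinField I M} {h : BilinField J N} {c ε : ℝ}
  {f : Diffeomorph I (𝓘(ℝ, ℝ).prod J) M (ℝ × N) ∞}

theorem prodField_zero_zero : prodField f 0 (0 : VField J N) = 0 := by
  simpa using prodField_const_smul f 0 0 (0 : VField J N)

theorem mlieBracket_prodField_zero_left (a b : ℝ) {Z : VField J N} (hZ : IsSmoothVField Z) :
    mlieBracket I (prodField f a 0) (prodField f b Z) = 0 := by
  rw [mlieBracket_prodField f a b isSmoothVField_zero hZ, mlieBracket_zero_left,
    prodField_zero_zero]

theorem pairing_vfield_prodField (hfg : ∀ x, g x = c • pullback I f (warpedProduct ε h) x)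
    (hc : 0 < c) (b : ℝ) (Z : VField J N) :
    pairing g (prodField f c⁻¹ 0) (prodField f b Z) = fun _ => ε * b := by
  funext x
  rw [pairing, apply_prodField_of_homothetic hfg]
  simp only [Pi.zero_apply, map_zero, zero_apply, mul_zero, add_zero]
  field_simp

theorem mvfderiv_pairing_prodField (hg : IsPseudoRiemannian g)
    (hfg : ∀ x, g x = c • pullback I f (warpedProduct ε h) x) (hc : 0 < c) (a b : ℝ)
    {Y Z : VField J N} (hY : IsSmoothVField Y) (hZ : IsSmoothVField Z) (x : M) :
    mvfderiv I (pairing g (prodField f a Y) (prodField f b Z)) x (prodField f c⁻¹ 0 x)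
      = 2 * ε * Real.exp (2 * ε * (f x).1) * h (f x).2 (Y (f x).2) (Z (f x).2) := by
  have hh := isPseudoRiemannian_of_homothetic hfg hc hg
  have hdh := (hh.contMDiff_pairing hY hZ).mdifferentiableAt (x := (f x).2) (by simp)
  have hde : DifferentiableAt ℝ (fun t => Real.exp (2 * ε * t)) (f x).1 := by fun_prop
  have h1 : pairing g (prodField f a Y) (prodField f b Z) =
      (fun _ => c * (ε * (a * b))) + (fun _ => c) * ((fun x => (fun t => Real.exp (2 * ε * t)) (f x).1)
        * fun x => pairing h Y Z (f x).2) := by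
    funext x
    rw [pairing, apply_prodField_of_homothetic hfg, mul_add]
    rfl
  have hd1 : MDifferentiableAt I 𝓘(ℝ, ℝ) (fun x => (fun t => Real.exp (2 * ε * t)) (f x).1) x :=
    MDifferentiableAt.comp (g := fun t => Real.exp (2 * ε * t)) x hde.mdifferentiableAt ((contMDiff_fst_comp f).mdifferentiableAt (by simp))
  have hd2 : MDifferentiableAt I 𝓘(ℝ, ℝ) (fun x => pairing h Y Z (f x).2) x :=
    hdh.comp x ((contMDiff_snd_comp f).mdifferentiableAt (by simp))
  have hderiv : deriv (fun t => Real.exp (2 * ε * t)) (f x).1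
      = Real.exp (2 * ε * (f x).1) * (2 * ε) := by
    have := (((hasDerivAt_id (f x).1).const_mul (2 * ε)).exp).deriv
    simpa using this
  rw [h1, mvfderiv_add mdifferentiableAt_const (mdifferentiableAt_const.mul (hd1.mul hd2)),
    mvfderiv_mul mdifferentiableAt_const (hd1.mul hd2), mvfderiv_mul hd1 hd2, mvfderiv_const,
    mvfderiv_const]
  simp only [add_apply, smul_apply, zero_apply, smul_eq_mul]
  rw [mvfderiv_comp_fst_prodField f x hde, mvfderiv_comp_snd_prodField f x hdh, hderiv]
  simp only [Pi.zero_apply, map_zero, pairing]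
  field_simp
  ring

theorem vectorialConnection_prodField_eq_zero (hg : IsPseudoRiemannian g)
    (hfg : ∀ x, g x = c • pullback I f (warpedProduct ε h) x) (hc : 0 < c) (x : M)
    (v : TangentSpace I x) :
    vectorialConnection hg (prodField f c⁻¹ 0) (prodField f c⁻¹ 0) x v = 0 := by
  refine hg.nondegenerate x _ fun w => ?_
  obtain ⟨a, Y, hY, rfl⟩ := exists_prodField_apply_eq f x v
  obtain ⟨b, Z, hZ, rfl⟩ := exists_prodField_apply_eq f x w
  have hξ : IsSmoothVField (prodField f c⁻¹ 0) := isSmoothVField_prodField f _ isSmoothVField_zero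
  have hYs := isSmoothVField_prodField f a hY
  have hZs := isSmoothVField_prodField f b hZ
  have hp := fun (b : ℝ) (Z : VField J N) => pairing_vfield_prodField hfg hc b Z
  have h1 := apply_leviCivitaFun hg (hξ.mdifferentiableAt x) (hYs.mdifferentiableAt x)
    (hZs.mdifferentiableAt x)
  have hb := congrFun (hp 0 (mlieBracket J Y Z)) x
  rw [pairing] at hb
  rw [koszul, hp, hg.pairing_comm (prodField f a Y) (prodField f c⁻¹ 0), hp,
    mvfderiv_pairing_prodField hg hfg hc a b hY hZ, mlieBracket_swap_apply (V := prodField f a Y),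
    mlieBracket_prodField_zero_left _ _ hY, mlieBracket_prodField_zero_left _ _ hZ,
    mlieBracket_prodField f a b hY hZ, hg.symm x _ (prodField f c⁻¹ 0 x), hb,
    mvfderiv_const, mvfderiv_const] at h1
  rw [vectorialConnection_apply]
  have h2 : ∀ (b : ℝ) (Z : VField J N), g x (prodField f c⁻¹ 0 x) (prodField f b Z x) = ε * b :=
    fun b Z => congrFun (hp b Z) x
  simp only [map_add, map_sub, map_smul, add_apply, sub_apply, smul_apply, smul_eq_mul, h2]
  change g x (leviCivitaFun hg (prodField f c⁻¹ 0) x (prodField f a Y x)) (prodField f b Z x)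
    + _ - _ = _
  rw [h1, apply_prodField_of_homothetic hfg]
  simp only [zero_apply, Pi.zero_apply, neg_zero, map_zero]
  field_simp
  ring

theorem prodField_apply_symm (a : ℝ) (Y : VField J N) (p : ℝ × N) :
    prodField f a Y (f.symm p) = mfderiv (𝓘(ℝ, ℝ).prod J) I f.symm p ((a, Y p.2) : ℝ × F) := by
  apply (f.mfderivToContinuousLinearEquiv (by simp) _).injective
  change mfderiv I (𝓘(ℝ, ℝ).prod J) f (f.symm p) _ = mfderiv I (𝓘(ℝ, ℝ).prod J) f (f.symm p) _
  have h1 := mfderiv_comp_apply p (f.contMDiff.mdifferentiableAt (x := f.symm p) (by simp))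
    (f.symm.contMDiff.mdifferentiableAt (x := p) (by simp)) ((a, Y p.2) : ℝ × F)
  have h2 : f ∘ f.symm = id := funext f.apply_symm_apply
  rw [h2, mfderiv_id] at h1
  rw [mfderiv_prodField]
  refine Eq.trans ?_ h1
  exact congrArg (fun z : ℝ × N => ((a, Y z.2) : ℝ × F)) (f.apply_symm_apply p)

theorem isCompleteVField_prodField (f : Diffeomorph I (𝓘(ℝ, ℝ).prod J) M (ℝ × N) ∞) (a : ℝ) :
    IsCompleteVField (prodField f a (0 : VField J N)) := by
  intro x
  refine ⟨fun s => f.symm ((f x).1 + a * s, (f x).2), by simp, fun s => ?_⟩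
  have h1 : HasFDerivAt (fun s => (f x).1 + a * s) (a • (1 : ℝ →L[ℝ] ℝ)) s := by
    have h0 := ((hasFDerivAt_id (𝕜 := ℝ) s).const_mul a).const_add (f x).1
    exact h0
  have h2 := h1.hasMFDerivAt.prodMk (hasMFDerivAt_const (I := 𝓘(ℝ, ℝ)) (I' := J) (f x).2 s)
  have h3 := (f.symm.contMDiff.mdifferentiableAt (x := ((f x).1 + a * s, (f x).2))
    (by simp)).hasMFDerivAt.comp s h2
  have h4 : prodField f a 0 (f.symm ((f x).1 + a * s, (f x).2)) = _ :=
    prodField_apply_symm (f := f) a (0 : VField J N) _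
  refine h3.congr_mfderiv ?_
  refine ContinuousLinearMap.ext_ring ?_
  refine Eq.trans ?_ (one_smul ℝ _).symm
  rw [h4]
  refine congrArg (mfderiv (𝓘(ℝ, ℝ).prod J) I f.symm ((f x).1 + a * s, (f x).2)) ?_
  refine Prod.ext ?_ rfl
  exact mul_one a

end WarpedProduct

end TwistorFree

theorem mainTheorem3 (n : ℕ) (hn : 1 ≤ n)
    (M : Type u) [TopologicalSpace M] [T2Space M] [SecondCountableTopology M]
    [SimplyConnectedSpace M]
    [ChartedSpace (EuclideanSpace ℝ (Fin (n + 1))) M] [IsManifold (𝓡 (n + 1)) ∞ M]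
    (g : TwistorFree.BilinField (𝓡 (n + 1)) M) (hg : TwistorFree.IsLorentzian g)
    (ε : ℝ) (hε : ε = 1 ∨ ε = -1) :
    (∃ (D : CovariantDerivative (𝓡 (n + 1)) (EuclideanSpace ℝ (Fin (n + 1)))
          (TangentSpace (𝓡 (n + 1)) : M → Type _))
        (ξ : TwistorFree.VField (𝓡 (n + 1)) M),
      TwistorFree.IsMetricConnection g D ∧
      TwistorFree.HasParallelTorsion D ∧
      TwistorFree.IsSmoothVField ξ ∧
      TwistorFree.IsTwistorFreeWith g D ξ ∧
      TwistorFree.IsCompleteVField ξ ∧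
      ∀ x : M, 0 < ε * g x (ξ x) (ξ x))
    ↔
    (∃ (N : Type u) (_ : TopologicalSpace N) (_ : T2Space N) (_ : SecondCountableTopology N)
        (_ : ChartedSpace (EuclideanSpace ℝ (Fin n)) N) (_ : IsManifold (𝓡 n) ∞ N)
        (h : TwistorFree.BilinField (𝓡 n) N) (τ : TwistorFree.TrilinField (𝓡 n) N),
      (ε = -1 → TwistorFree.IsRiemannian h) ∧
      (ε = 1 → TwistorFree.IsLorentzian h) ∧
      TwistorFree.IsThreeForm τ ∧
      TwistorFree.IsLeviCivitaParallel h τ ∧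
      (∀ (y : N) (u v w : TangentSpace (𝓡 n) y), TwistorFree.sigma h τ y u v w = 0) ∧
      TwistorFree.IsHomothetic g (TwistorFree.warpedProduct ε h)) := by
  constructor
  · rintro ⟨D, ξ, hD, hT, hξ, ⟨S, hS, hcomp⟩, hcompl, hpos⟩
    have h : TwistorFree.IsParallelTwistorFree g D ξ S :=
      { toIsMetricConnection := hD
        pseudo := hg.toIsPseudoRiemannian
        parallel := hT
        smooth_vfield := hξ
        three_form := hS
        components := hcomp
        nonnull := fun x => right_ne_zero_of_mul (hpos x).ne' }
    obtain ⟨N, tN, t2N, scN, csN, mN, k, c, f, hc, hgf⟩ :=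
      h.exists_warpedProduct (F := EuclideanSpace ℝ (Fin n)) (by simp) (by simpa using hn)
        hcompl hε hpos
    have hk := TwistorFree.isPseudoRiemannian_of_homothetic hgf hc hg.toIsPseudoRiemannian
    refine ⟨N, tN, t2N, scN, csN, mN, k, TwistorFree.zeroTrilinField, ?_, ?_,
      TwistorFree.isThreeForm_zeroTrilinField,
      ⟨TwistorFree.leviCivita hk, TwistorFree.isLeviCivita_leviCivita hk,
        TwistorFree.isParallelForm_zeroTrilinField _⟩,
      TwistorFree.sigma_zeroTrilinField hk, c, f, hc, hgf⟩
    · rintro rfl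
      exact TwistorFree.isRiemannian_of_homothetic hgf hc hg
    · rintro rfl
      exact TwistorFree.isLorentzian_of_homothetic hgf hc hg
  · rintro ⟨N, tN, t2N, -, csN, mN, k, -, -, -, -, -, -, c, f, hc, hgf⟩
    have hξ : TwistorFree.IsSmoothVField (TwistorFree.prodField f c⁻¹ 0) :=
      TwistorFree.isSmoothVField_prodField f _ TwistorFree.isSmoothVField_zero
    have hg' := hg.toIsPseudoRiemannian
    refine ⟨TwistorFree.vectorialConnection hg' (TwistorFree.prodField f c⁻¹ 0),
      TwistorFree.prodField f c⁻¹ 0, TwistorFree.isMetricConnection_vectorialConnection hg' hξ,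
      TwistorFree.hasParallelTorsion_vectorialConnection hg' hξ
        (TwistorFree.vectorialConnection_prodField_eq_zero hg' hgf hc), hξ,
      TwistorFree.isTwistorFreeWith_vectorialConnection hg',
      TwistorFree.isCompleteVField_prodField f _, fun x => ?_⟩
    have h1 := congrFun (TwistorFree.pairing_vfield_prodField hgf hc c⁻¹ 0) x
    rw [TwistorFree.pairing] at h1
    rw [h1, ← mul_assoc]
    rcases hε with rfl | rfl <;> simpa using hc
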